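/- There is an absolute constant $c>0$ such that the following holds. Let $G$ be a finite group with $|G|\ge 3$ and let $A\subset G$ contain no non-trivial solutions to $xz=y^2$, i.e. whenever $x,y,z\in A$ satisfy $xz=y^2$ we have $x=y$. Then $$|A|\le \frac{|G|}{(\log\log|G|)^{c}}.$$ -/

import Mathlib

/-! Let `A` have density `α` in `G` and no nontrivial solution of `xz = y²`. Solutions can be looked
for inside three kinds of subgroup, so each kind is constrained in terms of `α`; a group constrained
in all three ways has bounded order.

Quasirandom normal subgroups. Let `K` be normal and nontrivial, with no nontrivial isometric real
representation of dimension at most `D`. On a coset `gK` in which `A` is dense, `(ga)(gb) = (gc)²`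
reads `φ(a) b = φ(c) c` with `φ` conjugation by `g⁻¹`. Gowers mixing (`OnlyTrivialReps.card_mul_le`)
produces too many solutions unless `α³ D ≤ 4` (`density_le_of_quasirandom`).

Abelian normal subgroups. On `gN` the triple `g c (g d g⁻¹)`, `g c`, `g c d⁻¹` is a solution;
additively it is a progression `c + θ d, c, c - d` twisted by an automorphism `θ`. A density
increment on Bohr sets bounds `|N|` by a double exponential in `α⁻³` (`card_le_of_twisted_roth`).

Elementary abelian subgroups, not necessarily normal. The map `(x, y) ↦ x⁻¹ g y` sends corners in `H
× H` to solutions. A quantitative corners theorem, by density increment on products of uniform sets,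
gives `|H| ≤ p ^ exp(O(α⁻⁴⁸))` (`card_le_of_corner_free`).

Group theory combines these in `card_le_of_structure`. Subgroups without small representations have
a normal join with the same property, so by the first constraint every nontrivial subgroup has a
nontrivial representation of dimension `O(α⁻³)`. A maximal abelian normal subgroup `Z` is small.
Above it lies a maximal normal `X` of class at most two with `Z` central, small because its abelian
subgroups have small rank and exponent dividing `|Z|²`. Conjugation on `X` has kernel `C = C_G(X)`,
and `C/Z` contains no nontrivial abelian subgroup normal in `G/Z`, so it acts faithfully on a family
of commuting nonabelian simple subgroups. These are small by a Jordan-type commutator argument, and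
few because elements of order `p` in them lift to commuting elements.

The outcome is `log |G| ≤ exp(O(α⁻⁴⁸))`. The final exponent `1/96`, rather than `1/48`, leaves room
for the constant, and groups of bounded order are handled by `|A| < |G|`. -/

open Finset in
/-- Unnormalised Fourier transform on a finite abelian group. -/
noncomputable def fourierSum {N : Type*} [AddCommGroup N] [Fintype N] (f : N → ℂ)
    (γ : AddChar N ℂ) : ℂ := ∑ x, f x * γ x

/-! ### Fourier analysis on finite abelian groups. -/

section Fourier

open Finset ComplexConjugate

variable {N : Type*} [AddCommGroup N] [Fintype N]

lemma fourierSum_inversion (f : N → ℂ) (x : N) :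
    ∑ γ : AddChar N ℂ, fourierSum f γ * conj (γ x) = Fintype.card N * f x := by
  classical
  simp only [fourierSum, sum_mul]
  rw [sum_comm]
  have : ∀ y, ∑ γ : AddChar N ℂ, f y * γ y * conj (γ x)
      = f y * (if y - x = 0 then (Fintype.card N : ℂ) else 0) := by
    intro y
    rw [← AddChar.sum_apply_eq_ite, mul_sum]
    refine sum_congr rfl fun γ _ => ?_
    rw [sub_eq_add_neg, AddChar.map_add_eq_mul, AddChar.map_neg_eq_conj, mul_assoc]
  simp only [this, sub_eq_zero]
  simp [mul_comm]

lemma fourierSum_parseval (f : N → ℂ) :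
    ∑ γ : AddChar N ℂ, ‖fourierSum f γ‖ ^ 2 = Fintype.card N * ∑ x, ‖f x‖ ^ 2 := by
  have key : ∑ γ : AddChar N ℂ, fourierSum f γ * conj (fourierSum f γ)
      = Fintype.card N * ∑ x, f x * conj (f x) := by
    have : ∀ γ : AddChar N ℂ, fourierSum f γ * conj (fourierSum f γ)
        = ∑ x, conj (f x) * (fourierSum f γ * conj (γ x)) := by
      intro γ
      conv_lhs => rw [fourierSum, map_sum, ← fourierSum, mul_sum]
      refine sum_congr rfl fun x _ => ?_
      rw [map_mul]; ring
    simp only [this]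
    rw [sum_comm, mul_sum]
    refine sum_congr rfl fun x _ => ?_
    rw [← mul_sum, fourierSum_inversion]; ring
  simp only [Complex.mul_conj, Complex.normSq_eq_norm_sq] at key
  exact_mod_cast key

/-- A trilinear form along `τ c - θ b` is controlled by the Fourier transform of one function. -/
lemma norm_trilinear_le (θ : N ≃+ N) (τ : N →+ N) (u v w : N → ℂ) (S : ℝ)
    (hS : ∀ γ, ‖fourierSum v γ‖ ≤ S) :
    ‖∑ c, ∑ b, u (τ c - θ b) * v c * w b‖
      ≤ S * Real.sqrt (∑ x, ‖u x‖ ^ 2) * Real.sqrt (∑ x, ‖w x‖ ^ 2) := by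
  classical
  have hN : (0 : ℝ) < Fintype.card N := by exact_mod_cast Fintype.card_pos
  have hS0 : 0 ≤ S := (norm_nonneg _).trans (hS 0)
  let pull : AddChar N ℂ → AddChar N ℂ := fun γ => γ.compAddMonoidHom θ.toAddMonoidHom
  -- Inverting `u` decouples the variables: each character evaluated at `τ c - θ b` splits into a
  -- function of `c` times a function of `b`.
  have key : (Fintype.card N : ℂ) * ∑ c, ∑ b, u (τ c - θ b) * v c * w b
      = ∑ γ : AddChar N ℂ, fourierSum u γ * fourierSum v ((-γ).compAddMonoidHom τ) *
          fourierSum w (pull γ) := by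
    have h1 : ∀ γ : AddChar N ℂ, fourierSum u γ * fourierSum v ((-γ).compAddMonoidHom τ) *
          fourierSum w (pull γ)
        = ∑ c, ∑ b, (fourierSum u γ * conj (γ (τ c - θ b))) * v c * w b := by
      intro γ
      rw [fourierSum.eq_1 v, fourierSum.eq_1 w, mul_assoc, sum_mul_sum, mul_sum]
      refine sum_congr rfl fun c _ => ?_
      rw [mul_sum]
      refine sum_congr rfl fun b _ => ?_
      have : conj (γ (τ c - θ b)) = conj (γ (τ c)) * γ (θ b) := by
        rw [← AddChar.map_neg_eq_conj, ← AddChar.map_neg_eq_conj, ← AddChar.map_add_eq_mul]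
        congr 1; abel
      rw [this]
      simp only [pull, AddChar.compAddMonoidHom_apply, AddChar.neg_apply, AddChar.map_neg_eq_conj]
      simp only [AddEquiv.toAddMonoidHom_eq_coe, AddMonoidHom.coe_coe]
      ring
    simp only [h1]
    symm
    rw [sum_comm, mul_sum]
    refine sum_congr rfl fun c _ => ?_
    rw [sum_comm, mul_sum]
    refine sum_congr rfl fun b _ => ?_
    rw [← sum_mul, ← sum_mul, fourierSum_inversion]; ring
  -- Invertibility of `θ` makes pulling back along it a permutation of the dual, so Parseval applies
  -- to the reindexed transform of `w`. Nothing is needed of `τ`, since `v` enters only through the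
  -- bound `S`.
  have hpull : Function.Bijective pull := by
    rw [Fintype.bijective_iff_injective_and_card]
    exact ⟨AddChar.compAddMonoidHom_injective_left _ θ.surjective, rfl⟩
  have hw : ∑ γ : AddChar N ℂ, ‖fourierSum w (pull γ)‖ ^ 2 = Fintype.card N * ∑ x, ‖w x‖ ^ 2 := by
    rw [← fourierSum_parseval]
    exact hpull.sum_comp (fun γ : AddChar N ℂ => ‖fourierSum w γ‖ ^ 2)
  have hcs : ∑ γ : AddChar N ℂ, ‖fourierSum u γ‖ * ‖fourierSum w (pull γ)‖
      ≤ Fintype.card N * (Real.sqrt (∑ x, ‖u x‖ ^ 2) * Real.sqrt (∑ x, ‖w x‖ ^ 2)) := by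
    refine (Real.sum_mul_le_sqrt_mul_sqrt _ _ _).trans ?_
    rw [fourierSum_parseval, hw, Real.sqrt_mul hN.le, Real.sqrt_mul hN.le]
    refine le_of_eq ?_
    have := Real.mul_self_sqrt hN.le
    linear_combination (Real.sqrt (∑ x, ‖u x‖ ^ 2) * Real.sqrt (∑ x, ‖w x‖ ^ 2)) * this
  have : (Fintype.card N : ℝ) * ‖∑ c, ∑ b, u (τ c - θ b) * v c * w b‖
      ≤ Fintype.card N * (S * Real.sqrt (∑ x, ‖u x‖ ^ 2) * Real.sqrt (∑ x, ‖w x‖ ^ 2)) := by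
    calc (Fintype.card N : ℝ) * ‖∑ c, ∑ b, u (τ c - θ b) * v c * w b‖
        = ‖(Fintype.card N : ℂ) * ∑ c, ∑ b, u (τ c - θ b) * v c * w b‖ := by
          rw [norm_mul, Complex.norm_natCast]
      _ ≤ ∑ γ : AddChar N ℂ, S * (‖fourierSum u γ‖ * ‖fourierSum w (pull γ)‖) := by
          rw [key]
          refine (norm_sum_le _ _).trans (sum_le_sum fun γ _ => ?_)
          rw [norm_mul, norm_mul]
          have := hS ((-γ).compAddMonoidHom τ)
          calc _ ≤ ‖fourierSum u γ‖ * S * ‖fourierSum w (pull γ)‖ := by gcongr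
            _ = _ := by ring
      _ ≤ _ := by
          rw [← mul_sum]
          calc _ ≤ S * (Fintype.card N *
                (Real.sqrt (∑ x, ‖u x‖ ^ 2) * Real.sqrt (∑ x, ‖w x‖ ^ 2))) := by gcongr
            _ = _ := by ring
  exact le_of_mul_le_mul_left this hN

/-- If the autocorrelation of a balanced bounded function is large in mean square, then the
function has large averages on the cosets of the kernel of a nontrivial character. -/
lemma exists_char_of_autocorrelation (g : N → ℝ) (hg : ∑ x, g x = 0) (hg1 : ∀ x, |g x| ≤ 1)
    (η : ℝ) (hη : 0 ≤ η)
    (h : η * (Fintype.card N : ℝ) ^ 3 < ∑ t, (∑ x, g x * g (x + t)) ^ 2) :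
    ∃ γ : AddChar N ℂ, γ ≠ 0 ∧
      η * (Fintype.card N : ℝ) ^ 2 ≤ ‖fourierSum (fun x => (g x : ℂ)) γ‖ ^ 2 := by
  by_contra! hcon
  set n : ℝ := (Fintype.card N : ℝ) with hn
  have hN : (0 : ℝ) < n := by simp only [hn]; exact_mod_cast Fintype.card_pos
  set G : N → ℂ := fun x => (g x : ℂ) with hG
  set r : N → ℂ := fun t => ((∑ x, g x * g (x + t) : ℝ) : ℂ) with hr
  -- The autocorrelation has transform `|ĝ|²`, so by Parseval the hypothesis is a lower bound on the
  -- fourth moment of `ĝ`. The second moment is at most `n²` and the trivial coefficient vanishes,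
  -- so some nontrivial coefficient is large.
  have hr' : ∀ γ, ‖fourierSum r γ‖ = ‖fourierSum G γ‖ ^ 2 := by
    intro γ
    have : fourierSum r γ = conj (fourierSum G γ) * fourierSum G γ := by
      simp only [fourierSum, hr, hG, map_sum, Complex.ofReal_sum, Complex.ofReal_mul, sum_mul_sum]
      simp only [sum_mul]
      rw [sum_comm]
      refine sum_congr rfl fun x _ => ?_
      conv_rhs => rw [← Equiv.sum_comp (Equiv.addLeft x)]
      refine sum_congr rfl fun t _ => ?_
      simp only [Equiv.coe_addLeft, map_mul, Complex.conj_ofReal, AddChar.map_add_eq_mul]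
      have : conj (γ x) * γ x = 1 := by
        rw [← AddChar.map_neg_eq_conj, ← AddChar.map_add_eq_mul]; simp
      linear_combination (-(g x : ℂ) * (g (x + t)) * γ t) * this
    rw [this, norm_mul, RCLike.norm_conj, sq]
  have hbound : ∀ γ, ‖fourierSum G γ‖ ^ 2 ≤ η * n ^ 2 := by
    intro γ
    by_cases hγ : γ = 0
    · subst hγ
      have : fourierSum G 0 = 0 := by
        simp only [fourierSum, hG, AddChar.zero_apply, mul_one]
        exact_mod_cast congrArg (fun t : ℝ => (t : ℂ)) hg
      rw [this]; simp; positivity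
    · exact (hcon γ hγ).le
  have h1 := fourierSum_parseval r
  have h2 := fourierSum_parseval G
  have h3 : ∑ x, ‖G x‖ ^ 2 ≤ n := by
    calc ∑ x, ‖G x‖ ^ 2 ≤ ∑ _x : N, (1 : ℝ) := by
          refine sum_le_sum fun x _ => ?_
          simp only [hG, Complex.norm_real, Real.norm_eq_abs]
          exact pow_le_one₀ (abs_nonneg _) (hg1 x)
      _ = n := by simp [hn]
  have h4 : n * ∑ t, (∑ x, g x * g (x + t)) ^ 2 ≤ η * n ^ 2 * (n * n) := by
    have e1 : ∑ t, ‖r t‖ ^ 2 = ∑ t, (∑ x, g x * g (x + t)) ^ 2 := by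
      refine sum_congr rfl fun t _ => ?_
      simp only [hr, Complex.norm_real, Real.norm_eq_abs, sq_abs]
    rw [← e1, ← h1]
    calc ∑ γ, ‖fourierSum r γ‖ ^ 2 ≤ ∑ γ, η * n ^ 2 * ‖fourierSum G γ‖ ^ 2 := by
          refine sum_le_sum fun γ _ => ?_
          rw [hr', sq (‖fourierSum G γ‖ ^ 2)]
          exact mul_le_mul_of_nonneg_right (hbound γ) (by positivity)
      _ = η * n ^ 2 * (n * ∑ x, ‖G x‖ ^ 2) := by rw [← mul_sum, h2]
      _ ≤ _ := by gcongr
  have h5 : n * (η * n ^ 3) < n * ∑ t, (∑ x, g x * g (x + t)) ^ 2 :=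
    mul_lt_mul_of_pos_left h hN
  nlinarith

end Fourier

/-! ### The corner form and its reduction to a weighted box form. -/

section Corners

open Finset

/-- Cauchy-Schwarz that discards `a` but keeps the majorant `w` as a weight, so the sparsity of the
support of `a` is not lost. -/
lemma sq_sum_mul_le_of_abs_le {ι : Type*} (s : Finset ι) (a b w : ι → ℝ)
    (h : ∀ i ∈ s, |a i| ≤ w i) :
    (∑ i ∈ s, a i * b i) ^ 2 ≤ (∑ i ∈ s, w i) * ∑ i ∈ s, w i * b i ^ 2 := by
  have hw : ∀ i ∈ s, 0 ≤ w i := fun i hi => (abs_nonneg _).trans (h i hi)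
  have h1 : |∑ i ∈ s, a i * b i| ≤ ∑ i ∈ s, w i * |b i| := by
    refine (abs_sum_le_sum_abs _ _).trans (sum_le_sum fun i hi => ?_)
    rw [abs_mul]
    exact mul_le_mul_of_nonneg_right (h i hi) (abs_nonneg _)
  calc (∑ i ∈ s, a i * b i) ^ 2 = |∑ i ∈ s, a i * b i| ^ 2 := (sq_abs _).symm
    _ ≤ (∑ i ∈ s, w i * |b i|) ^ 2 := by gcongr
    _ ≤ _ := by
      refine sum_sq_le_sum_mul_sum_of_sq_le_mul s hw
        (fun i hi => mul_nonneg (hw i hi) (sq_nonneg _)) fun i _ => ?_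
      rw [mul_pow, sq_abs]; exact le_of_eq (by ring)

variable {W : Type*} [AddCommGroup W] [Fintype W]

/-- The autocorrelation of a function on a finite abelian group. -/
def autocorr (E : W → ℝ) (t : W) : ℝ := ∑ x, E x * E (x + t)

/-- The weight with which a box `(x, x') × (y, y')` is counted after two applications of
Cauchy-Schwarz to the corner form. -/
def boxWeight (E₁ E₂ : W → ℝ) (x x' y y' : W) : ℝ :=
  ∑ z, E₂ (z - x) * E₂ (z - x') * (E₁ (z - y) * E₁ (z - y'))

lemma sum_sub_left (f : W → ℝ) (a : W) : ∑ z, f (z - a) = ∑ z, f z :=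
  Equiv.sum_comp (Equiv.subRight a) f

lemma sum_mul_sub (E : W → ℝ) (x x' : W) :
    ∑ z, E (z - x) * E (z - x') = autocorr E (x - x') := by
  rw [autocorr, ← Equiv.sum_comp (Equiv.subRight x) (fun y => E y * E (y + (x - x')))]
  refine sum_congr rfl fun z _ => ?_
  simp

lemma sum_autocorr (E : W → ℝ) : ∑ t, autocorr E t = (∑ x, E x) ^ 2 := by
  simp only [autocorr]
  rw [sum_comm, sq, sum_mul]
  refine sum_congr rfl fun x _ => ?_
  rw [← mul_sum]
  congr 1
  exact Equiv.sum_comp (Equiv.addLeft x) E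

lemma sum_boxWeight (E₁ E₂ : W → ℝ) :
    ∑ x, ∑ x', ∑ y, ∑ y', boxWeight E₁ E₂ x x' y y'
      = Fintype.card W * ((∑ x, E₁ x) ^ 2 * (∑ x, E₂ x) ^ 2) := by
  have h : ∀ z : W, ∑ x, ∑ x', ∑ y, ∑ y', E₂ (z - x) * E₂ (z - x') * (E₁ (z - y) * E₁ (z - y'))
      = (∑ x, E₁ x) ^ 2 * (∑ x, E₂ x) ^ 2 := by
    intro z
    simp only [← mul_sum, ← sum_mul]
    have h1 : ∀ E : W → ℝ, ∑ x, E (z - x) = ∑ x, E x := fun E =>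
      Equiv.sum_comp (Equiv.subLeft z) E
    simp only [h1]; ring
  calc _ = ∑ z, ∑ x, ∑ x', ∑ y, ∑ y',
        E₂ (z - x) * E₂ (z - x') * (E₁ (z - y) * E₁ (z - y')) := by
        simp only [boxWeight]
        rw [sum_comm]
        conv_rhs => rw [sum_comm]
        rw [sum_comm]
        refine sum_congr rfl fun x _ => ?_
        conv_rhs => rw [sum_comm]
        refine sum_congr rfl fun x' _ => ?_
        conv_rhs => rw [sum_comm]
        refine sum_congr rfl fun y _ => ?_
        conv_rhs => rw [sum_comm]
    _ = _ := by simp only [h]; simp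

/-- Expanding the square introduces two centres `z, z'`; for fixed centres each of the four vertex
sums is an autocorrelation at `z' - z`. -/
lemma sum_boxWeight_sq (E₁ E₂ : W → ℝ) :
    ∑ x, ∑ x', ∑ y, ∑ y', boxWeight E₁ E₂ x x' y y' ^ 2
      = Fintype.card W * ∑ t, autocorr E₁ t ^ 2 * autocorr E₂ t ^ 2 := by
  have h : ∀ z z' : W, ∑ x, ∑ x', ∑ y, ∑ y',
      (E₂ (z - x) * E₂ (z - x') * (E₁ (z - y) * E₁ (z - y'))) *
      (E₂ (z' - x) * E₂ (z' - x') * (E₁ (z' - y) * E₁ (z' - y')))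
      = autocorr E₁ (z' - z) ^ 2 * autocorr E₂ (z' - z) ^ 2 := by
    intro z z'
    have h1 : ∀ E : W → ℝ, ∑ x, E (z - x) * E (z' - x) = autocorr E (z' - z) := by
      intro E
      rw [autocorr, ← Equiv.sum_comp (Equiv.subLeft z) (fun y => E y * E (y + (z' - z)))]
      refine sum_congr rfl fun x _ => ?_
      simp
    calc _ = ∑ x, ∑ x', ∑ y, ∑ y',
      ((E₂ (z - x) * E₂ (z' - x)) * (E₂ (z - x') * E₂ (z' - x'))) *
      ((E₁ (z - y) * E₁ (z' - y)) * (E₁ (z - y') * E₁ (z' - y'))) := by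
          refine sum_congr rfl fun x _ => sum_congr rfl fun x' _ => sum_congr rfl fun y _ =>
            sum_congr rfl fun y' _ => ?_
          ring
      _ = _ := by
          simp only [← mul_sum, ← sum_mul, h1]; ring
  calc _ = ∑ x, ∑ x', ∑ y, ∑ y', ∑ z, ∑ z',
      (E₂ (z - x) * E₂ (z - x') * (E₁ (z - y) * E₁ (z - y'))) *
      (E₂ (z' - x) * E₂ (z' - x') * (E₁ (z' - y) * E₁ (z' - y'))) := by
        simp only [boxWeight, sq, sum_mul_sum]
    _ = ∑ z, ∑ z', ∑ x, ∑ x', ∑ y, ∑ y',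
      (E₂ (z - x) * E₂ (z - x') * (E₁ (z - y) * E₁ (z - y'))) *
      (E₂ (z' - x) * E₂ (z' - x') * (E₁ (z' - y) * E₁ (z' - y'))) := by
        simp only [← Fintype.sum_prod_type']
        let e : (W × W × W × W × W × W) ≃ (W × W × W × W × W × W) :=
          ⟨fun p => (p.2.2.2.2.1, p.2.2.2.2.2, p.1, p.2.1, p.2.2.1, p.2.2.2.1),
           fun p => (p.2.2.1, p.2.2.2.1, p.2.2.2.2.1, p.2.2.2.2.2, p.1, p.2.1),
           fun _ => rfl, fun _ => rfl⟩
        exact Fintype.sum_equiv e _ _ fun _ => rfl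
    _ = ∑ z : W, ∑ z' : W, autocorr E₁ (z' - z) ^ 2 * autocorr E₂ (z' - z) ^ 2 := by
        simp only [h]
    _ = _ := by
        have : ∀ z : W, ∑ z' : W, autocorr E₁ (z' - z) ^ 2 * autocorr E₂ (z' - z) ^ 2
            = ∑ t, autocorr E₁ t ^ 2 * autocorr E₂ t ^ 2 := fun z =>
          Equiv.sum_comp (Equiv.subRight z) (fun t => autocorr E₁ t ^ 2 * autocorr E₂ t ^ 2)
        simp only [this]; simp

/-- The total mass of the weight in the second Cauchy-Schwarz step of `corner_form_pow_four_le`. -/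
lemma sum_autocorr_mul (E₁ E₂ : W → ℝ) :
    ∑ x, ∑ x', ∑ z, E₁ x * E₁ x' * (E₂ (z - x) * E₂ (z - x'))
      = ∑ t, autocorr E₁ t * autocorr E₂ t := by
  simp only [← mul_sum, sum_mul_sub]
  rw [sum_comm]
  have : ∀ x' : W, ∑ x, E₁ x * E₁ x' * autocorr E₂ (x - x')
      = ∑ t, E₁ x' * E₁ (x' + t) * autocorr E₂ t := by
    intro x'
    rw [← Equiv.sum_comp (Equiv.addLeft x')]
    refine sum_congr rfl fun t _ => ?_
    simp only [Equiv.coe_addLeft, add_sub_cancel_left]; ring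
  simp only [this]
  rw [sum_comm]
  refine sum_congr rfl fun t _ => ?_
  rw [← sum_mul, autocorr.eq_1 E₁]

/-- Two applications of Cauchy-Schwarz to the form counting corners. -/
lemma corner_form_pow_four_le (E₁ E₂ : W → ℝ) (h₁ : ∀ x, E₁ x = 0 ∨ E₁ x = 1)
    (h₂ : ∀ x, E₂ x = 0 ∨ E₂ x = 1) (f A B : W → W → ℝ)
    (hf : ∀ x y, |f x y| ≤ E₁ x * E₂ y) (hA : ∀ x y, |A x y| ≤ E₁ x * E₂ y)
    (hB : ∀ x y, |B x y| ≤ E₁ x * E₂ y) :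
    (∑ x, ∑ y, ∑ z, f x y * A (z - y) y * B x (z - x)) ^ 4
      ≤ ((∑ x, E₁ x) * ∑ x, E₂ x) ^ 2 * (∑ t, autocorr E₁ t * autocorr E₂ t) *
        ∑ x, ∑ x', ∑ y, ∑ y', f x y * f x' y * f x y' * f x' y' * boxWeight E₁ E₂ x x' y y' := by
  have p₁ : ∀ x, 0 ≤ E₁ x := fun x => by rcases h₁ x with h | h <;> simp [h]
  have p₂ : ∀ x, 0 ≤ E₂ x := fun x => by rcases h₂ x with h | h <;> simp [h]
  have q₁ : ∀ x, E₁ x ≤ 1 := fun x => by rcases h₁ x with h | h <;> simp [h]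
  have hfE : ∀ x y, E₂ y * f x y = f x y := by
    intro x y
    rcases h₂ y with h | h
    · have := hf x y; rw [h, mul_zero, abs_nonpos_iff] at this; simp [h, this]
    · simp [h]
  set M₂ := ∑ x, ∑ x', ∑ y, ∑ y',
    f x y * f x' y * f x y' * f x' y' * boxWeight E₁ E₂ x x' y y' with hM₂
  -- With `z = x + y + d`, the points `(z - y, y)` and `(x, z - x)` are the other two vertices of
  -- the corner based at `(x, y)`.
  set T := ∑ x, ∑ y, ∑ z, f x y * A (z - y) y * B x (z - x) with hT
  set T₂ := ∑ x, ∑ x', ∑ z, (B x (z - x) * B x' (z - x')) *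
    ∑ y, E₁ (z - y) * (f x y * f x' y) with hT₂
  -- Cauchy-Schwarz over `(y, z)` discards `A` and doubles `x`.
  have step1 : T ^ 2 ≤ ((∑ x, E₁ x) * ∑ x, E₂ x) * T₂ := by
    have e1 : T = ∑ p : W × W, A (p.2 - p.1) p.1 * ∑ x, f x p.1 * B x (p.2 - x) := by
      rw [Fintype.sum_prod_type, hT, sum_comm]
      refine sum_congr rfl fun y _ => ?_
      rw [sum_comm]
      refine sum_congr rfl fun z _ => ?_
      rw [mul_sum]
      exact sum_congr rfl fun x _ => by ring
    have e2 : ∑ p : W × W, E₁ (p.2 - p.1) * E₂ p.1 = (∑ x, E₁ x) * ∑ x, E₂ x := by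
      rw [Fintype.sum_prod_type]
      simp only [← sum_mul, sum_sub_left]
      rw [← mul_sum]
    have e3 : ∑ p : W × W, (E₁ (p.2 - p.1) * E₂ p.1) * (∑ x, f x p.1 * B x (p.2 - x)) ^ 2
        = T₂ := by
      rw [Fintype.sum_prod_type, hT₂]
      simp only [sq, sum_mul_sum]
      simp only [mul_sum]
      simp only [← Fintype.sum_prod_type']
      let e : (W × W × W × W) ≃ (W × W × W × W) :=
        ⟨fun p => (p.2.2.1, p.2.2.2, p.2.1, p.1), fun p => (p.2.2.2, p.2.2.1, p.1, p.2.1),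
          fun _ => rfl, fun _ => rfl⟩
      refine Fintype.sum_equiv e _ _ fun p => ?_
      obtain ⟨y, z, x, x'⟩ := p
      simp only [e, Equiv.coe_fn_mk]
      linear_combination (E₁ (z - y) * B x (z - x) * B x' (z - x') * f x' y) * hfE x y
    rw [e1, ← e2, ← e3]
    exact sq_sum_mul_le_of_abs_le _ _ _ _ fun p _ => hA _ _
  -- Cauchy-Schwarz over `(x, x', z)` discards both copies of `B` and doubles `y`.
  have step2 : T₂ ^ 2 ≤ (∑ t, autocorr E₁ t * autocorr E₂ t) * M₂ := by
    have e1 : T₂ = ∑ p : (W × W) × W, (B p.1.1 (p.2 - p.1.1) * B p.1.2 (p.2 - p.1.2)) *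
        ∑ y, E₁ (p.2 - y) * (f p.1.1 y * f p.1.2 y) := by
      rw [Fintype.sum_prod_type, Fintype.sum_prod_type]
    have e2 : ∑ p : (W × W) × W, E₁ p.1.1 * E₁ p.1.2 * (E₂ (p.2 - p.1.1) * E₂ (p.2 - p.1.2))
        = ∑ t, autocorr E₁ t * autocorr E₂ t := by
      rw [Fintype.sum_prod_type, Fintype.sum_prod_type, sum_autocorr_mul]
    have e3 : ∑ p : (W × W) × W, (E₂ (p.2 - p.1.1) * E₂ (p.2 - p.1.2)) *
        (∑ y, E₁ (p.2 - y) * (f p.1.1 y * f p.1.2 y)) ^ 2 = M₂ := by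
      rw [Fintype.sum_prod_type, Fintype.sum_prod_type, hM₂]
      simp only [boxWeight, sq, sum_mul_sum]
      simp only [mul_sum]
      simp only [← Fintype.sum_prod_type']
      let e : (W × W × W × W × W) ≃ (W × W × W × W × W) :=
        ⟨fun p => (p.1, p.2.1, p.2.2.2.1, p.2.2.2.2, p.2.2.1),
          fun p => (p.1, p.2.1, p.2.2.2.2, p.2.2.1, p.2.2.2.1), fun _ => rfl, fun _ => rfl⟩
      refine Fintype.sum_equiv e _ _ fun p => ?_
      obtain ⟨x, x', z, y, y'⟩ := p
      simp only [e, Equiv.coe_fn_mk]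
      ring
    have hB' : ∀ p ∈ (univ : Finset ((W × W) × W)),
        |B p.1.1 (p.2 - p.1.1) * B p.1.2 (p.2 - p.1.2)|
          ≤ E₁ p.1.1 * E₁ p.1.2 * (E₂ (p.2 - p.1.1) * E₂ (p.2 - p.1.2)) := by
      intro p _
      rw [abs_mul]
      calc _ ≤ (E₁ p.1.1 * E₂ (p.2 - p.1.1)) * (E₁ p.1.2 * E₂ (p.2 - p.1.2)) :=
            mul_le_mul (hB _ _) (hB _ _) (abs_nonneg _) (mul_nonneg (p₁ _) (p₂ _))
        _ = _ := by ring
    have hM1 : 0 ≤ ∑ t, autocorr E₁ t * autocorr E₂ t := by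
      rw [← e2]
      exact sum_nonneg fun p _ => by
        have := p₁ p.1.1; have := p₁ p.1.2; have := p₂ (p.2 - p.1.1); have := p₂ (p.2 - p.1.2)
        positivity
    refine (e1 ▸ sq_sum_mul_le_of_abs_le _ _ _ _ hB').trans ?_
    rw [e2]
    refine mul_le_mul_of_nonneg_left ?_ hM1
    rw [← e3]
    refine sum_le_sum fun p _ => mul_le_mul_of_nonneg_right ?_ (sq_nonneg _)
    -- This half of the weight can be dropped at no cost, `f` being supported where it equals one;
    -- what remains is exactly `boxWeight`.
    have h5 : E₁ p.1.1 * E₁ p.1.2 ≤ 1 := mul_le_one₀ (q₁ _) (p₁ _) (q₁ _)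
    have h6 : 0 ≤ E₂ (p.2 - p.1.1) * E₂ (p.2 - p.1.2) := mul_nonneg (p₂ _) (p₂ _)
    nlinarith
  have hT4 : T ^ 4 = (T ^ 2) ^ 2 := by ring
  rw [hT4]
  calc (T ^ 2) ^ 2 ≤ (((∑ x, E₁ x) * ∑ x, E₂ x) * T₂) ^ 2 :=
        pow_le_pow_left₀ (sq_nonneg _) step1 2
    _ = ((∑ x, E₁ x) * ∑ x, E₂ x) ^ 2 * T₂ ^ 2 := by ring
    _ ≤ ((∑ x, E₁ x) * ∑ x, E₂ x) ^ 2 * ((∑ t, autocorr E₁ t * autocorr E₂ t) * M₂) := by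
        gcongr
    _ = _ := by ring

end Corners

/-! ### The box form on uniform product sets, and rectangles of increased density. -/

section Corners

open Finset

variable {W : Type*} [AddCommGroup W] [Fintype W]

/-- The box form is bounded below by the corner form when both side sets are uniform. -/
lemma corner_form_pow_four_le_of_uniform (E₁ E₂ : W → ℝ) (h₁ : ∀ x, E₁ x = 0 ∨ E₁ x = 1)
    (h₂ : ∀ x, E₂ x = 0 ∨ E₂ x = 1) (f A B : W → W → ℝ)
    (hf : ∀ x y, |f x y| ≤ E₁ x * E₂ y) (hA : ∀ x y, |A x y| ≤ E₁ x * E₂ y)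
    (hB : ∀ x y, |B x y| ≤ E₁ x * E₂ y) (n e₁ e₂ ξ : ℝ) (hn : n = Fintype.card W)
    (he₁ : e₁ = ∑ x, E₁ x) (he₂ : e₂ = ∑ x, E₂ x) (hξ : 0 ≤ ξ)
    (hu₁ : ∑ t, (autocorr E₁ t - e₁ ^ 2 / n) ^ 2 ≤ ξ ^ 4 * n ^ 3)
    (hu₂ : ∑ t, (autocorr E₂ t - e₂ ^ 2 / n) ^ 2 ≤ ξ ^ 4 * n ^ 3) :
    (∑ x, ∑ y, ∑ z, f x y * A (z - y) y * B x (z - x)) ^ 4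
      ≤ (e₁ * e₂) ^ 2 * (e₁ ^ 2 * e₂ ^ 2 / n + ξ ^ 4 * n ^ 3) *
        (e₁ ^ 2 * e₂ ^ 2 / n ^ 3 * (∑ x, ∑ x', ∑ y, ∑ y', f x y * f x' y * f x y' * f x' y')
          + 2 * ξ * n ^ 5) := by
  have hn0 : 0 < n := by rw [hn]; exact_mod_cast Fintype.card_pos
  have p₁ : ∀ x, 0 ≤ E₁ x := fun x => by rcases h₁ x with h | h <;> simp [h]
  have p₂ : ∀ x, 0 ≤ E₂ x := fun x => by rcases h₂ x with h | h <;> simp [h]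
  have q₁ : ∀ x, E₁ x ≤ 1 := fun x => by rcases h₁ x with h | h <;> simp [h]
  have q₂ : ∀ x, E₂ x ≤ 1 := fun x => by rcases h₂ x with h | h <;> simp [h]
  have hcard : ∀ c : ℝ, ∑ _x : W, c = n * c := by intro c; simp [hn]
  have hae : ∀ E : W → ℝ, (∀ x, 0 ≤ E x) → (∀ x, E x ≤ 1) → ∀ t, 0 ≤ autocorr E t ∧
      autocorr E t ≤ n := by
    intro E hp hq t
    refine ⟨sum_nonneg fun x _ => mul_nonneg (hp _) (hp _), ?_⟩
    calc autocorr E t ≤ ∑ _x : W, (1 : ℝ) :=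
          sum_le_sum fun x _ => mul_le_one₀ (hq _) (hp _) (hq _)
      _ = n := by rw [hcard]; ring
  have hele : ∀ E : W → ℝ, (∀ x, 0 ≤ E x) → (∀ x, E x ≤ 1) → 0 ≤ ∑ x, E x ∧ ∑ x, E x ≤ n := by
    intro E hp hq
    refine ⟨sum_nonneg fun x _ => hp _, ?_⟩
    calc ∑ x, E x ≤ ∑ _x : W, (1 : ℝ) := sum_le_sum fun x _ => hq _
      _ = n := by rw [hcard]; ring
  obtain ⟨e₁0, e₁n⟩ := hele E₁ p₁ q₁
  obtain ⟨e₂0, e₂n⟩ := hele E₂ p₂ q₂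
  rw [← he₁] at e₁0 e₁n
  rw [← he₂] at e₂0 e₂n
  have hm : ∀ e : ℝ, 0 ≤ e → e ≤ n → 0 ≤ e ^ 2 / n ∧ e ^ 2 / n ≤ n := by
    intro e h0 h1
    refine ⟨by positivity, ?_⟩
    rw [div_le_iff₀ hn0]; nlinarith
  obtain ⟨m₁0, m₁n⟩ := hm e₁ e₁0 e₁n
  obtain ⟨m₂0, m₂n⟩ := hm e₂ e₂0 e₂n
  have hL1 : ∀ r : W → ℝ, ∑ t, r t ^ 2 ≤ ξ ^ 4 * n ^ 3 → ∑ t, |r t| ≤ ξ ^ 2 * n ^ 2 := by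
    intro r hr
    refine abs_le_of_sq_le_sq' ?_ (by positivity) |>.2
    have := sq_sum_le_card_mul_sum_sq (s := (univ : Finset W)) (f := fun t => |r t|)
    simp only [sq_abs, card_univ] at this
    rw [← hn] at this
    calc _ ≤ n * ∑ t, r t ^ 2 := this
      _ ≤ n * (ξ ^ 4 * n ^ 3) := by gcongr
      _ = _ := by ring
  have hr₁ := hL1 _ hu₁
  have hr₂ := hL1 _ hu₂
  -- the first moment
  have hsum1 : ∀ E : W → ℝ, ∀ e : ℝ, e = ∑ x, E x → ∑ t, (autocorr E t - e ^ 2 / n) = 0 := by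
    intro E e he
    rw [sum_sub_distrib, sum_autocorr, hcard, ← he]
    field_simp; ring
  -- The deviations of each autocorrelation from its mean sum to zero, so the cross terms vanish and
  -- only the product of deviations remains.
  have hM1 : ∑ t, autocorr E₁ t * autocorr E₂ t ≤ e₁ ^ 2 * e₂ ^ 2 / n + ξ ^ 4 * n ^ 3 := by
    have : ∀ t, autocorr E₁ t * autocorr E₂ t = e₁ ^ 2 / n * (e₂ ^ 2 / n)
        + e₁ ^ 2 / n * (autocorr E₂ t - e₂ ^ 2 / n) + e₂ ^ 2 / n * (autocorr E₁ t - e₁ ^ 2 / n)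
        + (autocorr E₁ t - e₁ ^ 2 / n) * (autocorr E₂ t - e₂ ^ 2 / n) := by intro t; ring
    simp only [this, sum_add_distrib, ← mul_sum, hsum1 E₁ e₁ he₁, hsum1 E₂ e₂ he₂, hcard]
    have h3 : ∑ t, (autocorr E₁ t - e₁ ^ 2 / n) * (autocorr E₂ t - e₂ ^ 2 / n)
        ≤ ξ ^ 4 * n ^ 3 := by
      calc _ ≤ ∑ t, ((autocorr E₁ t - e₁ ^ 2 / n) ^ 2 / 2
              + (autocorr E₂ t - e₂ ^ 2 / n) ^ 2 / 2) :=
            sum_le_sum fun t _ => by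
              nlinarith [sq_nonneg ((autocorr E₁ t - e₁ ^ 2 / n) - (autocorr E₂ t - e₂ ^ 2 / n))]
        _ ≤ _ := by
            rw [sum_add_distrib, ← sum_div, ← sum_div]; linarith
    have h4 : n * (e₁ ^ 2 / n * (e₂ ^ 2 / n)) = e₁ ^ 2 * e₂ ^ 2 / n := by field_simp
    linarith
  -- the variance of the weights
  set m : ℝ := e₁ ^ 2 * e₂ ^ 2 / n ^ 3 with hmdef
  -- `m` is the mean of `boxWeight` over all `n⁴` boxes, so the variance is the second moment minus
  -- `n⁴ m²`; uniformity makes the second moment close to that value.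
  have hvar : ∑ x, ∑ x', ∑ y, ∑ y', (boxWeight E₁ E₂ x x' y y' - m) ^ 2 ≤ 4 * ξ ^ 2 * n ^ 6 := by
    have e : ∀ x x' y y' : W, (boxWeight E₁ E₂ x x' y y' - m) ^ 2
        = boxWeight E₁ E₂ x x' y y' ^ 2 - 2 * m * boxWeight E₁ E₂ x x' y y' + m ^ 2 := by
      intros; ring
    simp only [e, sum_add_distrib, sum_sub_distrib, ← mul_sum, sum_boxWeight, sum_boxWeight_sq,
      hcard, ← he₁, ← he₂, ← hn]
    have h5 : ∑ t, autocorr E₁ t ^ 2 * autocorr E₂ t ^ 2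
        ≤ ∑ t, ((e₁ ^ 2 / n) ^ 2 * (e₂ ^ 2 / n) ^ 2
          + 2 * n ^ 3 * (|autocorr E₁ t - e₁ ^ 2 / n| + |autocorr E₂ t - e₂ ^ 2 / n|)) := by
      refine sum_le_sum fun t _ => ?_
      obtain ⟨a0, an⟩ := hae E₁ p₁ q₁ t
      obtain ⟨b0, bn⟩ := hae E₂ p₂ q₂ t
      set a := autocorr E₁ t
      set b := autocorr E₂ t
      have k1 : a - e₁ ^ 2 / n ≤ |a - e₁ ^ 2 / n| := le_abs_self _
      have k2 : b - e₂ ^ 2 / n ≤ |b - e₂ ^ 2 / n| := le_abs_self _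
      have k3 := abs_nonneg (a - e₁ ^ 2 / n)
      have k4 := abs_nonneg (b - e₂ ^ 2 / n)
      generalize |a - e₁ ^ 2 / n| = u at *
      generalize |b - e₂ ^ 2 / n| = v at *
      generalize e₁ ^ 2 / n = c at *
      generalize e₂ ^ 2 / n = d at *
      have k5 : a * b - c * d ≤ n * (u + v) := by
        have : a * b - c * d = a * (b - d) + d * (a - c) := by ring
        rw [this]
        have : a * (b - d) ≤ n * v :=
          (mul_le_mul_of_nonneg_left k2 a0).trans (mul_le_mul_of_nonneg_right an k4)
        have : d * (a - c) ≤ n * u :=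
          (mul_le_mul_of_nonneg_left k1 m₂0).trans (mul_le_mul_of_nonneg_right m₂n k3)
        linarith
      have k6 : a ^ 2 * b ^ 2 - c ^ 2 * d ^ 2 = (a * b - c * d) * (a * b + c * d) := by ring
      have k7 : a * b ≤ n * n := mul_le_mul an bn b0 hn0.le
      have k8 : c * d ≤ n * n := mul_le_mul m₁n m₂n m₂0 hn0.le
      have k9 : 0 ≤ a * b + c * d := by positivity
      have k10 : (a * b - c * d) * (a * b + c * d) ≤ (n * (u + v)) * (2 * (n * n)) := by
        calc _ ≤ (n * (u + v)) * (a * b + c * d) := mul_le_mul_of_nonneg_right k5 k9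
          _ ≤ _ := mul_le_mul_of_nonneg_left (by linarith) (by positivity)
      nlinarith
    rw [sum_add_distrib, hcard, ← mul_sum, sum_add_distrib] at h5
    have h6 : n * ∑ t, autocorr E₁ t ^ 2 * autocorr E₂ t ^ 2
        ≤ n * (n * ((e₁ ^ 2 / n) ^ 2 * (e₂ ^ 2 / n) ^ 2)
          + 2 * n ^ 3 * (ξ ^ 2 * n ^ 2 + ξ ^ 2 * n ^ 2)) := by
      refine mul_le_mul_of_nonneg_left (h5.trans ?_) hn0.le
      gcongr
    have h7 : n * (n * ((e₁ ^ 2 / n) ^ 2 * (e₂ ^ 2 / n) ^ 2)) = n ^ 4 * m ^ 2 := by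
      rw [hmdef]; field_simp
    have h8 : n * (e₁ ^ 2 * e₂ ^ 2) = n ^ 4 * m := by rw [hmdef]; field_simp
    rw [h8]
    nlinarith
  have hL1w : ∑ x, ∑ x', ∑ y, ∑ y', |boxWeight E₁ E₂ x x' y y' - m| ≤ 2 * ξ * n ^ 5 := by
    have := sq_sum_le_card_mul_sum_sq (s := (univ : Finset (W × W × W × W)))
      (f := fun p => |boxWeight E₁ E₂ p.1 p.2.1 p.2.2.1 p.2.2.2 - m|)
    simp only [sq_abs, card_univ, Fintype.sum_prod_type, Fintype.card_prod, Nat.cast_mul] at this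
    rw [← hn] at this
    refine abs_le_of_sq_le_sq' ?_ (by positivity) |>.2
    calc _ ≤ _ := this
      _ ≤ n * (n * (n * n)) * (4 * ξ ^ 2 * n ^ 6) := by gcongr
      _ = _ := by ring
  have hM2 : ∑ x, ∑ x', ∑ y, ∑ y',
      f x y * f x' y * f x y' * f x' y' * boxWeight E₁ E₂ x x' y y'
      ≤ m * (∑ x, ∑ x', ∑ y, ∑ y', f x y * f x' y * f x y' * f x' y') + 2 * ξ * n ^ 5 := by
    have hf1 : ∀ x y, |f x y| ≤ 1 := fun x y =>
      (hf x y).trans (mul_le_one₀ (q₁ _) (p₂ _) (q₂ _))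
    calc _ ≤ ∑ x, ∑ x', ∑ y, ∑ y', (m * (f x y * f x' y * f x y' * f x' y')
          + |boxWeight E₁ E₂ x x' y y' - m|) := by
          refine sum_le_sum fun x _ => sum_le_sum fun x' _ => sum_le_sum fun y _ =>
            sum_le_sum fun y' _ => ?_
          have h9 : |f x y * f x' y * f x y' * f x' y'| ≤ 1 := by
            simp only [abs_mul]
            refine mul_le_one₀ (mul_le_one₀ (mul_le_one₀ (hf1 _ _) (abs_nonneg _) (hf1 _ _))
              (abs_nonneg _) (hf1 _ _)) (abs_nonneg _) (hf1 _ _)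
          set F := f x y * f x' y * f x y' * f x' y'
          have h10 : F * (boxWeight E₁ E₂ x x' y y' - m) ≤ |boxWeight E₁ E₂ x x' y y' - m| := by
            calc _ ≤ |F * (boxWeight E₁ E₂ x x' y y' - m)| := le_abs_self _
              _ = |F| * |boxWeight E₁ E₂ x x' y y' - m| := abs_mul _ _
              _ ≤ 1 * |boxWeight E₁ E₂ x x' y y' - m| := by gcongr
              _ = _ := one_mul _
          linarith
      _ ≤ _ := by
          simp only [sum_add_distrib, ← mul_sum]
          linarith
  have hbase := corner_form_pow_four_le E₁ E₂ h₁ h₂ f A B hf hA hB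
  rw [← he₁, ← he₂] at hbase
  have hM1nn : 0 ≤ ∑ t, autocorr E₁ t * autocorr E₂ t :=
    sum_nonneg fun t _ => mul_nonneg (hae E₁ p₁ q₁ t).1 (hae E₂ p₂ q₂ t).1
  have hR : 0 ≤ e₁ ^ 2 * e₂ ^ 2 / n + ξ ^ 4 * n ^ 3 := by positivity
  have hpos : (0 : ℝ) ≤ (e₁ * e₂) ^ 2 * ∑ t, autocorr E₁ t * autocorr E₂ t := by positivity
  calc _ ≤ _ := hbase
    _ ≤ (e₁ * e₂) ^ 2 * (∑ t, autocorr E₁ t * autocorr E₂ t) *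
        (m * (∑ x, ∑ x', ∑ y, ∑ y', f x y * f x' y * f x y' * f x' y') + 2 * ξ * n ^ 5) :=
        mul_le_mul_of_nonneg_left hM2 hpos
    _ ≤ _ := by
        -- The other factor can be enlarged only if this one is nonnegative. It is, because it
        -- dominates the weighted box form, which is a sum of squares with nonnegative weights.
        by_cases hs : 0 ≤ m * (∑ x, ∑ x', ∑ y, ∑ y', f x y * f x' y * f x y' * f x' y')
            + 2 * ξ * n ^ 5
        · exact mul_le_mul_of_nonneg_right
            (mul_le_mul_of_nonneg_left hM1 (sq_nonneg _)) hs
        · exfalso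
          have : 0 ≤ ∑ x, ∑ x', ∑ y, ∑ y',
              f x y * f x' y * f x y' * f x' y' * boxWeight E₁ E₂ x x' y y' := by
            have e : ∀ x x' z : W, ∑ y, ∑ y', f x y * f x' y * f x y' * f x' y' *
                (E₂ (z - x) * E₂ (z - x') * (E₁ (z - y) * E₁ (z - y')))
                = E₂ (z - x) * E₂ (z - x') * (∑ y, E₁ (z - y) * (f x y * f x' y)) ^ 2 := by
              intro x x' z
              rw [sq, sum_mul_sum, mul_sum]
              refine sum_congr rfl fun y _ => ?_
              rw [mul_sum]
              exact sum_congr rfl fun y' _ => by ring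
            refine sum_nonneg fun x _ => sum_nonneg fun x' _ => ?_
            have : ∑ y, ∑ y', f x y * f x' y * f x y' * f x' y' * boxWeight E₁ E₂ x x' y y'
                = ∑ z, E₂ (z - x) * E₂ (z - x') * (∑ y, E₁ (z - y) * (f x y * f x' y)) ^ 2 := by
              simp only [← e, boxWeight, mul_sum]
              rw [sum_comm' (t' := univ) (s' := fun _ => univ) (by simp)]
              conv_rhs => rw [sum_comm]
              rw [sum_comm]
              refine sum_congr rfl fun y _ => ?_
              rw [sum_comm]
            rw [this]
            exact sum_nonneg fun z _ => mul_nonneg (mul_nonneg (p₂ _) (p₂ _)) (sq_nonneg _)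
          linarith

/-- A large box form produces a rectangle on which the balanced function is large. -/
lemma exists_rectangle_of_box {α β : Type*} (E₁ : Finset α) (E₂ : Finset β) (P : α → β → Prop)
    [∀ x y, Decidable (P x y)] (δ ε : ℝ) (hδ0 : 0 ≤ δ) (hδ1 : δ ≤ 1) (g : α → β → ℝ)
    (hg : ∀ x y, g x y = (if P x y then 1 else 0) - δ)
    (h0 : ∑ x ∈ E₁, ∑ y ∈ E₂, g x y = 0) (hε : 0 < ε) (hE₁ : E₁.Nonempty) (hE₂ : E₂.Nonempty)
    (hbox : ε * ((#E₁ : ℝ) * #E₂) ^ 2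
      ≤ ∑ x ∈ E₁, ∑ x' ∈ E₁, ∑ y ∈ E₂, ∑ y' ∈ E₂, g x y * g x' y * g x y' * g x' y') :
    ∃ F₁ ⊆ E₁, ∃ F₂ ⊆ E₂, ε / 9 * ((#E₁ : ℝ) * #E₂) ≤ ∑ x ∈ F₁, ∑ y ∈ F₂, g x y := by
  classical
  have hg1 : ∀ x y, |g x y| ≤ 1 := by
    intro x y
    rw [hg, abs_le]
    split_ifs <;> constructor <;> linarith
  set M : ℝ := (#E₁ : ℝ) * #E₂ with hM
  have hMpos : 0 < M := by
    have := hE₁.card_pos; have := hE₂.card_pos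
    simp only [hM]; positivity
  -- fix one vertex of the box
  obtain ⟨x', hx', y', hy', hxy⟩ : ∃ x' ∈ E₁, ∃ y' ∈ E₂,
      ε * M ≤ ∑ x ∈ E₁, ∑ y ∈ E₂, g x y * g x' y * g x y' * g x' y' := by
    by_contra! hcon
    have h1 : ∑ x ∈ E₁, ∑ x' ∈ E₁, ∑ y ∈ E₂, ∑ y' ∈ E₂, g x y * g x' y * g x y' * g x' y'
        = ∑ x' ∈ E₁, ∑ y' ∈ E₂, ∑ x ∈ E₁, ∑ y ∈ E₂, g x y * g x' y * g x y' * g x' y' := by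
      rw [sum_comm]
      refine sum_congr rfl fun x' _ => ?_
      rw [sum_comm' (t' := E₂) (s' := fun _ => E₁) (by intros; tauto)]
      conv_rhs => rw [sum_comm]
      rw [sum_comm]
      refine sum_congr rfl fun x _ => ?_
      rw [sum_comm]
    rw [h1] at hbox
    have h2 : ∑ x' ∈ E₁, ∑ y' ∈ E₂, ∑ x ∈ E₁, ∑ y ∈ E₂, g x y * g x' y * g x y' * g x' y'
        < ∑ x' ∈ E₁, ∑ y' ∈ E₂, ε * M :=
      sum_lt_sum_of_nonempty hE₁ fun x hx => sum_lt_sum_of_nonempty hE₂ fun y hy => hcon x hx y hy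
    simp only [sum_const, nsmul_eq_mul] at h2
    have : (#E₁ : ℝ) * (#E₂ * (ε * M)) = ε * M ^ 2 := by rw [hM]; ring
    linarith
  let G : Finset α → Finset β → ℝ := fun S T => ∑ x ∈ S, ∑ y ∈ T, g x y
  -- With the vertex `(x', y')` fixed, two factors are `1_S - δ` and `1_T - δ`. Multiplying out
  -- leaves sums of `g` over rectangles, of which the full one is zero.
  set S := E₁.filter (fun x => P x y') with hS
  set T := E₂.filter (fun y => P x' y) with hT
  have hexp : ∑ x ∈ E₁, ∑ y ∈ E₂, g x y * g x' y * g x y'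
      = G S T - δ * G E₁ T - δ * G S E₂ := by
    have e1 : ∀ x y, g x y * g x' y * g x y' = (if P x y' then (if P x' y then g x y else 0) else 0)
        - δ * (if P x' y then g x y else 0) - δ * (if P x y' then g x y else 0)
        + δ ^ 2 * g x y := by
      intro x y
      rw [hg x' y, hg x y']
      split_ifs <;> ring
    simp only [e1, sum_add_distrib, sum_sub_distrib, ← mul_sum, h0]
    simp only [G, hS, hT, sum_filter]
    have e2 : ∀ x, (∑ y ∈ E₂, if P x y' then (if P x' y then g x y else 0) else 0)
        = if P x y' then ∑ y ∈ E₂, (if P x' y then g x y else 0) else 0 := by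
      intro x; split_ifs <;> simp
    have e3 : ∀ x, (∑ y ∈ E₂, if P x y' then g x y else 0)
        = if P x y' then ∑ y ∈ E₂, g x y else 0 := by
      intro x; split_ifs <;> simp
    simp only [e2, e3]; ring
  have hlow : ε * M ≤ |G S T - δ * G E₁ T - δ * G S E₂| := by
    rw [← hexp]
    have : ∑ x ∈ E₁, ∑ y ∈ E₂, g x y * g x' y * g x y' * g x' y'
        = (∑ x ∈ E₁, ∑ y ∈ E₂, g x y * g x' y * g x y') * g x' y' := by
      simp only [sum_mul]
    rw [this] at hxy
    calc ε * M ≤ |(∑ x ∈ E₁, ∑ y ∈ E₂, g x y * g x' y * g x y') * g x' y'| :=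
          hxy.trans (le_abs_self _)
      _ ≤ _ := by
          rw [abs_mul]
          exact mul_le_of_le_one_right (abs_nonneg _) (hg1 _ _)
  have hST : S ⊆ E₁ ∧ T ⊆ E₂ := ⟨filter_subset _ _, filter_subset _ _⟩
  have hlarge : ∃ F₁ ⊆ E₁, ∃ F₂ ⊆ E₂, ε / 3 * M ≤ |G F₁ F₂| := by
    by_contra! hcon
    have a1 := hcon S hST.1 T hST.2
    have a2 := hcon E₁ subset_rfl T hST.2
    have a3 := hcon S hST.1 E₂ subset_rfl
    have b2 : |δ * G E₁ T| ≤ |G E₁ T| := by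
      rw [abs_mul, abs_of_nonneg hδ0]; exact mul_le_of_le_one_left (abs_nonneg _) hδ1
    have b3 : |δ * G S E₂| ≤ |G S E₂| := by
      rw [abs_mul, abs_of_nonneg hδ0]; exact mul_le_of_le_one_left (abs_nonneg _) hδ1
    have c1 := abs_sub (G S T - δ * G E₁ T) (δ * G S E₂)
    have c2 := abs_sub (G S T) (δ * G E₁ T)
    linarith
  obtain ⟨F₁, hF₁, F₂, hF₂, hF⟩ := hlarge
  have hεM : 0 < ε * M := by positivity
  rcases le_abs'.1 hF with hneg | hpos
  -- The four rectangles cut out by `F₁` and `F₂` sum to zero, so if this one is at most `-(ε / 3)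
  -- M`, one of the other three is at least `(ε / 9) M`.
  · have s1 : G F₁ F₂ + G F₁ (E₂ \ F₂) = G F₁ E₂ := by
      simp only [G, ← sum_add_distrib]
      refine sum_congr rfl fun x _ => ?_
      rw [add_comm]; exact sum_sdiff hF₂
    have s2 : G (E₁ \ F₁) F₂ + G (E₁ \ F₁) (E₂ \ F₂) = G (E₁ \ F₁) E₂ := by
      simp only [G, ← sum_add_distrib]
      refine sum_congr rfl fun x _ => ?_
      rw [add_comm]; exact sum_sdiff hF₂
    have s3 : G F₁ E₂ + G (E₁ \ F₁) E₂ = 0 := by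
      rw [← h0, add_comm]; exact sum_sdiff hF₁
    by_contra! hcon
    have a1 := hcon F₁ hF₁ (E₂ \ F₂) sdiff_subset
    have a2 := hcon (E₁ \ F₁) sdiff_subset F₂ hF₂
    have a3 := hcon (E₁ \ F₁) sdiff_subset (E₂ \ F₂) sdiff_subset
    change G _ _ < _ at a1 a2 a3
    linarith
  · exact ⟨F₁, hF₁, F₂, hF₂, by change _ ≤ G F₁ F₂; linarith⟩

end Corners

/-! ### Corner-free configurations and their density increment. -/

section Corners

open Finset

/-- A corner-free set inside a product set in the square of a finite group of exponent `p`. -/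
structure CornerConfig.{u} (p : ℕ) where
  W : Type u
  [grp : AddCommGroup W]
  [fin : Fintype W]
  [dec : DecidableEq W]
  torsion : ∀ x : W, p • x = 0
  E₁ : Finset W
  E₂ : Finset W
  A : Finset (W × W)
  subset : A ⊆ E₁ ×ˢ E₂
  corner_free : ∀ x y d : W, (x, y) ∈ A → (x + d, y) ∈ A → (x, y + d) ∈ A → d = 0

attribute [instance] CornerConfig.grp CornerConfig.fin CornerConfig.dec

namespace CornerConfig

variable {p : ℕ} (C : CornerConfig p)

/-- The order of the ambient group. -/
def n : ℝ := Fintype.card C.W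

/-- The density of the first side. -/
noncomputable def β₁ : ℝ := #C.E₁ / C.n

/-- The density of the second side. -/
noncomputable def β₂ : ℝ := #C.E₂ / C.n

/-- The density of the corner-free set in the square of the ambient group. -/
noncomputable def α : ℝ := #C.A / C.n ^ 2

/-- Both sides have autocorrelation close to its mean. -/
def Uniform (ξ : ℝ) : Prop :=
  (∑ t, (autocorr (fun x : C.W => if x ∈ C.E₁ then (1 : ℝ) else 0) t - #C.E₁ ^ 2 / C.n) ^ 2
      ≤ ξ ^ 4 * C.n ^ 3) ∧
  (∑ t, (autocorr (fun x : C.W => if x ∈ C.E₂ then (1 : ℝ) else 0) t - #C.E₂ ^ 2 / C.n) ^ 2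
      ≤ ξ ^ 4 * C.n ^ 3)

lemma n_pos : 0 < C.n := by
  unfold n; exact_mod_cast Fintype.card_pos

lemma β₁_nonneg : 0 ≤ C.β₁ := div_nonneg (Nat.cast_nonneg _) C.n_pos.le

lemma β₂_nonneg : 0 ≤ C.β₂ := div_nonneg (Nat.cast_nonneg _) C.n_pos.le

lemma β₁_le_one : C.β₁ ≤ 1 := by
  rw [β₁, div_le_one C.n_pos, n]; exact_mod_cast card_le_univ _

lemma β₂_le_one : C.β₂ ≤ 1 := by
  rw [β₂, div_le_one C.n_pos, n]; exact_mod_cast card_le_univ _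

lemma card_E₁ : (#C.E₁ : ℝ) = C.β₁ * C.n := by
  rw [β₁, div_mul_cancel₀ _ C.n_pos.ne']

lemma card_E₂ : (#C.E₂ : ℝ) = C.β₂ * C.n := by
  rw [β₂, div_mul_cancel₀ _ C.n_pos.ne']

lemma card_A : (#C.A : ℝ) = C.α * C.n ^ 2 := by
  rw [α, div_mul_cancel₀ _ (pow_pos C.n_pos 2).ne']

lemma α_le : C.α ≤ C.β₁ * C.β₂ := by
  have h : (#C.A : ℝ) ≤ #C.E₁ * #C.E₂ := by
    have := card_le_card C.subset
    rw [card_product] at this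
    exact_mod_cast this
  rw [C.card_A, C.card_E₁, C.card_E₂] at h
  have := pow_pos C.n_pos 2
  nlinarith

/-- A corner-free set of relative density `δ` on a product of uniform sets has increased density
on a large product subset. -/
lemma exists_density_increment (δ ξ : ℝ) (hδ : 0 < δ) (hδα : C.α = δ * (C.β₁ * C.β₂))
    (hb : 0 < C.β₁ * C.β₂) (hξ : 0 ≤ ξ) (hξ' : 128 * ξ ≤ δ ^ 12 * (C.β₁ * C.β₂) ^ 4)
    (hU : C.Uniform ξ) (hn : 2 ≤ δ ^ 2 * (C.β₁ * C.β₂) * C.n) :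
    ∃ F₁ ⊆ C.E₁, ∃ F₂ ⊆ C.E₂, δ ^ 12 / 576 * ((#C.E₁ : ℝ) * #C.E₂)
      ≤ #(C.A ∩ F₁ ×ˢ F₂) - δ * (#F₁ * #F₂) := by
  set n := C.n with hndef
  set b := C.β₁ * C.β₂ with hbdef
  have hn0 : 0 < n := C.n_pos
  have hδ1 : δ ≤ 1 := by
    have h := C.α_le
    rw [hδα] at h
    by_contra! h1
    nlinarith
  have hb1 : b ≤ 1 := mul_le_one₀ C.β₁_le_one C.β₂_nonneg C.β₂_le_one
  set E₁ : C.W → ℝ := fun x => if x ∈ C.E₁ then 1 else 0 with hE₁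
  set E₂ : C.W → ℝ := fun x => if x ∈ C.E₂ then 1 else 0 with hE₂
  set A : C.W → C.W → ℝ := fun x y => if (x, y) ∈ C.A then 1 else 0 with hA
  set f : C.W → C.W → ℝ := fun x y => A x y - δ * (E₁ x * E₂ y) with hf
  have hAE : ∀ x y, (x, y) ∈ C.A → x ∈ C.E₁ ∧ y ∈ C.E₂ := fun x y h => by
    simpa using C.subset h
  have h01 : ∀ x, E₁ x = 0 ∨ E₁ x = 1 := fun x => by simp only [hE₁]; split_ifs <;> simp
  have h02 : ∀ x, E₂ x = 0 ∨ E₂ x = 1 := fun x => by simp only [hE₂]; split_ifs <;> simp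
  have hA' : ∀ x y, |A x y| ≤ E₁ x * E₂ y := by
    intro x y
    simp only [hA, hE₁, hE₂]
    by_cases h : (x, y) ∈ C.A
    · simp [h, hAE x y h]
    · simp only [h, if_false, abs_zero]; positivity
  have hf' : ∀ x y, |f x y| ≤ E₁ x * E₂ y := by
    intro x y
    simp only [hf, hA, hE₁, hE₂]
    by_cases h : (x, y) ∈ C.A
    · simp only [h, hAE x y h, if_true]; rw [abs_le]; constructor <;> linarith
    · by_cases h1 : x ∈ C.E₁ <;> by_cases h2 : y ∈ C.E₂ <;> simp [h, h1, h2, abs_of_pos hδ, hδ1]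
  have he₁ : ∑ x, E₁ x = #C.E₁ := by simp [hE₁]
  have he₂ : ∑ x, E₂ x = #C.E₂ := by simp [hE₂]
  have hAc : ∑ x, ∑ y, A x y = #C.A := by
    rw [← Fintype.sum_prod_type' (f := A)]; simp [hA]
  -- Corner-freeness leaves only the degenerate corners `d = 0`, that is `z = x + y`.
  have hT0 : ∑ x, ∑ y, ∑ z, A x y * A (z - y) y * A x (z - x) = #C.A := by
    rw [← hAc]
    refine sum_congr rfl fun x _ => sum_congr rfl fun y _ => ?_
    rw [sum_eq_single (x + y)]
    · simp only [add_sub_cancel_right, add_sub_cancel_left, hA]; split_ifs <;> simp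
    · intro z _ hz
      by_contra hne
      simp only [hA] at hne
      have h1 : (x, y) ∈ C.A := by by_contra h; simp [h] at hne
      have h2 : (z - y, y) ∈ C.A := by by_contra h; simp [h] at hne
      have h3 : (x, z - x) ∈ C.A := by by_contra h; simp [h] at hne
      refine hz ?_
      have := C.corner_free x y (z - x - y) h1 (by convert h2 using 2; abel)
        (by convert h3 using 2; abel)
      rw [sub_sub, sub_eq_zero] at this
      exact this
    · simp
  -- The condition `(x, y) ∈ E₁ × E₂` follows from the other two vertices lying in `A`, so the form
  -- counts pairs of points of `A` on a common antidiagonal.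
  have hTE : ∑ x, ∑ y, ∑ z, E₁ x * E₂ y * A (z - y) y * A x (z - x)
      = ∑ z, (∑ x, A x (z - x)) ^ 2 := by
    have h1 : ∀ x y z, E₁ x * E₂ y * A (z - y) y * A x (z - x) = A (z - y) y * A x (z - x) := by
      intro x y z
      simp only [hA, hE₁, hE₂]
      by_cases h2 : (z - y, y) ∈ C.A
      · by_cases h3 : (x, z - x) ∈ C.A
        · simp [h2, h3, hAE _ _ h2, hAE _ _ h3]
        · simp [h3]
      · simp [h2]
    simp only [h1]
    have h2 : ∀ z, ∑ y, A (z - y) y = ∑ x, A x (z - x) := by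
      intro z
      rw [← Equiv.sum_comp (Equiv.subLeft z)]
      refine sum_congr rfl fun x _ => ?_
      simp
    have h3 : ∀ z, (∑ x, A x (z - x)) ^ 2 = ∑ x, ∑ y, A (z - y) y * A x (z - x) := by
      intro z
      rw [sq]; nth_rw 1 [← h2 z]; rw [sum_mul_sum, sum_comm]
    simp only [h3]
    conv_rhs => rw [sum_comm]
    refine sum_congr rfl fun x _ => ?_
    rw [sum_comm]
  have hTE' : (#C.A : ℝ) ^ 2 ≤ n * ∑ z, (∑ x, A x (z - x)) ^ 2 := by
    have h1 := sq_sum_le_card_mul_sum_sq (s := (univ : Finset C.W))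
      (f := fun z => ∑ x, A x (z - x))
    have h2 : ∑ z, ∑ x, A x (z - x) = #C.A := by
      rw [← hAc, sum_comm]
      exact sum_congr rfl fun x _ => sum_sub_left (A x) x
    rw [h2, card_univ] at h1
    exact h1
  have hTf : ∑ x, ∑ y, ∑ z, f x y * A (z - y) y * A x (z - x)
      = #C.A - δ * ∑ z, (∑ x, A x (z - x)) ^ 2 := by
    rw [← hT0, ← hTE]
    simp only [mul_sum, ← sum_sub_distrib]
    refine sum_congr rfl fun x _ => sum_congr rfl fun y _ => sum_congr rfl fun z _ => ?_
    simp only [hf]; ring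
  have hAcard : (#C.A : ℝ) = δ * b * n ^ 2 := by rw [C.card_A, hδα]
  -- The degenerate corners number `δ b n²`, at most half of the expected `δ³ b² n³` by `hn`. The
  -- form with the balanced function is therefore large and negative; the even power hides the sign.
  have hlow : (δ ^ 3 * b ^ 2 * n ^ 3 / 2) ^ 4
      ≤ (∑ x, ∑ y, ∑ z, f x y * A (z - y) y * A x (z - x)) ^ 4 := by
    have h1 : δ ^ 2 * b ^ 2 * n ^ 3 ≤ ∑ z, (∑ x, A x (z - x)) ^ 2 := by
      rw [hAcard] at hTE'
      refine le_of_mul_le_mul_left ?_ hn0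
      calc _ = (δ * b * n ^ 2) ^ 2 := by ring
        _ ≤ _ := hTE'
    have h2 : δ * (δ ^ 2 * b ^ 2 * n ^ 3) ≤ δ * ∑ z, (∑ x, A x (z - x)) ^ 2 :=
      mul_le_mul_of_nonneg_left h1 hδ.le
    have h3 : δ * b * n ^ 2 * 2 ≤ δ * b * n ^ 2 * (δ ^ 2 * b * n) :=
      mul_le_mul_of_nonneg_left hn (by positivity)
    rw [hTf, hAcard, ← Even.neg_pow (n := 4) (by decide) (δ * b * n ^ 2 - _)]
    refine pow_le_pow_left₀ (by positivity) ?_ 4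
    nlinarith
  have hu₁ := hU.1
  have hu₂ := hU.2
  have hmain := corner_form_pow_four_le_of_uniform E₁ E₂ h01 h02 f A A hf' hA' hA' n
    #C.E₁ #C.E₂ ξ rfl he₁.symm he₂.symm hξ hu₁ hu₂
  set Box := ∑ x, ∑ x', ∑ y, ∑ y', f x y * f x' y * f x y' * f x' y' with hBox
  have hee : (#C.E₁ : ℝ) * #C.E₂ = b * n ^ 2 := by
    rw [C.card_E₁, C.card_E₂, hbdef]; ring
  have hee2 : (#C.E₁ : ℝ) ^ 2 * #C.E₂ ^ 2 = b ^ 2 * n ^ 4 := by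
    rw [← mul_pow, hee]; ring
  -- The fourth power of `1 / 2` and the factor `2` in `h3` give `1 / 32`, and the error `2 ξ n⁵`
  -- costs half of that. The rectangle lemma then divides by `9`, whence `576`.
  have hBoxlow : δ ^ 12 / 64 * (b * n ^ 2) ^ 2 ≤ Box := by
    rw [hee, hee2] at hmain
    have e1 : b ^ 2 * n ^ 4 / n = b ^ 2 * n ^ 3 := by field_simp
    have e2 : b ^ 2 * n ^ 4 / n ^ 3 = b ^ 2 * n := by field_simp
    rw [e1, e2] at hmain
    have hd12 : δ ^ 12 ≤ 1 := pow_le_one₀ hδ.le hδ1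
    have hξb : ξ ≤ b ^ 4 := by
      have : δ ^ 12 * b ^ 4 ≤ 1 * b ^ 4 := mul_le_mul_of_nonneg_right hd12 (by positivity)
      linarith [pow_pos hb 4]
    have hξb2 : ξ ^ 4 ≤ b ^ 2 := by
      calc ξ ^ 4 ≤ (b ^ 4) ^ 4 := pow_le_pow_left₀ hξ hξb 4
        _ = b ^ 2 * b ^ 14 := by ring
        _ ≤ b ^ 2 * 1 := by gcongr; exact pow_le_one₀ hb.le hb1
        _ = _ := mul_one _
    have h3 : b ^ 2 * n ^ 3 + ξ ^ 4 * n ^ 3 ≤ 2 * b ^ 2 * n ^ 3 := by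
      have := mul_le_mul_of_nonneg_right hξb2 (pow_pos hn0 3).le
      linarith
    set R := b ^ 2 * n * Box + 2 * ξ * n ^ 5 with hR
    have h4 := hlow.trans hmain
    have hRpos : 0 ≤ R := by
      by_contra! hneg
      have : (b * n ^ 2) ^ 2 * (b ^ 2 * n ^ 3 + ξ ^ 4 * n ^ 3) * R < 0 :=
        mul_neg_of_pos_of_neg (by positivity) hneg
      have : 0 < (δ ^ 3 * b ^ 2 * n ^ 3 / 2) ^ 4 := by positivity
      linarith
    have h5 : (δ ^ 3 * b ^ 2 * n ^ 3 / 2) ^ 4 ≤ (b * n ^ 2) ^ 2 * (2 * b ^ 2 * n ^ 3) * R := by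
      refine h4.trans (mul_le_mul_of_nonneg_right (mul_le_mul_of_nonneg_left h3 ?_) hRpos)
      positivity
    have h6 : (2 * b ^ 4 * n ^ 7) * (δ ^ 12 * b ^ 4 * n ^ 5 / 32) ≤ (2 * b ^ 4 * n ^ 7) * R := by
      calc _ = (δ ^ 3 * b ^ 2 * n ^ 3 / 2) ^ 4 := by ring
        _ ≤ _ := h5
        _ = _ := by ring
    have h7 : δ ^ 12 * b ^ 4 * n ^ 5 / 32 ≤ R := le_of_mul_le_mul_left h6 (by positivity)
    have h8 : 2 * ξ * n ^ 5 ≤ δ ^ 12 * b ^ 4 * n ^ 5 / 64 := by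
      have := mul_le_mul_of_nonneg_right hξ' (pow_pos hn0 5).le
      linarith
    have h9 : (b ^ 2 * n) * (δ ^ 12 / 64 * (b * n ^ 2) ^ 2) ≤ (b ^ 2 * n) * Box := by
      calc _ = δ ^ 12 * b ^ 4 * n ^ 5 / 64 := by ring
        _ ≤ _ := by rw [hR] at h7; linarith
    exact le_of_mul_le_mul_left h9 (by positivity)
  -- pass to sums over the sides
  set g : C.W → C.W → ℝ := fun x y => (if (x, y) ∈ C.A then 1 else 0) - δ with hg
  have hfg : ∀ x ∈ C.E₁, ∀ y ∈ C.E₂, f x y = g x y := by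
    intro x hx y hy
    simp [hf, hg, hA, hE₁, hE₂, hx, hy]
  have hf0 : ∀ x y, (x ∉ C.E₁ ∨ y ∉ C.E₂) → f x y = 0 := by
    intro x y hxy
    have := hf' x y
    have h0 : E₁ x * E₂ y = 0 := by
      rcases hxy with h | h <;> simp [hE₁, hE₂, h]
    rw [h0] at this
    exact abs_nonpos_iff.1 this
  have hBoxg : Box = ∑ x ∈ C.E₁, ∑ x' ∈ C.E₁, ∑ y ∈ C.E₂, ∑ y' ∈ C.E₂,
      g x y * g x' y * g x y' * g x' y' := by
    symm
    have r1 : ∀ (F : C.W → ℝ) (s : Finset C.W), (∀ x ∉ s, F x = 0) →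
        ∑ x ∈ s, F x = ∑ x, F x := fun F s h =>
      sum_subset (subset_univ _) fun x _ hx => h x hx
    rw [hBox]
    rw [← r1 _ C.E₁ (fun x hx => by simp [hf0 x _ (Or.inl hx)])]
    refine sum_congr rfl fun x hx => ?_
    rw [← r1 _ C.E₁ (fun x' hx' => by simp [hf0 x' _ (Or.inl hx')])]
    refine sum_congr rfl fun x' hx' => ?_
    rw [← r1 _ C.E₂ (fun y hy => by simp [hf0 _ y (Or.inr hy)])]
    refine sum_congr rfl fun y hy => ?_
    rw [← r1 _ C.E₂ (fun y' hy' => by simp [hf0 _ y' (Or.inr hy')])]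
    refine sum_congr rfl fun y' hy' => ?_
    rw [hfg x hx y hy, hfg x' hx' y hy, hfg x hx y' hy', hfg x' hx' y' hy']
  have hrect : ∀ F₁ ⊆ C.E₁, ∀ F₂ ⊆ C.E₂,
      ∑ x ∈ F₁, ∑ y ∈ F₂, g x y = #(C.A ∩ F₁ ×ˢ F₂) - δ * (#F₁ * #F₂) := by
    intro F₁ _ F₂ _
    simp only [hg, sum_sub_distrib, sum_const, nsmul_eq_mul]
    congr 1
    · rw [← sum_product' (f := fun x y => if (x, y) ∈ C.A then (1 : ℝ) else 0)]
      simp only [Prod.mk.eta]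
      rw [← sum_filter, sum_const, nsmul_eq_mul, mul_one, filter_mem_eq_inter, inter_comm]
    · ring
  have hne : C.E₁.Nonempty ∧ C.E₂.Nonempty := by
    constructor
    · by_contra h
      rw [not_nonempty_iff_eq_empty] at h
      simp [hbdef, β₁, h] at hb
    · by_contra h
      rw [not_nonempty_iff_eq_empty] at h
      simp [hbdef, β₂, h] at hb
  obtain ⟨F₁, hF₁, F₂, hF₂, hF⟩ := exists_rectangle_of_box C.E₁ C.E₂ (fun x y => (x, y) ∈ C.A)
    δ (δ ^ 12 / 64) hδ.le hδ1 g (fun x y => rfl) (by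
      rw [hrect _ subset_rfl _ subset_rfl, inter_eq_left.2 C.subset, hee, hAcard]; ring)
    (by positivity) hne.1 hne.2 (by rw [← hBoxg, hee]; exact hBoxlow)
  refine ⟨F₁, hF₁, F₂, hF₂, ?_⟩
  rw [hrect F₁ hF₁ F₂ hF₂] at hF
  calc _ = δ ^ 12 / 64 / 9 * ((#C.E₁ : ℝ) * #C.E₂) := by ring
    _ ≤ _ := hF

end CornerConfig

end Corners

/-! ### Uniform cells, found by an energy increment on cosets of character kernels. -/

section Corners

open Finset ComplexConjugate

/-- The kernel of an additive character as a subgroup. -/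
def AddChar.kernel {W : Type*} [AddCommGroup W] (γ : AddChar W ℂ) : AddSubgroup W where
  carrier := {x | γ x = 1}
  zero_mem' := γ.map_zero_eq_one
  add_mem' := by
    intro a b ha hb
    simp only [Set.mem_ofPred_eq] at *
    rw [AddChar.map_add_eq_mul, ha, hb, one_mul]
  neg_mem' := by
    intro a ha
    simp only [Set.mem_ofPred_eq] at *
    rw [AddChar.map_neg_eq_inv, ha, inv_one]

lemma AddChar.mem_kernel {W : Type*} [AddCommGroup W] (γ : AddChar W ℂ) (x : W) :
    x ∈ γ.kernel ↔ γ x = 1 := Iff.rfl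

section

variable {W : Type*} [AddCommGroup W] [Fintype W]

/-- The values of `γ` are `p`-th roots of unity, so the multiples of one element outside the kernel
already meet every coset of it. -/
lemma AddChar.card_le_mul_card_kernel {p : ℕ} (hp : p.Prime) (hW : ∀ x : W, p • x = 0)
    (γ : AddChar W ℂ) (hγ : γ ≠ 0) :
    Nat.card W ≤ p * Nat.card γ.kernel ∧ Nat.card γ.kernel < Nat.card W := by
  obtain ⟨x₀, hx₀⟩ := AddChar.ne_zero_iff.1 hγ
  have hpow : ∀ x : W, γ x ^ p = 1 := by
    intro x; rw [← AddChar.map_nsmul_eq_pow, hW, AddChar.map_zero_eq_one]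
  have hprim : IsPrimitiveRoot (γ x₀) p := by
    have := orderOf_eq_prime (hpow x₀) hx₀ (hp := ⟨hp⟩)
    rw [← this]; exact IsPrimitiveRoot.orderOf _
  have : NeZero p := ⟨hp.ne_zero⟩
  constructor
  · have hsurj : Function.Surjective (fun q : Fin p × γ.kernel => (q.1 : ℕ) • x₀ + (q.2 : W)) := by
      intro x
      obtain ⟨i, hi, hix⟩ := hprim.eq_pow_of_pow_eq_one (hpow x)
      refine ⟨(⟨i, hi⟩, ⟨x - i • x₀, ?_⟩), by simp⟩
      rw [AddChar.mem_kernel, AddChar.map_sub_eq_div, AddChar.map_nsmul_eq_pow, hix]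
      refine div_self ?_
      rw [← hix]
      exact pow_ne_zero _ (hprim.ne_zero hp.ne_zero)
    have := Nat.card_le_card_of_surjective _ hsurj
    rwa [Nat.card_prod, Nat.card_fin] at this
  · have : γ.kernel ≠ ⊤ := fun h => hx₀ (by
      rw [← AddChar.mem_kernel, h]; trivial)
    have h1 := AddSubgroup.card_le_card_addGroup γ.kernel
    exact lt_of_le_of_ne h1 fun h => this (AddSubgroup.eq_top_of_card_eq _ h)

/-- A large autocorrelation variance gives a large Fourier coefficient at a nontrivial character
`γ`. Since `γ` is constant on cosets of its kernel, that coefficient only sees the coset densities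
of `S`, which must therefore vary; `H` is the kernel. -/
lemma exists_subgroup_of_not_uniform [DecidableEq W] {p : ℕ} (hp : p.Prime)
    (hW : ∀ x : W, p • x = 0) (S : Finset W) (η : ℝ) (hη : 0 ≤ η)
    (h : η * (Fintype.card W : ℝ) ^ 3 < ∑ t, (autocorr (fun x : W => if x ∈ S then (1 : ℝ) else 0) t
      - #S ^ 2 / Fintype.card W) ^ 2) :
    ∃ H : AddSubgroup W, Nat.card W ≤ p * Nat.card H ∧ Nat.card H < Nat.card W ∧
      ∀ [Fintype H], η * Fintype.card W ≤ ∑ s, ((#{h : H | s + (h : W) ∈ S} : ℝ) / Fintype.card H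
        - #S / Fintype.card W) ^ 2 := by
  set n : ℝ := (Fintype.card W : ℝ) with hn
  have hn0 : 0 < n := by rw [hn]; exact_mod_cast Fintype.card_pos
  set β : ℝ := #S / n with hβ
  have hSβ : (#S : ℝ) = β * n := by rw [hβ]; field_simp
  have hβ0 : 0 ≤ β := div_nonneg (Nat.cast_nonneg _) hn0.le
  have hβ1 : β ≤ 1 := by
    rw [hβ, div_le_one hn0, hn]; exact_mod_cast card_le_univ _
  set g : W → ℝ := fun x => (if x ∈ S then (1 : ℝ) else 0) - β with hg
  have hcard : ∀ c : ℝ, ∑ _x : W, c = n * c := by intro c; simp [hn]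
  have hg0 : ∑ x, g x = 0 := by
    simp only [hg, sum_sub_distrib, hcard]
    simp only [sum_ite_mem, univ_inter, sum_const, nsmul_eq_mul, mul_one]
    rw [hSβ]; ring
  have hgauto : ∀ t, ∑ x, g x * g (x + t)
      = autocorr (fun x : W => if x ∈ S then (1 : ℝ) else 0) t - #S ^ 2 / n := by
    intro t
    have e : ∀ x, g x * g (x + t) = (if x ∈ S then (1 : ℝ) else 0) * (if x + t ∈ S then 1 else 0)
      - β * (if x ∈ S then (1 : ℝ) else 0) - β * (if x + t ∈ S then (1 : ℝ) else 0) + β ^ 2 := by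
      intro x; simp only [hg]; ring
    have e2 : ∑ x, (if x + t ∈ S then (1 : ℝ) else 0) = #S := by
      exact (Equiv.sum_comp (Equiv.addRight t) (fun x => if x ∈ S then (1 : ℝ) else 0)).trans
        (by simp)
    simp only [e, sum_add_distrib, sum_sub_distrib, ← mul_sum, e2, hcard, autocorr]
    simp only [sum_ite_mem, univ_inter, sum_const, nsmul_eq_mul, mul_one]
    rw [hSβ]; field_simp; ring
  have hg1 : ∀ x, |g x| ≤ 1 := by
    intro x; simp only [hg]; rw [abs_le]; split_ifs <;> constructor <;> linarith
  obtain ⟨γ, hγ, hlarge⟩ := exists_char_of_autocorrelation g hg0 hg1 η hη (by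
    simp only [hgauto]; exact h)
  obtain ⟨hc1, hc2⟩ := AddChar.card_le_mul_card_kernel hp hW γ hγ
  refine ⟨γ.kernel, hc1, hc2, ?_⟩
  intro _
  set m : ℝ := (Fintype.card γ.kernel : ℝ) with hm
  have hm0 : 0 < m := by rw [hm]; exact_mod_cast Fintype.card_pos
  set e : W → ℝ := fun s => (#{h : γ.kernel | s + (h : W) ∈ S} : ℝ) / m - β with he
  have hes : ∀ s, ∑ h : γ.kernel, g (s + h) = m * e s := by
    intro s
    simp only [hg, sum_sub_distrib, he]
    rw [mul_sub, mul_div_cancel₀ _ hm0.ne']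
    simp [hm]
  -- Averaging over translations by the kernel replaces `g` by its coset averages `e` without
  -- changing the coefficient.
  have hFT : (m : ℂ) * fourierSum (fun x => (g x : ℂ)) γ = m * ∑ s, (e s : ℂ) * γ s := by
    have h1 : ∀ h : γ.kernel, fourierSum (fun x => (g x : ℂ)) γ
        = ∑ s, (g (s + h) : ℂ) * γ s := by
      intro h
      rw [fourierSum, ← Equiv.sum_comp (Equiv.addRight (h : W))]
      refine sum_congr rfl fun s _ => ?_
      simp only [Equiv.coe_addRight, AddChar.map_add_eq_mul]
      rw [(AddChar.mem_kernel γ h).1 h.2, mul_one]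
    have h2 : ∑ _h : γ.kernel, fourierSum (fun x => (g x : ℂ)) γ
        = m * fourierSum (fun x => (g x : ℂ)) γ := by simp [hm]
    rw [← h2, sum_congr rfl fun h _ => h1 h, sum_comm, mul_sum]
    refine sum_congr rfl fun s _ => ?_
    rw [← sum_mul, ← mul_assoc, ← Complex.ofReal_mul, ← hes, Complex.ofReal_sum]
  have hFT' : ‖fourierSum (fun x => (g x : ℂ)) γ‖ ≤ ∑ s, |e s| := by
    have : fourierSum (fun x => (g x : ℂ)) γ = ∑ s, (e s : ℂ) * γ s :=
      mul_left_cancel₀ (Complex.ofReal_ne_zero.2 hm0.ne') hFT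
    rw [this]
    refine (norm_sum_le _ _).trans (sum_le_sum fun s _ => ?_)
    rw [norm_mul, γ.norm_apply, mul_one, Complex.norm_real, Real.norm_eq_abs]
  have hcs := sq_sum_le_card_mul_sum_sq (s := (univ : Finset W)) (f := fun s => |e s|)
  simp only [sq_abs, card_univ] at hcs
  have : η * n ^ 2 ≤ n * ∑ s, e s ^ 2 := by
    calc η * n ^ 2 ≤ _ := hlarge
      _ ≤ (∑ s, |e s|) ^ 2 := pow_le_pow_left₀ (norm_nonneg _) hFT' 2
      _ ≤ _ := hcs
  refine le_of_mul_le_mul_left ?_ hn0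
  calc n * (η * n) = η * n ^ 2 := by ring
    _ ≤ _ := this

end

namespace CornerConfig

variable {p : ℕ} (C : CornerConfig p)

/-- The restriction of a configuration to a pair of cosets of a subgroup. -/
noncomputable def cell (H : AddSubgroup C.W) (s t : C.W) : CornerConfig p :=
  letI : Fintype H := Fintype.ofFinite H
  letI : DecidableEq H := Classical.decEq H
  { W := H
    torsion := fun x => by ext; simpa using C.torsion x
    E₁ := {h : H | s + (h : C.W) ∈ C.E₁}
    E₂ := {h : H | t + (h : C.W) ∈ C.E₂}
    A := {q : H × H | (s + (q.1 : C.W), t + (q.2 : C.W)) ∈ C.A}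
    subset := by
      intro q hq
      simp only [mem_filter, mem_univ, true_and, mem_product] at *
      simpa using C.subset hq
    corner_free := by
      intro x y d h1 h2 h3
      simp only [mem_filter, mem_univ, true_and] at *
      have := C.corner_free (s + x) (t + y) d h1 (by convert h2 using 2; simp [add_assoc])
        (by convert h3 using 2; simp [add_assoc])
      exact_mod_cast this }

lemma cell_n (H : AddSubgroup C.W) (s t : C.W) : (C.cell H s t).n = Nat.card H := by
  change (Fintype.card (C.cell H s t).W : ℝ) = _
  rw [← Nat.card_eq_fintype_card]
  rfl

/-- The potential function used to find uniform cells. -/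
noncomputable def potential (l μ₁ μ₂ ν : ℝ) : ℝ :=
  C.α - l * (C.β₁ * C.β₂) - μ₁ * C.β₁ - μ₂ * C.β₂ + ν * (C.β₁ ^ 2 + C.β₂ ^ 2)

lemma sum_card_translate {W : Type*} [AddCommGroup W] [Fintype W] [DecidableEq W]
    (H : AddSubgroup W) [Fintype H] (S : Finset W) :
    ∑ s, (#{h : H | s + (h : W) ∈ S} : ℝ) = Fintype.card H * #S := by
  have h1 : ∀ s : W, (#{h : H | s + (h : W) ∈ S} : ℝ)
      = ∑ h : H, if s + (h : W) ∈ S then (1 : ℝ) else 0 := by intro s; simp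
  simp only [h1]
  rw [sum_comm]
  have h2 : ∀ h : H, ∑ s, (if s + (h : W) ∈ S then (1 : ℝ) else 0) = #S := by
    intro h
    exact (Equiv.sum_comp (Equiv.addRight (h : W)) (fun x => if x ∈ S then (1 : ℝ) else 0)).trans
      (by simp)
  simp only [h2]; simp

lemma sum_card_translate₂ {W : Type*} [AddCommGroup W] [Fintype W] [DecidableEq W]
    (H : AddSubgroup W) [Fintype H] (A : Finset (W × W)) :
    ∑ s, ∑ t, (#{q : H × H | (s + (q.1 : W), t + (q.2 : W)) ∈ A} : ℝ)
      = Fintype.card H ^ 2 * #A := by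
  have h1 : ∀ s t : W, (#{q : H × H | (s + (q.1 : W), t + (q.2 : W)) ∈ A} : ℝ)
      = ∑ q : H × H, if (s + (q.1 : W), t + (q.2 : W)) ∈ A then (1 : ℝ) else 0 := by
    intro s t; simp
  simp only [h1]
  have h3 : ∀ s : W, ∑ t : W, ∑ q : H × H, (if (s + (q.1 : W), t + (q.2 : W)) ∈ A then (1 : ℝ) else 0)
      = ∑ q : H × H, ∑ t : W, if (s + (q.1 : W), t + (q.2 : W)) ∈ A then (1 : ℝ) else 0 :=
    fun s => sum_comm
  simp only [h3]
  rw [sum_comm]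
  have h2 : ∀ q : H × H, ∑ s, ∑ t, (if (s + (q.1 : W), t + (q.2 : W)) ∈ A then (1 : ℝ) else 0)
      = #A := by
    intro q
    refine (Equiv.sum_comp (Equiv.addRight (q.1 : W))
      (fun x => ∑ t, if (x, t + (q.2 : W)) ∈ A then (1 : ℝ) else 0)).trans ?_
    have : ∀ x : W, ∑ t, (if (x, t + (q.2 : W)) ∈ A then (1 : ℝ) else 0)
        = ∑ y, if (x, y) ∈ A then (1 : ℝ) else 0 := fun x =>
      Equiv.sum_comp (Equiv.addRight (q.2 : W)) (fun y => if (x, y) ∈ A then (1 : ℝ) else 0)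
    simp only [this]
    rw [← Fintype.sum_prod_type' (f := fun x y => if (x, y) ∈ A then (1 : ℝ) else 0)]
    simp
  simp only [h2]; simp [sq]

lemma sum_sq_eq_of_mean {ι : Type*} [Fintype ι] (e : ι → ℝ) (β : ℝ)
    (h : ∑ s, e s = Fintype.card ι * β) :
    ∑ s, e s ^ 2 = ∑ s, (e s - β) ^ 2 + Fintype.card ι * β ^ 2 := by
  have : ∀ s, (e s - β) ^ 2 = e s ^ 2 - 2 * β * e s + β ^ 2 := fun s => by ring
  simp only [this, sum_add_distrib, sum_sub_distrib, ← mul_sum, h]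
  simp; ring

/-- A non-uniform configuration has a cell of larger potential. -/
lemma exists_cell_of_not_uniform (hp : p.Prime) (ξ l μ₁ μ₂ ν : ℝ) (hν : 0 ≤ ν)
    (hU : ¬ C.Uniform ξ) :
    ∃ (H : AddSubgroup C.W) (s t : C.W), Nat.card C.W ≤ p * Nat.card H ∧
      Nat.card H < Nat.card C.W ∧
      C.potential l μ₁ μ₂ ν + ν * ξ ^ 4 ≤ (C.cell H s t).potential l μ₁ μ₂ ν := by
  have hξ4 : (0 : ℝ) ≤ ξ ^ 4 := by positivity
  have key : ∃ H : AddSubgroup C.W, Nat.card C.W ≤ p * Nat.card H ∧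
      Nat.card H < Nat.card C.W ∧ (∀ [Fintype H],
      (ξ ^ 4 * C.n ≤ ∑ s, ((#{h : H | s + (h : C.W) ∈ C.E₁} : ℝ) / Fintype.card H - C.β₁) ^ 2) ∨
      (ξ ^ 4 * C.n ≤ ∑ s, ((#{h : H | s + (h : C.W) ∈ C.E₂} : ℝ) / Fintype.card H - C.β₂) ^ 2)) := by
    rw [Uniform, not_and_or, not_le, not_le] at hU
    rcases hU with h | h
    · obtain ⟨H, h1, h2, h3⟩ := exists_subgroup_of_not_uniform hp C.torsion C.E₁ (ξ ^ 4) hξ4 h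
      exact ⟨H, h1, h2, Or.inl h3⟩
    · obtain ⟨H, h1, h2, h3⟩ := exists_subgroup_of_not_uniform hp C.torsion C.E₂ (ξ ^ 4) hξ4 h
      exact ⟨H, h1, h2, Or.inr h3⟩
  obtain ⟨H, hH1, hH2, hH3⟩ := key
  let _ : Fintype H := Fintype.ofFinite H
  replace hH3 := @hH3 _
  set n := C.n with hn
  have hn0 : 0 < n := C.n_pos
  set m : ℝ := (Fintype.card H : ℝ) with hm
  have hm0 : 0 < m := by rw [hm]; exact_mod_cast Fintype.card_pos
  set a₁ : C.W → ℝ := fun s => (#{h : H | s + (h : C.W) ∈ C.E₁} : ℝ) / m with ha₁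
  set a₂ : C.W → ℝ := fun s => (#{h : H | s + (h : C.W) ∈ C.E₂} : ℝ) / m with ha₂
  set a : C.W → C.W → ℝ := fun s t =>
    (#{q : H × H | (s + (q.1 : C.W), t + (q.2 : C.W)) ∈ C.A} : ℝ) / m ^ 2 with ha
  have hs₁ : ∑ s, a₁ s = n * C.β₁ := by
    simp only [ha₁, ← sum_div]
    rw [sum_card_translate, ← hm, mul_div_cancel_left₀ _ hm0.ne', C.card_E₁, mul_comm]
  have hs₂ : ∑ s, a₂ s = n * C.β₂ := by
    simp only [ha₂, ← sum_div]
    rw [sum_card_translate, ← hm, mul_div_cancel_left₀ _ hm0.ne', C.card_E₂, mul_comm]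
  have hs : ∑ s, ∑ t, a s t = n ^ 2 * C.α := by
    simp only [ha, ← sum_div]
    rw [sum_card_translate₂, ← hm, mul_div_cancel_left₀ _ (pow_pos hm0 2).ne', C.card_A, mul_comm]
  have hq₁ := sum_sq_eq_of_mean a₁ C.β₁ hs₁
  have hq₂ := sum_sq_eq_of_mean a₂ C.β₂ hs₂
  have hv₁ : 0 ≤ ∑ s, (a₁ s - C.β₁) ^ 2 := sum_nonneg fun _ _ => sq_nonneg _
  have hv₂ : 0 ≤ ∑ s, (a₂ s - C.β₂) ^ 2 := sum_nonneg fun _ _ => sq_nonneg _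
  have hv : ξ ^ 4 * n ≤ ∑ s, (a₁ s - C.β₁) ^ 2 + ∑ s, (a₂ s - C.β₂) ^ 2 := by
    rcases hH3 with h | h <;> linarith
  have hsq : n * (ξ ^ 4 + C.β₁ ^ 2 + C.β₂ ^ 2) ≤ ∑ s, a₁ s ^ 2 + ∑ s, a₂ s ^ 2 := by
    rw [hq₁, hq₂]
    change _ ≤ _ + n * _ + (_ + n * _)
    linarith
  have hcell : ∀ s t, (C.cell H s t).potential l μ₁ μ₂ ν
      = a s t - l * (a₁ s * a₂ t) - μ₁ * a₁ s - μ₂ * a₂ t + ν * (a₁ s ^ 2 + a₂ t ^ 2) := by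
    intro s t; rfl
  by_contra! hcon
  have hlt : ∑ s : C.W, ∑ t : C.W, (C.cell H s t).potential l μ₁ μ₂ ν
      < ∑ _s : C.W, ∑ _t : C.W, (C.potential l μ₁ μ₂ ν + ν * ξ ^ 4) :=
    sum_lt_sum_of_nonempty univ_nonempty fun s _ =>
      sum_lt_sum_of_nonempty univ_nonempty fun t _ => hcon H s t hH1 hH2
  have hc : ∀ c : ℝ, ∑ _s : C.W, c = n * c := fun c => by simp [hn, CornerConfig.n]
  simp only [hcell, hc] at hlt
  -- The two cosets are chosen independently, so the density, the product and the linear terms keep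
  -- their means. Only the squares change on average, and they gain the variances, at least `ξ ^ 4`
  -- in total.
  have hsum : ∑ s, ∑ t, (a s t - l * (a₁ s * a₂ t) - μ₁ * a₁ s - μ₂ * a₂ t
      + ν * (a₁ s ^ 2 + a₂ t ^ 2)) = n ^ 2 * C.α - l * (n * C.β₁ * (n * C.β₂))
      - μ₁ * (n * (n * C.β₁)) - μ₂ * (n * (n * C.β₂))
      + ν * (n * (∑ s, a₁ s ^ 2 + ∑ s, a₂ s ^ 2)) := by
    simp only [sum_add_distrib, sum_sub_distrib, ← mul_sum, hs, hs₂, ← sum_mul, hs₁, hc]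
    ring
  rw [hsum] at hlt
  have h9 : ν * (n * (n * (ξ ^ 4 + C.β₁ ^ 2 + C.β₂ ^ 2)))
      ≤ ν * (n * (∑ s, a₁ s ^ 2 + ∑ s, a₂ s ^ 2)) := by gcongr
  simp only [potential] at hlt
  nlinarith

universe u in
/-- Every configuration contains a uniform cell of no smaller potential and bounded codimension. -/
lemma exists_uniform_cell (hp : p.Prime) (ξ l μ₁ μ₂ ν : ℝ) (hν : 0 ≤ ν)
    (C : CornerConfig.{u} p) : ∃ (C' : CornerConfig.{u} p) (k : ℕ), C'.Uniform ξ ∧ C.n ≤ p ^ k * C'.n ∧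
      C.potential l μ₁ μ₂ ν + k * (ν * ξ ^ 4) ≤ C'.potential l μ₁ μ₂ ν := by
  induction' hN : Nat.card C.W using Nat.strong_induction_on with N ih generalizing C
  by_cases hU : C.Uniform ξ
  · exact ⟨C, 0, hU, by simp, by simp⟩
  · obtain ⟨H, s, t, h1, h2, h3⟩ := C.exists_cell_of_not_uniform hp ξ l μ₁ μ₂ ν hν hU
    obtain ⟨C', k, hk1, hk2, hk3⟩ := ih (Nat.card H) (hN ▸ h2) (C.cell H s t) rfl
    refine ⟨C', k + 1, hk1, ?_, ?_⟩
    · rw [cell_n] at hk2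
      have h1' : C.n ≤ p * (Nat.card H : ℝ) := by
        rw [CornerConfig.n, ← Nat.card_eq_fintype_card]; exact_mod_cast h1
      calc C.n ≤ p * (Nat.card H : ℝ) := h1'
        _ ≤ p * (p ^ k * C'.n) := by gcongr
        _ = _ := by ring
    · push_cast; linarith

end CornerConfig

end Corners

/-! ### Iteration of the increment and the corners theorem. -/

section Corners

open Finset

namespace CornerConfig

variable {p : ℕ}

/-- The part of a configuration inside a smaller product set. -/
def restrict (C : CornerConfig p) (F₁ F₂ : Finset C.W) : CornerConfig p :=
  { W := C.W
    torsion := C.torsion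
    E₁ := F₁
    E₂ := F₂
    A := C.A ∩ F₁ ×ˢ F₂
    subset := inter_subset_right
    corner_free := fun x y d h1 h2 h3 => C.corner_free x y d (mem_inter.1 h1).1
      (mem_inter.1 h2).1 (mem_inter.1 h3).1 }

universe u in
/-- A dense configuration has a uniform cell which is almost as dense. -/
lemma exists_uniform_dense_cell (hp : p.Prime) (κ β δ ξ : ℝ) (K : ℕ) (hκ0 : 0 < κ) (hκ1 : κ ≤ 1)
    (hκδ : κ ≤ δ) (hβ : 0 < β) (hK : 2 ≤ K * (κ * β ^ 2 / 8 * ξ ^ 4))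
    (C : CornerConfig.{u} p) (h₁ : β ≤ C.β₁) (h₂ : β ≤ C.β₂)
    (hCα : δ * (C.β₁ * C.β₂) ≤ C.α) :
    ∃ C₁ : CornerConfig.{u} p, C₁.Uniform ξ ∧ C.n ≤ p ^ K * C₁.n ∧
      κ * β / 4 ≤ C₁.β₁ ∧ κ * β / 4 ≤ C₁.β₂ ∧ (δ - κ) * (C₁.β₁ * C₁.β₂) ≤ C₁.α := by
  have hb0 : 0 < C.β₁ * C.β₂ := mul_pos (hβ.trans_le h₁) (hβ.trans_le h₂)
  have hb1 : C.β₁ * C.β₂ ≤ 1 := mul_le_one₀ C.β₁_le_one C.β₂_nonneg C.β₂_le_one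
  have hbβ : β ^ 2 ≤ C.β₁ * C.β₂ := by
    rw [sq]; exact mul_le_mul h₁ h₂ hβ.le (hβ.le.trans h₁)
  obtain ⟨b, hb⟩ : ∃ b, b = C.β₁ * C.β₂ := ⟨_, rfl⟩
  rw [← hb] at hb0 hb1 hbβ hCα
  -- The parameters make the potential start at `κ b / 2` or more, while its quadratic part never
  -- exceeds `2 ν = κ b / 4`; the difference `κ b / 4` survives in `hmain`.
  obtain ⟨ν, hν⟩ : ∃ ν, ν = κ * b / 8 := ⟨_, rfl⟩
  have hν0 : 0 < ν := by rw [hν]; positivity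
  obtain ⟨C₁, k, hU, hk, hpot⟩ := exists_uniform_cell hp ξ (δ - κ) (κ * C.β₂ / 4) (κ * C.β₁ / 4) ν
    hν0.le C
  have hstart : κ * b / 2 ≤ C.potential (δ - κ) (κ * C.β₂ / 4) (κ * C.β₁ / 4) ν := by
    simp only [potential]
    have : 0 ≤ ν * (C.β₁ ^ 2 + C.β₂ ^ 2) := by positivity
    rw [← hb]
    have e1 : κ * C.β₂ / 4 * C.β₁ = κ * b / 4 := by rw [hb]; ring
    have e2 : κ * C.β₁ / 4 * C.β₂ = κ * b / 4 := by rw [hb]; ring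
    linarith
  have a₁0 : 0 ≤ C₁.β₁ := C₁.β₁_nonneg
  have a₂0 : 0 ≤ C₁.β₂ := C₁.β₂_nonneg
  have a₁1 : C₁.β₁ ≤ 1 := C₁.β₁_le_one
  have a₂1 : C₁.β₂ ≤ 1 := C₁.β₂_le_one
  have hA1 : C₁.α ≤ C₁.β₁ * C₁.β₂ := C₁.α_le
  simp only [potential] at hpot hstart
  obtain ⟨a₁, ha₁⟩ : ∃ a, a = C₁.β₁ := ⟨_, rfl⟩
  obtain ⟨a₂, ha₂⟩ : ∃ a, a = C₁.β₂ := ⟨_, rfl⟩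
  rw [← ha₁] at a₁0 a₁1 hA1 hpot
  rw [← ha₂] at a₂0 a₂1 hA1 hpot
  have hsq : ν * (a₁ ^ 2 + a₂ ^ 2) ≤ ν * 2 :=
    mul_le_mul_of_nonneg_left (by nlinarith) hν0.le
  have haa1 : a₁ * a₂ ≤ 1 := mul_le_one₀ a₁1 a₂0 a₂1
  have h5 : 0 ≤ (δ - κ) * (a₁ * a₂) := mul_nonneg (by linarith) (mul_nonneg a₁0 a₂0)
  have hC2 : 0 < κ * C.β₂ / 4 := by have := hβ.trans_le h₂; positivity
  have hC1 : 0 < κ * C.β₁ / 4 := by have := hβ.trans_le h₁; positivity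
  have h6 : 0 ≤ κ * C.β₂ / 4 * a₁ := mul_nonneg hC2.le a₁0
  have h7 : 0 ≤ κ * C.β₁ / 4 * a₂ := mul_nonneg hC1.le a₂0
  have hξ4 : (0 : ℝ) ≤ ξ ^ 4 := by positivity
  have hκb : 0 < κ * b := by positivity
  -- The final potential is at most `1 + 2 ν < 2`, while more than `K` cells would have gained at
  -- least `2`.
  have hkK : k ≤ K := by
    by_contra! hlt
    have hle : (K : ℝ) ≤ k := by exact_mod_cast hlt.le
    have h3 : κ * β ^ 2 / 8 * ξ ^ 4 ≤ ν * ξ ^ 4 := by rw [hν]; gcongr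
    have h4 : 2 ≤ (k : ℝ) * (ν * ξ ^ 4) := by
      calc 2 ≤ K * (κ * β ^ 2 / 8 * ξ ^ 4) := hK
        _ ≤ k * (ν * ξ ^ 4) := by gcongr
    have h8 : ν ≤ 1 / 8 := by
      have : κ * b ≤ 1 * 1 := mul_le_mul hκ1 hb1 hb0.le (by norm_num)
      rw [hν]; linarith
    linarith
  have hmain : κ * b / 4 + κ * C.β₂ / 4 * a₁ + κ * C.β₁ / 4 * a₂ ≤ C₁.α - (δ - κ) * (a₁ * a₂) := by
    have : 0 ≤ (k : ℝ) * (ν * ξ ^ 4) := by positivity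
    have h2 : ν * 2 = κ * b / 4 := by rw [hν]; ring
    linarith
  have haa0 : 0 < a₁ * a₂ := by linarith
  have a₁pos : 0 < a₁ := pos_of_mul_pos_left haa0 a₂0
  have a₂pos : 0 < a₂ := pos_of_mul_pos_right haa0 a₁0
  -- The linear penalties serve to keep the cell from degenerating: as `C₁.α ≤ a₁ a₂`, `hmain`
  -- bounds each penalty by `a₁ a₂`, and one side cancels.
  have hlow₂ : κ * C.β₂ / 4 ≤ a₂ := le_of_mul_le_mul_right (by linarith) a₁pos
  have hlow₁ : κ * C.β₁ / 4 ≤ a₁ := le_of_mul_le_mul_right (by linarith) a₂pos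
  have hp1 : (1 : ℝ) ≤ p := by exact_mod_cast hp.one_lt.le
  have hβ₁ : κ * β / 4 ≤ κ * C.β₁ / 4 := by gcongr
  have hβ₂ : κ * β / 4 ≤ κ * C.β₂ / 4 := by gcongr
  refine ⟨C₁, hU, hk.trans ?_, ha₁ ▸ hβ₁.trans hlow₁, ha₂ ▸ hβ₂.trans hlow₂, ?_⟩
  swap
  · rw [← ha₁, ← ha₂]; linarith
  have := C₁.n_pos
  gcongr

universe u in
/-- One step of the density increment strategy. -/
lemma exists_denser (hp : p.Prime) (α₀ g β δ M : ℝ) (K : ℕ) (hα₀ : 0 < α₀) (hα₁ : α₀ ≤ 1)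
    (hg : g = (α₀ / 2) ^ 12 / 576) (hβ : 0 < β)
    (hK : 2 ≤ K * (g / 2 * β ^ 2 / 8 * ((α₀ / 2) ^ 12 * (g / 2 * β / 4) ^ 8 / 128) ^ 4))
    (hM : 2 ≤ (α₀ / 2) ^ 2 * (g / 2 * β / 4) ^ 2 * M)
    (C : CornerConfig.{u} p) (h₁ : β ≤ C.β₁) (h₂ : β ≤ C.β₂) (hδ : α₀ ≤ δ)
    (hCα : δ * (C.β₁ * C.β₂) ≤ C.α) (hn : p ^ K * M ≤ C.n) :
    ∃ C' : CornerConfig.{u} p, g * (g / 2) / 4 * β ≤ C'.β₁ ∧ g * (g / 2) / 4 * β ≤ C'.β₂ ∧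
      (δ + g / 2) * (C'.β₁ * C'.β₂) ≤ C'.α ∧ C.n ≤ p ^ K * C'.n := by
  obtain ⟨κ, hκ⟩ : ∃ κ, κ = g / 2 := ⟨_, rfl⟩
  have hg0 : 0 < g := by rw [hg]; positivity
  have hgα : g ≤ α₀ / 2 := by
    have : (α₀ / 2) ^ 12 ≤ α₀ / 2 := pow_le_of_le_one (by positivity) (by linarith) (by norm_num)
    rw [hg]; linarith
  rw [← hκ] at hK hM ⊢
  have hκ0 : 0 < κ := by rw [hκ]; positivity
  have hξ0 : 0 < (α₀ / 2) ^ 12 * (κ * β / 4) ^ 8 / 128 := by positivity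
  -- This is what `exists_density_increment` tolerates when the relative density is at least `α₀ /
  -- 2` and the product of the sides at least `(κ β / 4)²`.
  obtain ⟨ξ, hξ⟩ : ∃ ξ, ξ = (α₀ / 2) ^ 12 * (κ * β / 4) ^ 8 / 128 := ⟨_, rfl⟩
  rw [← hξ] at hK hξ0
  obtain ⟨C₁, hU, hkn, hlow₁', hlow₂', hδ₁low⟩ := exists_uniform_dense_cell hp κ β δ ξ K hκ0
    (by linarith) (by linarith) hβ hK C h₁ h₂ hCα
  obtain ⟨a₁, ha₁⟩ : ∃ a, a = C₁.β₁ := ⟨_, rfl⟩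
  obtain ⟨a₂, ha₂⟩ : ∃ a, a = C₁.β₂ := ⟨_, rfl⟩
  rw [← ha₁] at hlow₁' hδ₁low
  rw [← ha₂] at hlow₂' hδ₁low
  have a₁pos : 0 < a₁ := lt_of_lt_of_le (by positivity) hlow₁'
  have a₂pos : 0 < a₂ := lt_of_lt_of_le (by positivity) hlow₂'
  have haa0 : 0 < a₁ * a₂ := mul_pos a₁pos a₂pos
  have hlow : (κ * β / 4) ^ 2 ≤ a₁ * a₂ := by
    rw [sq]; exact mul_le_mul hlow₁' hlow₂' (by positivity) a₁pos.le
  obtain ⟨δ₁, hδ₁⟩ : ∃ δ₁, δ₁ = C₁.α / (a₁ * a₂) := ⟨_, rfl⟩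
  have hδ₁α : C₁.α = δ₁ * (a₁ * a₂) := by rw [hδ₁, div_mul_cancel₀ _ haa0.ne']
  replace hδ₁low : δ - κ ≤ δ₁ := by rw [hδ₁, le_div_iff₀ haa0]; exact hδ₁low
  clear hδ₁
  have hδ₁α₀ : α₀ / 2 ≤ δ₁ := by linarith
  have hδ₁0 : 0 < δ₁ := by linarith
  have hp1 : (1 : ℝ) ≤ p := by exact_mod_cast hp.one_lt.le
  have hn₁ : M ≤ C₁.n := by
    have hpK : (0 : ℝ) < p ^ K := by positivity
    exact le_of_mul_le_mul_left (hn.trans hkn) hpK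
  have hM0 : 0 < M := by
    by_contra! h
    have : (α₀ / 2) ^ 2 * (κ * β / 4) ^ 2 * M ≤ 0 :=
      mul_nonpos_of_nonneg_of_nonpos (by positivity) h
    linarith
  obtain ⟨F₁, hF₁, F₂, hF₂, hF⟩ := C₁.exists_density_increment δ₁ ξ hδ₁0
    (by rw [← ha₁, ← ha₂]; exact hδ₁α) (by rw [← ha₁, ← ha₂]; exact haa0) hξ0.le (by
      rw [← ha₁, ← ha₂]
      calc 128 * ξ = (α₀ / 2) ^ 12 * ((κ * β / 4) ^ 2) ^ 4 := by rw [hξ]; ring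
        _ ≤ δ₁ ^ 12 * (a₁ * a₂) ^ 4 := by gcongr) hU (by
      rw [← ha₁, ← ha₂]
      calc 2 ≤ (α₀ / 2) ^ 2 * (κ * β / 4) ^ 2 * M := hM
        _ ≤ δ₁ ^ 2 * (a₁ * a₂) * C₁.n := by gcongr)
  have hN : 0 < C₁.n := C₁.n_pos
  have hgε : g ≤ δ₁ ^ 12 / 576 := by rw [hg]; gcongr
  obtain ⟨f₁, hf₁⟩ : ∃ f : ℝ, f = #F₁ := ⟨_, rfl⟩
  obtain ⟨f₂, hf₂⟩ : ∃ f : ℝ, f = #F₂ := ⟨_, rfl⟩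
  rw [← hf₁, ← hf₂] at hF
  have hf₁0 : 0 ≤ f₁ := hf₁ ▸ Nat.cast_nonneg _
  have hf₂0 : 0 ≤ f₂ := hf₂ ▸ Nat.cast_nonneg _
  have hf₁e : f₁ ≤ #C₁.E₁ := by rw [hf₁]; exact_mod_cast card_le_card hF₁
  have hf₂e : f₂ ≤ #C₁.E₂ := by rw [hf₂]; exact_mod_cast card_le_card hF₂
  have hFc : (#(C₁.A ∩ F₁ ×ˢ F₂) : ℝ) ≤ f₁ * f₂ := by
    have := card_le_card (inter_subset_right (s₁ := C₁.A) (s₂ := F₁ ×ˢ F₂))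
    rw [card_product] at this
    rw [hf₁, hf₂]
    exact_mod_cast this
  have hee : 0 ≤ (#C₁.E₁ : ℝ) * #C₁.E₂ := by positivity
  have hF' : g * ((#C₁.E₁ : ℝ) * #C₁.E₂) ≤ #(C₁.A ∩ F₁ ×ˢ F₂) - δ₁ * (f₁ * f₂) :=
    (mul_le_mul_of_nonneg_right hgε hee).trans hF
  -- The gain cannot exceed the size of the rectangle, so both of its sides keep at least a
  -- proportion `g` of the old ones.
  have hgff : g * ((#C₁.E₁ : ℝ) * #C₁.E₂) ≤ f₁ * f₂ := by
    have : 0 ≤ δ₁ * (f₁ * f₂) := by positivity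
    linarith
  have hE₁pos : 0 < (#C₁.E₁ : ℝ) := by rw [C₁.card_E₁, ← ha₁]; positivity
  have hE₂pos : 0 < (#C₁.E₂ : ℝ) := by rw [C₁.card_E₂, ← ha₂]; positivity
  have hf₁low : g * #C₁.E₁ ≤ f₁ := by
    refine le_of_mul_le_mul_right ?_ hE₂pos
    calc _ = g * ((#C₁.E₁ : ℝ) * #C₁.E₂) := by ring
      _ ≤ f₁ * f₂ := hgff
      _ ≤ _ := by gcongr
  have hf₂low : g * #C₁.E₂ ≤ f₂ := by
    refine le_of_mul_le_mul_right ?_ hE₁pos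
    calc _ = g * ((#C₁.E₁ : ℝ) * #C₁.E₂) := by ring
      _ ≤ f₁ * f₂ := hgff
      _ ≤ #C₁.E₁ * f₂ := by gcongr
      _ = _ := by ring
  refine ⟨C₁.restrict F₁ F₂, ?_, ?_, ?_, hkn⟩
  · change _ ≤ (#F₁ : ℝ) / C₁.n
    rw [← hf₁]
    rw [le_div_iff₀ hN]
    rw [C₁.card_E₁, ← ha₁] at hf₁low
    calc _ = g * (κ * β / 4 * C₁.n) := by ring
      _ ≤ g * (a₁ * C₁.n) := by gcongr
      _ ≤ _ := hf₁low
  · change _ ≤ (#F₂ : ℝ) / C₁.n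
    rw [← hf₂]
    rw [le_div_iff₀ hN]
    rw [C₁.card_E₂, ← ha₂] at hf₂low
    calc _ = g * (κ * β / 4 * C₁.n) := by ring
      _ ≤ g * (a₂ * C₁.n) := by gcongr
      _ ≤ _ := hf₂low
  · change (δ + κ) * ((#F₁ : ℝ) / C₁.n * (#F₂ / C₁.n)) ≤ (#(C₁.A ∩ F₁ ×ˢ F₂) : ℝ) / C₁.n ^ 2
    rw [← hf₁, ← hf₂]
    rw [le_div_iff₀ (pow_pos hN 2)]
    have e : (δ + κ) * (f₁ / C₁.n * (f₂ / C₁.n)) * C₁.n ^ 2 = (δ + κ) * (f₁ * f₂) := by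
      field_simp
    rw [e]
    have h1 : f₁ * f₂ ≤ (#C₁.E₁ : ℝ) * #C₁.E₂ := by gcongr
    have h2 : g * (f₁ * f₂) ≤ g * ((#C₁.E₁ : ℝ) * #C₁.E₂) := by gcongr
    -- Passing to the uniform cell loses `κ = g / 2` and the rectangle gains `g`.
    have h3 : (δ + κ) * (f₁ * f₂) ≤ (δ₁ + g) * (f₁ * f₂) := by
      refine mul_le_mul_of_nonneg_right ?_ (by positivity)
      rw [hκ] at hδ₁low ⊢; linarith
    linarith

universe u in
/-- Iterating the density increment bounds the order of the group. -/
lemma card_lt_of_density (hp : p.Prime) (α₀ g β M : ℝ) (J K : ℕ) (hα₀ : 0 < α₀) (hα₁ : α₀ ≤ 1)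
    (hg : g = (α₀ / 2) ^ 12 / 576) (hβ : β = (g * (g / 2) / 4) ^ J) (hJ : 1 ≤ J * (g / 2))
    (hK : 2 ≤ K * (g / 2 * β ^ 2 / 8 * ((α₀ / 2) ^ 12 * (g / 2 * β / 4) ^ 8 / 128) ^ 4))
    (hM : 2 ≤ (α₀ / 2) ^ 2 * (g / 2 * β / 4) ^ 2 * M)
    (C : CornerConfig.{u} p) (h₁ : C.β₁ = 1) (h₂ : C.β₂ = 1) (hα : α₀ ≤ C.α) :
    C.n < p ^ (J * K) * M := by
  by_contra! hcon
  have hg0 : 0 < g := by rw [hg]; positivity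
  have hg1 : g ≤ 1 := by
    have : (α₀ / 2) ^ 12 ≤ 1 := pow_le_one₀ (by positivity) (by linarith)
    rw [hg]; linarith
  set q := g * (g / 2) / 4 with hq
  have hq0 : 0 < q := by positivity
  have hq1 : q ≤ 1 := by rw [hq]; nlinarith
  have hp1 : (1 : ℝ) ≤ p := by exact_mod_cast hp.one_lt.le
  have hM0 : 0 ≤ M := by
    by_contra! h
    have : (α₀ / 2) ^ 2 * (g / 2 * β / 4) ^ 2 * M ≤ 0 :=
      mul_nonpos_of_nonneg_of_nonpos (by positivity) h.le
    linarith
  have key : ∀ j : ℕ, j ≤ J → ∃ C' : CornerConfig.{u} p, q ^ j ≤ C'.β₁ ∧ q ^ j ≤ C'.β₂ ∧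
      (α₀ + j * (g / 2)) * (C'.β₁ * C'.β₂) ≤ C'.α ∧ C.n ≤ p ^ (j * K) * C'.n := by
    intro j
    induction j with
    | zero => intro _; exact ⟨C, by simp [h₁], by simp [h₂], by simpa [h₁, h₂] using hα, by simp⟩
    | succ j ih =>
      intro hj
      obtain ⟨C', c1, c2, c3, c4⟩ := ih (by omega)
      have hqβ : β ≤ q ^ j := by rw [hβ]; exact pow_le_pow_of_le_one hq0.le hq1 (by omega)
      have hqj : 0 < q ^ j := by positivity
      have hβ0 : 0 < β := by rw [hβ]; positivity
      have hpj : (0 : ℝ) < p ^ (j * K) := by positivity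
      obtain ⟨C'', d1, d2, d3, d4⟩ := exists_denser hp α₀ g (q ^ j) (α₀ + j * (g / 2)) M K hα₀ hα₁ hg
        hqj (hK.trans (by gcongr)) (hM.trans (by gcongr)) C' c1 c2
        (by have : (0 : ℝ) ≤ j * (g / 2) := by positivity
            linarith) c3 (by
          refine le_of_mul_le_mul_left ?_ hpj
          calc _ = (p : ℝ) ^ ((j + 1) * K) * M := by ring
            _ ≤ (p : ℝ) ^ (J * K) * M := by gcongr
            _ ≤ _ := hcon.trans c4)
      refine ⟨C'', by rw [pow_succ']; exact d1, by rw [pow_succ']; exact d2, ?_, ?_⟩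
      · refine le_trans (le_of_eq ?_) d3
        push_cast; ring
      · calc C.n ≤ _ := c4
          _ ≤ p ^ (j * K) * (p ^ K * C''.n) := by gcongr
          _ = _ := by ring
  -- After `J` steps the relative density is at least `α₀ + 1 > 1`, which is impossible.
  obtain ⟨C', c1, c2, c3, _⟩ := key J le_rfl
  have hb : 0 < C'.β₁ * C'.β₂ := mul_pos ((pow_pos hq0 J).trans_le c1) ((pow_pos hq0 J).trans_le c2)
  have := C'.α_le
  nlinarith

end CornerConfig

/-- With `x = 1 / q`, every quantity is bounded by a power of `x` with exponent linear in `J ≤ x`;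
`log x ≤ x` then makes the logarithm quadratic in `x`. -/
lemma corner_exponent_bound (q M : ℝ) (J K : ℕ) (hq0 : 0 < q) (hqs : q ≤ 1 / 128)
    (hJq : (J : ℝ) ≤ 1 / q) (hK : (K : ℝ) ≤ 2 / q ^ (34 * J + 74) + 1)
    (hM : M = 2 / q ^ (2 * J + 5)) : ((J * K : ℕ) : ℝ) + M ≤ Real.exp (200 * (1 / q) ^ 2) := by
  obtain ⟨x, hx⟩ : ∃ x, x = 1 / q := ⟨_, rfl⟩
  have hx128 : 128 ≤ x := by rw [hx, le_div_iff₀ hq0]; linarith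
  have hx1 : 1 ≤ x := by linarith
  have hdiv : ∀ k : ℕ, 2 / q ^ k = 2 * x ^ k := by
    intro k; rw [hx, one_div, inv_pow]; ring
  rw [hdiv] at hK hM
  rw [← hx] at hJq ⊢
  have hKq : (K : ℝ) ≤ x ^ (34 * J + 75) := by
    have h3 : 1 ≤ x ^ (34 * J + 74) := one_le_pow₀ hx1
    rw [pow_succ x (34 * J + 74)]
    nlinarith
  have hMq : M ≤ x ^ (34 * J + 75) := by
    calc M = 2 * x ^ (2 * J + 5) := hM
      _ ≤ x * x ^ (2 * J + 5) := by gcongr; linarith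
      _ = x ^ (2 * J + 6) := by ring
      _ ≤ _ := pow_le_pow_right₀ hx1 (by omega)
  have hsum : ((J * K : ℕ) : ℝ) + M ≤ x ^ (34 * J + 77) := by
    have hX : 0 ≤ x ^ (34 * J + 75) := by positivity
    push_cast
    calc (J : ℝ) * K + M ≤ x * x ^ (34 * J + 75) + x ^ (34 * J + 75) := by gcongr
      _ ≤ x * x ^ (34 * J + 75) * 2 := by nlinarith
      _ ≤ x * x ^ (34 * J + 75) * x := by gcongr; linarith
      _ = _ := by ring
  refine hsum.trans ?_
  have hlog : Real.log x ≤ x := (Real.log_le_sub_one_of_pos (by positivity)).trans (by linarith)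
  have hlog0 : 0 ≤ Real.log x := Real.log_nonneg hx1
  calc x ^ (34 * J + 77) = Real.exp (((34 * J + 77 : ℕ) : ℝ) * Real.log x) := by
        rw [Real.exp_nat_mul, Real.exp_log (by linarith)]
    _ ≤ _ := by
        refine Real.exp_le_exp.2 ?_
        calc ((34 * J + 77 : ℕ) : ℝ) * Real.log x ≤ (34 * x + 77 * x) * x := by
              push_cast
              gcongr
              linarith
          _ ≤ 200 * x ^ 2 := by nlinarith

/-- **Corners theorem** in groups of prime exponent, with a quantitative bound. -/
theorem card_le_of_corner_free : ∃ c : ℝ, 0 < c ∧ ∀ (p : ℕ) (_ : p.Prime) (V : Type*)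
    [AddCommGroup V] [Fintype V] (_ : ∀ x : V, p • x = 0) (A : Finset (V × V)) (α : ℝ)
    (_ : 0 < α) (_ : α * (Fintype.card V : ℝ) ^ 2 ≤ #A)
    (_ : ∀ x y d : V, (x, y) ∈ A → (x + d, y) ∈ A → (x, y + d) ∈ A → d = 0),
    (Fintype.card V : ℝ) ≤ (p : ℝ) ^ Real.exp (c / α ^ 48) := by
  classical
  refine ⟨200 * (8 * 576 ^ 2 * 2 ^ 24) ^ 2, by positivity, ?_⟩
  intro p hp V _ _ hV A α hα hA hcf
  let C : CornerConfig p :=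
    { W := V, torsion := hV, E₁ := univ, E₂ := univ, A := A,
      subset := fun q _ => by simp, corner_free := hcf }
  have hn : C.n = Fintype.card V := rfl
  have hn0 := C.n_pos
  have hβ₁ : C.β₁ = 1 := by
    change ((univ : Finset V).card : ℝ) / C.n = 1
    rw [hn, card_univ]; exact div_self (hn ▸ hn0.ne')
  have hβ₂ : C.β₂ = 1 := hβ₁
  have hαC : α ≤ C.α := by
    rw [CornerConfig.α, le_div_iff₀ (pow_pos hn0 2)]; exact hA
  have hα1 : α ≤ 1 := by
    have := C.α_le
    rw [hβ₁, hβ₂] at this; linarith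
  set g := (α / 2) ^ 12 / 576 with hg
  set q := g * (g / 2) / 4 with hq
  have hg0 : 0 < g := by positivity
  have hq0 : 0 < q := by positivity
  have hqα : q = α ^ 24 / (8 * 576 ^ 2 * 2 ^ 24) := by rw [hq, hg]; ring
  have hg2 : (α / 2) ^ 12 ≤ 1 / 4096 := by
    calc (α / 2) ^ 12 ≤ (1 / 2) ^ 12 := by gcongr
      _ = _ := by norm_num
  have hgs : g ≤ 1 / (4096 * 576) := by rw [hg]; linarith
  have hqg : q ≤ g / (8 * 4096 * 576) := by rw [hq]; nlinarith
  have hqs : q ≤ 1 / 128 := by linarith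
  have hq1 : q ≤ 1 := by linarith
  have hqα2 : q ≤ (α / 2) ^ 12 := by
    have : (α / 2) ^ 12 = 576 * g := by rw [hg]; ring
    linarith
  have hqα3 : q ≤ (α / 2) ^ 2 := hqα2.trans
    (pow_le_pow_of_le_one (by positivity) (by linarith) (by norm_num))
  set J := ⌈2 / g⌉₊ with hJ
  set β := q ^ J with hβ
  have hβ0 : 0 < β := by positivity
  set K := ⌈2 / q ^ (34 * J + 74)⌉₊ with hK
  set M := 2 / q ^ (2 * J + 5) with hM
  have hJg : 1 ≤ J * (g / 2) := by
    have : 2 / g ≤ J := Nat.le_ceil _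
    rw [div_le_iff₀ hg0] at this
    linarith
  have hκβ : q ^ (J + 2) ≤ g / 2 * β / 4 := by
    rw [hβ]
    calc q ^ (J + 2) = q * q ^ J * q := by ring
      _ ≤ g / 2 * q ^ J * (1 / 4) := by
        gcongr
        · linarith
        · linarith
      _ = _ := by ring
  have hξ : q ^ (8 * J + 18) ≤ (α / 2) ^ 12 * (g / 2 * β / 4) ^ 8 / 128 := by
    calc q ^ (8 * J + 18) = q * (q ^ (J + 2)) ^ 8 * q := by ring
      _ ≤ (α / 2) ^ 12 * (g / 2 * β / 4) ^ 8 * (1 / 128) := by gcongr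
      _ = _ := by ring
  have hKK : 2 ≤ K * (g / 2 * β ^ 2 / 8 * ((α / 2) ^ 12 * (g / 2 * β / 4) ^ 8 / 128) ^ 4) := by
    have h1 : 2 / q ^ (34 * J + 74) ≤ K := Nat.le_ceil _
    rw [div_le_iff₀ (by positivity)] at h1
    refine h1.trans ?_
    calc (K : ℝ) * q ^ (34 * J + 74) = K * (q * β ^ 2 * q * (q ^ (8 * J + 18)) ^ 4) := by
          rw [hβ]; ring
      _ ≤ K * (g / 2 * β ^ 2 * (1 / 8) * ((α / 2) ^ 12 * (g / 2 * β / 4) ^ 8 / 128) ^ 4) := by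
          gcongr
          · linarith
          · linarith
      _ = _ := by ring
  have hMM : 2 ≤ (α / 2) ^ 2 * (g / 2 * β / 4) ^ 2 * M := by
    have h1 : q ^ (2 * J + 5) * M = 2 := by rw [hM]; field_simp
    calc 2 = q * (q ^ (J + 2)) ^ 2 * M := by rw [← h1]; ring
      _ ≤ _ := by gcongr
  have hmain := CornerConfig.card_lt_of_density hp α g β M J K hα hα1 hg hβ hJg hKK hMM C hβ₁ hβ₂ hαC
  rw [hn] at hmain
  have hp2 : (2 : ℝ) ≤ p := by exact_mod_cast hp.two_le
  have hM1 : M ≤ (p : ℝ) ^ M := by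
    have hM0 : 0 ≤ M := by positivity
    calc M ≤ (2 : ℝ) ^ M := by
          rcases le_total 1 M with h | h
          · have h1 := one_add_mul_self_le_rpow_one_add (s := 1) (by norm_num) h
            norm_num at h1
            linarith
          · exact h.trans (Real.one_le_rpow (by norm_num) hM0)
      _ ≤ (p : ℝ) ^ M := Real.rpow_le_rpow (by norm_num) hp2 hM0
  have hp0 : (0 : ℝ) < p := by linarith
  calc (Fintype.card V : ℝ) ≤ p ^ (J * K) * M := hmain.le
    _ ≤ (p : ℝ) ^ ((J * K : ℕ) : ℝ) * (p : ℝ) ^ M := by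
        rw [Real.rpow_natCast]; gcongr
    _ = (p : ℝ) ^ (((J * K : ℕ) : ℝ) + M) := (Real.rpow_add hp0 _ _).symm
    _ ≤ _ := by
        refine Real.rpow_le_rpow_of_exponent_le (by linarith) ?_
        have hJq : (J : ℝ) ≤ 1 / q := by
          have h1 : (J : ℝ) ≤ 2 / g + 1 := (Nat.ceil_lt_add_one (by positivity)).le
          have h2 : 2 / g + 1 ≤ 1 / q := by
            rw [hq, div_add_one hg0.ne', div_le_div_iff₀ hg0 (by positivity)]
            nlinarith
          linarith
        have hfin := corner_exponent_bound q M J K hq0 hqs hJq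
          (Nat.ceil_lt_add_one (by positivity)).le hM
        refine hfin.trans (Real.exp_le_exp.2 (le_of_eq ?_))
        rw [hqα]; field_simp

end Corners

/-! ### Bohr sets and regularity. -/

section Bohr

open Finset

variable {N : Type*} [AddCommGroup N] [Fintype N]

open Classical in
/-- The Bohr set with frequencies `Γ` and radius `ρ`. -/
noncomputable def bohr (Γ : Finset (AddChar N ℂ)) (ρ : ℝ) : Finset N :=
  {x | ∀ γ ∈ Γ, ‖γ x - 1‖ ≤ ρ}

lemma mem_bohr {Γ : Finset (AddChar N ℂ)} {ρ : ℝ} {x : N} :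
    x ∈ bohr Γ ρ ↔ ∀ γ ∈ Γ, ‖γ x - 1‖ ≤ ρ := by
  simp [bohr]

lemma zero_mem_bohr {Γ : Finset (AddChar N ℂ)} {ρ : ℝ} (hρ : 0 ≤ ρ) : (0 : N) ∈ bohr Γ ρ := by
  simp [mem_bohr, hρ]

lemma bohr_mono {Γ Γ' : Finset (AddChar N ℂ)} {ρ ρ' : ℝ} (hΓ : Γ' ⊆ Γ) (hρ : ρ ≤ ρ') :
    bohr Γ ρ ⊆ bohr Γ' ρ' := fun _ hx =>
  mem_bohr.2 fun γ hγ => (mem_bohr.1 hx γ (hΓ hγ)).trans hρ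

lemma AddChar.norm_apply_sub_apply (γ : AddChar N ℂ) (x y : N) :
    ‖γ x - γ y‖ = ‖γ (x - y) - 1‖ := by
  have : γ x - γ y = γ y * (γ (x - y) - 1) := by
    rw [mul_sub, ← AddChar.map_add_eq_mul]; simp
  rw [this, norm_mul, AddChar.norm_apply, one_mul]

lemma neg_mem_bohr {Γ : Finset (AddChar N ℂ)} {ρ : ℝ} {x : N} (hx : x ∈ bohr Γ ρ) :
    -x ∈ bohr Γ ρ := by
  refine mem_bohr.2 fun γ hγ => ?_
  have := γ.norm_apply_sub_apply 0 x
  rw [zero_sub, AddChar.map_zero_eq_one, norm_sub_rev] at this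
  rw [← this]
  exact mem_bohr.1 hx γ hγ

lemma add_mem_bohr {Γ : Finset (AddChar N ℂ)} {ρ σ : ℝ} {x y : N} (hx : x ∈ bohr Γ ρ)
    (hy : y ∈ bohr Γ σ) : x + y ∈ bohr Γ (ρ + σ) := by
  refine mem_bohr.2 fun γ hγ => ?_
  have h1 := γ.norm_apply_sub_apply (x + y) y
  rw [add_sub_cancel_right] at h1
  calc ‖γ (x + y) - 1‖ ≤ ‖γ (x + y) - γ y‖ + ‖γ y - 1‖ := norm_sub_le_norm_sub_add_norm_sub _ _ _
    _ ≤ ρ + σ := by rw [h1]; exact add_le_add (mem_bohr.1 hx γ hγ) (mem_bohr.1 hy γ hγ)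

/-- Every Bohr set is large. -/
lemma card_le_mul_card_bohr (Γ : Finset (AddChar N ℂ)) (ℓ : ℕ) :
    Fintype.card N ≤ 2 ^ ((2 * ℓ + 6) * #Γ) * #(bohr Γ ((1 / 2) ^ ℓ)) := by
  classical
  obtain ⟨k, hk⟩ : ∃ k : ℕ, k = 2 ^ (ℓ + 1) := ⟨_, rfl⟩
  have hk0 : (0 : ℝ) < k := by rw [hk]; positivity
  -- Values of characters are rounded to a grid of mesh `2 ^ -(ℓ + 1)`. Points with the same rounded
  -- values differ by an element of the Bohr set, so pigeonholing over grid cells gives the bound.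
  let q : ℂ → ℤ × ℤ := fun z => (⌊(k : ℝ) * z.re⌋, ⌊(k : ℝ) * z.im⌋)
  let cells : Finset (ℤ × ℤ) := Icc (-(k : ℤ)) k ×ˢ Icc (-(k : ℤ)) k
  have hq : ∀ z : ℂ, ‖z‖ ≤ 1 → q z ∈ cells := by
    have aux : ∀ t : ℝ, |t| ≤ 1 → ⌊(k : ℝ) * t⌋ ∈ Icc (-(k : ℤ)) k := by
      intro t ht
      rw [abs_le] at ht
      rw [mem_Icc]
      constructor
      · rw [Int.le_floor]; push_cast; nlinarith
      · rw [← Int.cast_le (R := ℝ)]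
        refine (Int.floor_le _).trans ?_
        push_cast; nlinarith
    intro z hz
    exact mem_product.2 ⟨aux _ ((Complex.abs_re_le_norm z).trans hz),
      aux _ ((Complex.abs_im_le_norm z).trans hz)⟩
  have hqd : ∀ z w : ℂ, q z = q w → ‖z - w‖ ≤ (1 / 2) ^ ℓ := by
    intro z w hzw
    have aux : ∀ s t : ℝ, ⌊(k : ℝ) * s⌋ = ⌊(k : ℝ) * t⌋ → |s - t| ≤ (1 / 2) ^ (ℓ + 1) := by
      intro s t h
      have h1 := Int.abs_sub_lt_one_of_floor_eq_floor h
      rw [← mul_sub, abs_mul, abs_of_pos hk0] at h1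
      have hk' : (k : ℝ) = 2 ^ (ℓ + 1) := by rw [hk]; push_cast; rfl
      rw [one_div, inv_pow, ← hk', ← one_div, le_div_iff₀ hk0]
      linarith
    have h1 := aux z.re w.re (congrArg Prod.fst hzw)
    have h2 := aux z.im w.im (congrArg Prod.snd hzw)
    calc ‖z - w‖ ≤ |(z - w).re| + |(z - w).im| := Complex.norm_le_abs_re_add_abs_im _
      _ ≤ (1 / 2) ^ (ℓ + 1) + (1 / 2) ^ (ℓ + 1) := by
        rw [Complex.sub_re, Complex.sub_im]; exact add_le_add h1 h2
      _ = _ := by ring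
  let Q : N → (Γ → ℤ × ℤ) := fun x γ => q (γ.1 x)
  have himg : univ.image Q ⊆ Fintype.piFinset fun _ => cells := by
    intro g hg
    obtain ⟨x, _, rfl⟩ := mem_image.1 hg
    exact Fintype.mem_piFinset.2 fun γ => hq _ (γ.1.norm_apply x).le
  have hcells : #cells ≤ 2 ^ (2 * ℓ + 6) := by
    have : #(Icc (-(k : ℤ)) k) ≤ 2 ^ (ℓ + 3) := by
      rw [Int.card_Icc]
      have : (2 : ℕ) ^ (ℓ + 3) = 4 * k := by rw [hk]; ring
      have : 1 ≤ k := by exact_mod_cast hk0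
      omega
    rw [card_product]
    calc _ ≤ 2 ^ (ℓ + 3) * 2 ^ (ℓ + 3) := Nat.mul_le_mul this this
      _ = _ := by ring
  have hfib := card_le_mul_card_image (s := (univ : Finset N)) (f := Q)
    #(bohr Γ ((1 / 2) ^ ℓ)) (by
      intro g hg
      obtain ⟨y, _, rfl⟩ := mem_image.1 hg
      refine card_le_card_of_injOn (fun x => x - y) ?_ (sub_left_injective.injOn)
      intro x hx
      have hx' : Q x = Q y := (mem_filter.1 hx).2
      refine mem_bohr.2 fun γ hγ => ?_
      rw [← γ.norm_apply_sub_apply]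
      exact hqd _ _ (congrFun hx' ⟨γ, hγ⟩))
  calc Fintype.card N ≤ #(bohr Γ ((1 / 2) ^ ℓ)) * #(univ.image Q) := hfib
    _ ≤ #(bohr Γ ((1 / 2) ^ ℓ)) * (2 ^ (2 * ℓ + 6)) ^ #Γ := by
      gcongr
      refine (card_le_card himg).trans ?_
      rw [Fintype.card_piFinset, prod_const, card_univ, Fintype.card_coe]
      exact Nat.pow_le_pow_left hcells _
    _ = _ := by rw [← pow_mul, mul_comm]

/-- A Bohr set which is almost invariant under translation by a slightly smaller Bohr set. -/
def IsRegularBohr (κ : ℝ) (x : ℕ) (B : Finset N) : Prop :=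
  ∃ (Γ : Finset (AddChar N ℂ)) (ρ : ℝ), #Γ ≤ x ∧ (1 / 2) ^ x ≤ ρ ∧ B = bohr Γ ρ ∧
    (#(bohr Γ (ρ + (1 / 2) ^ x)) : ℝ) ≤ (1 + κ) * #B

lemma IsRegularBohr.mono {κ : ℝ} {x y : ℕ} {B : Finset N} (h : IsRegularBohr κ x B) (hxy : x ≤ y) :
    IsRegularBohr κ y B := by
  obtain ⟨Γ, ρ, h1, h2, h3, h4⟩ := h
  have hp : ((1 : ℝ) / 2) ^ y ≤ (1 / 2) ^ x :=
    pow_le_pow_of_le_one (by norm_num) (by norm_num) hxy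
  refine ⟨Γ, ρ, h1.trans hxy, hp.trans h2, h3, le_trans ?_ h4⟩
  exact_mod_cast card_le_card (bohr_mono subset_rfl (by linarith))

lemma isRegularBohr_univ {κ : ℝ} (hκ : 0 ≤ κ) (x : ℕ) : IsRegularBohr κ x (univ : Finset N) := by
  refine ⟨∅, 1, by simp, pow_le_one₀ (by norm_num) (by norm_num), ?_, ?_⟩
  · ext; simp [mem_bohr]
  · have : (#(bohr (∅ : Finset (AddChar N ℂ)) (1 + (1 / 2) ^ x)) : ℝ) ≤ #(univ : Finset N) := by
      exact_mod_cast card_le_card (subset_univ _)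
    nlinarith [Nat.cast_nonneg (α := ℝ) #(univ : Finset N)]

lemma IsRegularBohr.card_le {κ : ℝ} {x : ℕ} {B : Finset N} (h : IsRegularBohr κ x B) :
    Fintype.card N ≤ 2 ^ ((2 * x + 6) * x) * #B := by
  obtain ⟨Γ, ρ, h1, h2, rfl, h4⟩ := h
  refine (card_le_mul_card_bohr Γ x).trans ?_
  gcongr
  · norm_num
  · exact bohr_mono subset_rfl h2

/-- Narrow Bohr sets with the same frequencies can be made almost invariant. -/
lemma exists_regular_radius {κ : ℝ} (hκ : 0 < κ) {x : ℕ} (hx : 1 ≤ κ * x)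
    (Γ : Finset (AddChar N ℂ)) (hΓ : #Γ ≤ x) :
    ∃ ρ : ℝ, (1 / 2) ^ (x + 1) ≤ ρ ∧ ρ ≤ (1 / 2) ^ x ∧
      (#(bohr Γ (ρ + (1 / 2) ^ (8 * x))) : ℝ) ≤ (1 + κ) * #(bohr Γ ρ) := by
  -- Otherwise each of the `2 ^ (7 x - 1)` steps of length `2 ^ (-8 x)` between the two radii
  -- multiplies the size by `1 + κ`. As `(1 + κ) ^ x ≥ 2`, the total growth would contradict
  -- `card_le_mul_card_bohr`.
  by_contra! hcon
  have hx1 : 1 ≤ x := by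
    rcases Nat.eq_zero_or_pos x with rfl | h
    · norm_num at hx
    · exact h
  obtain ⟨σ, hσ⟩ : ∃ σ : ℝ, σ = (1 / 2) ^ (8 * x) := ⟨_, rfl⟩
  have hσ0 : 0 < σ := by rw [hσ]; positivity
  rw [← hσ] at hcon
  have hB0 : 0 < #(bohr Γ ((1 / 2) ^ (x + 1))) := card_pos.2 ⟨0, zero_mem_bohr (by positivity)⟩
  have hstep : ∀ i : ℕ, i * σ ≤ (1 / 2) ^ (x + 1) →
      (1 + κ) ^ i * #(bohr Γ ((1 / 2) ^ (x + 1))) ≤ #(bohr Γ ((1 / 2) ^ (x + 1) + i * σ)) := by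
    intro i
    induction i with
    | zero => intro _; simp
    | succ i ih =>
      intro hi
      push_cast at hi ⊢
      have h0 : (0 : ℝ) ≤ i * σ := by positivity
      have h1 := ih (by linarith)
      have h2 := hcon ((1 / 2) ^ (x + 1) + i * σ) (by linarith) (by
        have : ((1 : ℝ) / 2) ^ x = 2 * (1 / 2) ^ (x + 1) := by ring
        linarith)
      calc (1 + κ) ^ (i + 1) * (#(bohr Γ ((1 / 2) ^ (x + 1))) : ℝ)
          = (1 + κ) * ((1 + κ) ^ i * #(bohr Γ ((1 / 2) ^ (x + 1)))) := by ring
        _ ≤ (1 + κ) * #(bohr Γ ((1 / 2) ^ (x + 1) + i * σ)) := by gcongr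
        _ ≤ _ := by
          refine h2.le.trans (le_of_eq ?_)
          congr 3; ring
  obtain ⟨m, hm⟩ : ∃ m : ℕ, m = 2 ^ (7 * x - 1) := ⟨_, rfl⟩
  have hmσ : (m : ℝ) * σ = (1 / 2) ^ (x + 1) := by
    have h8 : 8 * x = (7 * x - 1) + (x + 1) := by omega
    rw [hm, hσ, h8, pow_add, ← mul_assoc]
    push_cast
    rw [← mul_pow]; norm_num
  have h1 := hstep m hmσ.le
  obtain ⟨q, hq⟩ : ∃ q : ℕ, q = (2 * (x + 1) + 6) * x + 1 := ⟨_, rfl⟩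
  have hqm : x * q ≤ m := by
    have ht : x + 1 ≤ 2 ^ x := Nat.lt_two_pow_self
    have h3 : (x + 1) ^ 6 ≤ 2 ^ (6 * x) := by
      rw [mul_comm 6 x, pow_mul]; exact Nat.pow_le_pow_left ht 6
    have h4 : (2 : ℕ) ^ (6 * x) ≤ m := by
      rw [hm]; exact Nat.pow_le_pow_right (by norm_num) (by omega)
    refine le_trans ?_ (h3.trans h4)
    have h8 : 8 ≤ (x + 1) ^ 3 := Nat.pow_le_pow_left (show 2 ≤ x + 1 by omega) 3
    calc x * q ≤ 8 * (x + 1) ^ 3 := by rw [hq]; nlinarith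
      _ ≤ (x + 1) ^ 3 * (x + 1) ^ 3 := Nat.mul_le_mul_right _ h8
      _ = _ := by ring
  have h2 : (2 : ℝ) ^ q ≤ (1 + κ) ^ m := by
    have hb : 2 ≤ (1 + κ) ^ x := by
      have := one_add_mul_le_pow (show -2 ≤ κ by linarith) x
      linarith
    calc (2 : ℝ) ^ q ≤ ((1 + κ) ^ x) ^ q := by gcongr
      _ = (1 + κ) ^ (x * q) := (pow_mul _ _ _).symm
      _ ≤ _ := pow_le_pow_right₀ (by linarith) hqm
  have h3 : (#(bohr Γ ((1 / 2) ^ (x + 1) + m * σ)) : ℝ) ≤ Fintype.card N := by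
    exact_mod_cast card_le_univ _
  have h4 : (Fintype.card N : ℝ) ≤ 2 ^ ((2 * (x + 1) + 6) * x) * #(bohr Γ ((1 / 2) ^ (x + 1))) := by
    have h5 := card_le_mul_card_bohr Γ (x + 1)
    have h6 : (2 : ℕ) ^ ((2 * (x + 1) + 6) * #Γ) ≤ 2 ^ ((2 * (x + 1) + 6) * x) :=
      Nat.pow_le_pow_right (by norm_num) (Nat.mul_le_mul_left _ hΓ)
    exact_mod_cast h5.trans (Nat.mul_le_mul_right _ h6)
  have hB0' : (0 : ℝ) < #(bohr Γ ((1 / 2) ^ (x + 1))) := by exact_mod_cast hB0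
  have h5 : (2 : ℝ) ^ q * #(bohr Γ ((1 / 2) ^ (x + 1))) ≤
      2 ^ ((2 * (x + 1) + 6) * x) * #(bohr Γ ((1 / 2) ^ (x + 1))) :=
    (mul_le_mul_of_nonneg_right h2 hB0'.le).trans (h1.trans (h3.trans h4))
  have h6 := le_of_mul_le_mul_right h5 hB0'
  rw [hq, pow_succ] at h6
  have : (0 : ℝ) < 2 ^ ((2 * (x + 1) + 6) * x) := by positivity
  linarith

/-- The frequencies pulled back along a homomorphism. -/
noncomputable def pullFreq {M : Type*} [AddCommGroup M] [DecidableEq (AddChar M ℂ)]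
    (Γ : Finset (AddChar M ℂ)) (φ : M →+ M) : Finset (AddChar M ℂ) := Γ.image fun γ => γ.compAddMonoidHom φ

lemma mem_bohr_pullFreq [DecidableEq (AddChar N ℂ)] {Γ : Finset (AddChar N ℂ)} {φ : N →+ N} {ρ : ℝ}
    {x : N} : x ∈ bohr (pullFreq Γ φ) ρ ↔ φ x ∈ bohr Γ ρ := by
  simp [mem_bohr, pullFreq]

lemma card_pullFreq_le {M : Type*} [AddCommGroup M] [DecidableEq (AddChar M ℂ)]
    (Γ : Finset (AddChar M ℂ)) (φ : M →+ M) :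
    #(pullFreq Γ φ) ≤ #Γ := card_image_le

/-- The image of a Bohr set under an automorphism is the Bohr set of the frequencies pulled back
along the inverse, with the same rank and radius. -/
lemma IsRegularBohr.map [DecidableEq N] {κ : ℝ} {x : ℕ} {B : Finset N} (h : IsRegularBohr κ x B)
    (θ : N ≃+ N) : IsRegularBohr κ x (B.image θ) := by
  classical
  obtain ⟨Γ, ρ, h1, h2, rfl, h4⟩ := h
  have himg : ∀ r, bohr (pullFreq Γ (θ.symm : N →+ N)) r = (bohr Γ r).image θ := by
    intro r
    ext y
    rw [mem_bohr_pullFreq, mem_image]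
    constructor
    · intro hy; exact ⟨θ.symm y, hy, by simp⟩
    · rintro ⟨z, hz, rfl⟩; simpa using hz
  refine ⟨pullFreq Γ (θ.symm : N →+ N), ρ, (card_pullFreq_le _ _).trans h1, h2, (himg ρ).symm, ?_⟩
  rw [himg, card_image_of_injective _ θ.injective, card_image_of_injective _ θ.injective]
  exact h4

/-- Translating by a very narrow Bohr set moves few points out of a regular Bohr set. -/
lemma card_translate_not_mem_le {κ σ ρ : ℝ} {Γ : Finset (AddChar N ℂ)} [DecidableEq N]
    (h : (#(bohr Γ (ρ + σ)) : ℝ) ≤ (1 + κ) * #(bohr Γ ρ)) (hσ : 0 ≤ σ) {t : N} (ht : t ∈ bohr Γ σ) :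
    (#{x ∈ bohr Γ ρ | x + t ∉ bohr Γ ρ} : ℝ) ≤ κ * #(bohr Γ ρ) := by
  have h1 : #{x ∈ bohr Γ ρ | x + t ∉ bohr Γ ρ} ≤ #(bohr Γ (ρ + σ) \ bohr Γ ρ) := by
    refine card_le_card_of_injOn (fun x => x + t) ?_ (add_left_injective t).injOn
    intro x hx
    have hx := mem_filter.1 hx
    exact mem_sdiff.2 ⟨add_mem_bohr hx.1 ht, hx.2⟩
  have h2 := card_sdiff_add_card_eq_card
    (bohr_mono (subset_refl Γ) (show ρ ≤ ρ + σ by linarith) : bohr Γ ρ ⊆ bohr Γ (ρ + σ))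
  have h1' : (#{x ∈ bohr Γ ρ | x + t ∉ bohr Γ ρ} : ℝ) ≤ #(bohr Γ (ρ + σ) \ bohr Γ ρ) := by
    exact_mod_cast h1
  have h2' : (#(bohr Γ (ρ + σ) \ bohr Γ ρ) : ℝ) + #(bohr Γ ρ) = #(bohr Γ (ρ + σ)) := by
    exact_mod_cast h2
  linarith

end Bohr

/-! ### Counting twisted progressions in the absence of a density increment. -/

section TwistedRoth

open Finset

variable {N : Type*} [AddCommGroup N] [Fintype N] [DecidableEq N]

/-- At most `κ |B|` points leave `B` under the translation, and equally many enter it. -/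
lemma norm_sum_translate_sub_le {M : Type*} [AddCommGroup M] [DecidableEq M]
    {E : Type*} [SeminormedAddCommGroup E] (f : M → E) (hf : ∀ x, ‖f x‖ ≤ 1)
    (B : Finset M) (t : M) (κ : ℝ) (hB : (#{x ∈ B | x + t ∉ B} : ℝ) ≤ κ * #B) :
    ‖∑ x ∈ B, f (x + t) - ∑ x ∈ B, f x‖ ≤ 2 * κ * #B := by
  have h1 : ∑ x ∈ B, f (x + t) = ∑ y ∈ B.image (· + t), f y :=
    (sum_image (add_left_injective t).injOn).symm
  have hcard : #(B.image (· + t)) = #B := card_image_of_injective _ (add_left_injective t)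
  have h2 : #(B.image (· + t) \ B) ≤ #{x ∈ B | x + t ∉ B} := by
    refine (card_le_card ?_).trans (card_image_le (f := (· + t)))
    intro y hy
    obtain ⟨hy1, hy2⟩ := mem_sdiff.1 hy
    obtain ⟨x, hx, rfl⟩ := mem_image.1 hy1
    exact mem_image.2 ⟨x, mem_filter.2 ⟨hx, hy2⟩, rfl⟩
  have h3 : #(B \ B.image (· + t)) = #(B.image (· + t) \ B) := card_sdiff_comm hcard.symm
  have h2' : (#(B.image (· + t) \ B) : ℝ) ≤ κ * #B := le_trans (by exact_mod_cast h2) hB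
  have hs : ∀ s : Finset M, ‖∑ x ∈ s, f x‖ ≤ #s := fun s => by
    refine (norm_sum_le _ _).trans ((sum_le_sum fun x _ => hf x).trans ?_)
    simp
  rw [h1, ← sum_sdiff_sub_sum_sdiff]
  refine (norm_sub_le _ _).trans ?_
  have h4 := hs (B.image (· + t) \ B)
  have h5 := hs (B \ B.image (· + t))
  rw [h3] at h5
  linarith

/-- The indicator function of a finite set, with real values. -/
def realInd {M : Type*} [DecidableEq M] (A : Finset M) (x : M) : ℝ := if x ∈ A then 1 else 0

lemma realInd_nonneg {M : Type*} [DecidableEq M] (A : Finset M) (x : M) : 0 ≤ realInd A x := by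
  unfold realInd; split_ifs <;> norm_num

lemma realInd_le_one {M : Type*} [DecidableEq M] (A : Finset M) (x : M) : realInd A x ≤ 1 := by
  unfold realInd; split_ifs <;> norm_num

lemma sum_realInd {M ι : Type*} [DecidableEq M] (A : Finset M) (D : Finset ι) (φ : ι → M) :
    ∑ t ∈ D, realInd A (φ t) = #{t ∈ D | φ t ∈ A} := by
  simp [realInd, sum_boole]

lemma abs_realInd_sub_le {M : Type*} [DecidableEq M] (A : Finset M) (x : M) {δ : ℝ} (h0 : 0 ≤ δ)
    (h1 : δ ≤ 1) : |realInd A x - δ| ≤ 1 := by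
  rw [abs_le]
  constructor <;> linarith [realInd_nonneg A x, realInd_le_one A x]

/-- Used to choose a centre: averaged over `x ∈ B`, the set `A` is almost as dense on `x + φ(D)` as
on `B`. -/
lemma le_sum_translates {M : Type*} [AddCommGroup M] [DecidableEq M] (A B D : Finset M) (φ : M → M)
    (κ δ : ℝ) (hB : ∀ t ∈ D, (#{x ∈ B | x + φ t ∉ B} : ℝ) ≤ κ * #B)
    (hδ : δ * #B ≤ ∑ x ∈ B, realInd A x) :
    (δ - 2 * κ) * #B * #D ≤ ∑ x ∈ B, ∑ t ∈ D, realInd A (x + φ t) := by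
  rw [sum_comm]
  have : ∀ t ∈ D, (δ - 2 * κ) * #B ≤ ∑ x ∈ B, realInd A (x + φ t) := by
    intro t ht
    have h := norm_sum_translate_sub_le (realInd A) (fun x => by
      rw [Real.norm_eq_abs, abs_of_nonneg (realInd_nonneg A x)]; exact realInd_le_one A x)
      B (φ t) κ (hB t ht)
    rw [Real.norm_eq_abs, abs_le] at h
    linarith [h.1]
  calc (δ - 2 * κ) * #B * #D = ∑ t ∈ D, (δ - 2 * κ) * #B := by rw [sum_const, nsmul_eq_mul]; ring
    _ ≤ _ := sum_le_sum this

/-- Without a density increment on translates of `B'`, the balanced function of `A` on `C` has no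
large Fourier coefficient at a character which is almost trivial on `B'`. -/
lemma norm_fourier_le_of_no_increment (A C B' : Finset N) (χ : AddChar N ℂ) (κ δ η : ℝ)
    (hκ : 0 ≤ κ) (h0 : 0 ≤ δ) (h1 : δ ≤ 1)
    (hinv : ∀ t ∈ B', (#{x ∈ C | x + t ∉ C} : ℝ) ≤ κ * #C) (hχ : ∀ t ∈ B', ‖χ t - 1‖ ≤ κ)
    (hB' : B'.Nonempty) (hU : ∀ s, ∑ t ∈ B', realInd A (s + t) ≤ (δ + κ) * #B')
    (hC : (δ - η) * #C ≤ ∑ x ∈ C, realInd A x) :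
    ‖∑ c ∈ C, ((realInd A c - δ : ℝ) : ℂ) * χ c‖ ≤ (7 * κ + η) * #C := by
  have hb : (0 : ℝ) < #B' := by exact_mod_cast hB'.card_pos
  obtain ⟨f, hf⟩ : ∃ f : N → ℝ, f = fun x => realInd A x - δ := ⟨_, rfl⟩
  have hf1 : ∀ x, |f x| ≤ 1 := fun x => by rw [hf]; exact abs_realInd_sub_le A x h0 h1
  have hfχ : ∀ x y, ‖(f x : ℂ) * χ y‖ ≤ 1 := fun x y => by
    rw [norm_mul, AddChar.norm_apply, mul_one, Complex.norm_real]; exact hf1 x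
  have hfC : -η * #C ≤ ∑ x ∈ C, f x := by
    rw [hf]; rw [sum_sub_distrib, sum_const, nsmul_eq_mul]; linarith
  -- Translation by `t` costs `2 κ` for moving the domain and `κ` for the change of the character.
  have hstep : ∀ t ∈ B', ‖∑ c ∈ C, (f c : ℂ) * χ c - ∑ c ∈ C, (f (c + t) : ℂ) * χ c‖
      ≤ 3 * κ * #C := by
    intro t ht
    have e1 := norm_sum_translate_sub_le (fun x => (f x : ℂ) * χ x) (fun x => hfχ x x) C t κ
      (hinv t ht)
    have e2 : ‖∑ c ∈ C, (f (c + t) : ℂ) * χ (c + t) - ∑ c ∈ C, (f (c + t) : ℂ) * χ c‖ ≤ κ * #C := by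
      rw [← sum_sub_distrib]
      refine (norm_sum_le _ _).trans ?_
      calc ∑ c ∈ C, ‖(f (c + t) : ℂ) * χ (c + t) - (f (c + t) : ℂ) * χ c‖ ≤ ∑ c ∈ C, κ := by
            refine sum_le_sum fun c _ => ?_
            have : (f (c + t) : ℂ) * χ (c + t) - (f (c + t) : ℂ) * χ c
                = (f (c + t) : ℂ) * χ c * (χ t - 1) := by
              rw [AddChar.map_add_eq_mul]; ring
            rw [this, norm_mul]
            calc _ ≤ 1 * κ := mul_le_mul (hfχ _ _) (hχ t ht) (norm_nonneg _) zero_le_one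
              _ = κ := one_mul _
        _ = κ * #C := by rw [sum_const, nsmul_eq_mul, mul_comm]
    rw [norm_sub_rev] at e1
    have := norm_sub_le_norm_sub_add_norm_sub (∑ c ∈ C, (f c : ℂ) * χ c)
      (∑ c ∈ C, (f (c + t) : ℂ) * χ (c + t)) (∑ c ∈ C, (f (c + t) : ℂ) * χ c)
    linarith
  obtain ⟨Y, hY⟩ : ∃ Y : N → ℝ, Y = fun x => ∑ t ∈ B', f (x + t) := ⟨_, rfl⟩
  have hYle : ∀ x, Y x ≤ κ * #B' := by
    intro x
    have := hU x
    rw [hY, hf]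
    simp only [sum_sub_distrib, sum_const, nsmul_eq_mul]
    linarith
  have hYsum : -(η + 2 * κ) * #C * #B' ≤ ∑ x ∈ C, Y x := by
    rw [hY, sum_comm]
    calc -(η + 2 * κ) * #C * #B' = ∑ t ∈ B', -(η + 2 * κ) * #C := by
          rw [sum_const, nsmul_eq_mul]; ring
      _ ≤ _ := by
        refine sum_le_sum fun t ht => ?_
        have h := norm_sum_translate_sub_le f hf1 C t κ (hinv t ht)
        rw [Real.norm_eq_abs, abs_le] at h
        linarith [h.1]
  -- A function with a small pointwise upper bound and a sum that is not very negative has small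
  -- `L¹` norm. This is how the absence of an increment gives control in both directions.
  have hYabs : ∑ x ∈ C, |Y x| ≤ (η + 4 * κ) * #C * #B' := by
    calc ∑ x ∈ C, |Y x| ≤ ∑ x ∈ C, (2 * (κ * #B') - Y x) := by
          refine sum_le_sum fun x _ => abs_le.2 ⟨by nlinarith [hYle x], by linarith [hYle x]⟩
      _ = 2 * (κ * #B') * #C - ∑ x ∈ C, Y x := by
          rw [sum_sub_distrib, sum_const, nsmul_eq_mul]; ring
      _ ≤ _ := by linarith
  have hdouble : ‖∑ t ∈ B', ∑ c ∈ C, (f (c + t) : ℂ) * χ c‖ ≤ (η + 4 * κ) * #C * #B' := by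
    rw [sum_comm]
    refine (norm_sum_le _ _).trans (le_trans (le_of_eq ?_) hYabs)
    refine sum_congr rfl fun c _ => ?_
    rw [← sum_mul, norm_mul, AddChar.norm_apply, mul_one, ← Complex.ofReal_sum, Complex.norm_real,
      Real.norm_eq_abs, hY]
  have htot : ‖∑ t ∈ B', (∑ c ∈ C, (f c : ℂ) * χ c - ∑ c ∈ C, (f (c + t) : ℂ) * χ c)‖
      ≤ 3 * κ * #C * #B' := by
    refine (norm_sum_le _ _).trans ((sum_le_sum hstep).trans (le_of_eq ?_))
    rw [sum_const, nsmul_eq_mul]; ring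
  rw [sum_sub_distrib, sum_const, nsmul_eq_mul] at htot
  have h5 : ‖(#B' : ℂ) * ∑ c ∈ C, (f c : ℂ) * χ c‖ ≤ (7 * κ + η) * #C * #B' := by
    have := norm_le_norm_sub_add ((#B' : ℂ) * ∑ c ∈ C, (f c : ℂ) * χ c)
      (∑ t ∈ B', ∑ c ∈ C, (f (c + t) : ℂ) * χ c)
    linarith
  rw [norm_mul, Complex.norm_natCast] at h5
  have h6 : ‖∑ c ∈ C, (f c : ℂ) * χ c‖ ≤ (7 * κ + η) * #C :=
    le_of_mul_le_mul_left (by linarith) hb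
  simpa only [hf] using h6

/-- A lower bound for the number of twisted progressions in a set which is dense in the relevant
Bohr sets and has small Fourier coefficients. -/
lemma twisted_count_lower_bound (θ : N ≃+ N) (τ : N →+ N) (A C D : Finset N) (κ δ η S : ℝ)
    (hκ : 0 ≤ κ) (h1 : δ ≤ 1) (hη : 0 ≤ η) (hηδ : η ≤ δ) (hS0 : 0 ≤ S)
    (hinv : ∀ c ∈ C, (#{b ∈ D | b + -θ.symm (τ c) ∉ D} : ℝ) ≤ κ * #D)
    (hD : (δ - η) * #D ≤ ∑ b ∈ D, realInd A b)
    (hθD : (δ - η) * #D ≤ ∑ b ∈ D, realInd A (-θ b))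
    (hC : (δ - η) * #C ≤ ∑ c ∈ C, realInd A c)
    (hU : ∀ s, ∑ c ∈ C, realInd A (s + τ c) ≤ (δ + κ) * #C)
    (hS : ∀ χ : AddChar N ℂ, ‖∑ c ∈ C, ((realInd A c - δ : ℝ) : ℂ) * χ c‖ ≤ S) :
    (δ * (δ - η) ^ 2 - 5 * κ - η) * (#C * #D) - S * #D ≤
      ∑ c ∈ C, ∑ b ∈ D, realInd A (τ c - θ b) * realInd A c * realInd A b := by
  have h0 : 0 ≤ δ := hη.trans hηδ
  obtain ⟨a, ha⟩ : ∃ a : N → ℝ, a = realInd A := ⟨_, rfl⟩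
  simp only [← ha] at hD hθD hC hU hS ⊢
  have a0 : ∀ x, 0 ≤ a x := fun x => by rw [ha]; exact realInd_nonneg A x
  have a1 : ∀ x, a x ≤ 1 := fun x => by rw [ha]; exact realInd_le_one A x
  obtain ⟨I, hI⟩ : ∃ I : N → ℝ, I = realInd D := ⟨_, rfl⟩
  have I0 : ∀ x, 0 ≤ I x := fun x => by rw [hI]; exact realInd_nonneg D x
  have I1 : ∀ x, I x ≤ 1 := fun x => by rw [hI]; exact realInd_le_one D x
  have Isq : ∀ x, I x ^ 2 = I x := fun x => by rw [hI]; unfold realInd; split_ifs <;> norm_num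
  -- Both functions are cut off by the indicator of `D`, so that the `L²` norm of `u` is governed by
  -- `|D|` and not by `|N|`. They are the same function in different coordinates, as `hu` shows.
  let h : N → ℝ := fun y => (a (-θ y) - δ) * I y
  let u : N → ℝ := fun y => (a y - δ) * I (-θ.symm y)
  let t : N → N := fun c => -θ.symm (τ c)
  have hu : ∀ c b, u (τ c - θ b) = h (b + t c) := by
    intro c b
    have e1 : -θ.symm (τ c - θ b) = b + t c := by simp [t]; abel
    have e2 : -θ (b + t c) = τ c - θ b := by simp [t]; abel
    simp only [u, h, e1, e2]
  have hh1 : ∀ x, ‖h x‖ ≤ 1 := by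
    intro x
    rw [Real.norm_eq_abs, abs_mul, abs_of_nonneg (I0 x)]
    have := abs_realInd_sub_le A (-θ x) h0 h1
    rw [← ha] at this
    calc _ ≤ 1 * 1 := mul_le_mul this (I1 x) (I0 x) zero_le_one
      _ = 1 := one_mul 1
  have hhD : -η * #D ≤ ∑ b ∈ D, h b := by
    have : ∑ b ∈ D, h b = ∑ b ∈ D, (a (-θ b) - δ) := by
      refine sum_congr rfl fun b hb => ?_
      simp [h, hI, realInd, hb]
    rw [this, sum_sub_distrib, sum_const, nsmul_eq_mul]
    linarith
  have hexit : ∀ c ∈ C, ∑ b ∈ D, (1 - I (b + t c)) ≤ κ * #D := by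
    intro c hc
    refine le_trans (le_of_eq ?_) (hinv c hc)
    rw [card_filter, Nat.cast_sum]
    refine sum_congr rfl fun b _ => ?_
    simp only [hI, realInd, t]
    split_ifs <;> simp_all
  -- the contribution of the constant function
  have term1 : (δ * (δ - η) ^ 2 - κ) * (#C * #D) ≤
      ∑ c ∈ C, ∑ b ∈ D, δ * I (b + t c) * a c * a b := by
    have e1 : ∑ c ∈ C, ∑ b ∈ D, (a c * a b - (1 - I (b + t c))) ≤
        ∑ c ∈ C, ∑ b ∈ D, I (b + t c) * a c * a b := by
      refine sum_le_sum fun c _ => sum_le_sum fun b _ => ?_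
      have h2 : a c * a b ≤ 1 := mul_le_one₀ (a1 c) (a0 b) (a1 b)
      nlinarith [I1 (b + t c), mul_nonneg (a0 c) (a0 b)]
    have e2 : ((δ - η) * #C) * ((δ - η) * #D) - κ * (#C * #D) ≤
        ∑ c ∈ C, ∑ b ∈ D, (a c * a b - (1 - I (b + t c))) := by
      simp only [sum_sub_distrib (f := fun b => a _ * a b)]
      rw [sum_sub_distrib, ← sum_mul_sum]
      have e3 : ((δ - η) * #C) * ((δ - η) * #D) ≤ (∑ c ∈ C, a c) * ∑ b ∈ D, a b :=
        mul_le_mul hC hD (mul_nonneg (by linarith) (Nat.cast_nonneg _))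
          (sum_nonneg fun c _ => a0 c)
      have e4 : ∑ c ∈ C, ∑ b ∈ D, (1 - I (b + t c)) ≤ κ * (#C * #D) := by
        refine (sum_le_sum hexit).trans (le_of_eq ?_)
        rw [sum_const, nsmul_eq_mul]; ring
      linarith
    have e5 : ∑ c ∈ C, ∑ b ∈ D, δ * I (b + t c) * a c * a b =
        δ * ∑ c ∈ C, ∑ b ∈ D, I (b + t c) * a c * a b := by
      simp only [mul_sum]
      refine sum_congr rfl fun c _ => sum_congr rfl fun b _ => ?_
      ring
    rw [e5]
    have e6 := mul_le_mul_of_nonneg_left (e2.trans e1) h0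
    have e7 : δ * (κ * (#C * #D)) ≤ 1 * (κ * (#C * #D)) := by gcongr
    nlinarith
  -- the contribution of the mean value of `A` on `C`
  have term2 : -(4 * κ + η) * (#C * #D) ≤ ∑ c ∈ C, ∑ b ∈ D, h (b + t c) * δ * a b := by
    obtain ⟨g, hg⟩ : ∃ g : N → ℝ, g = fun b => ∑ c ∈ C, h (b + t c) := ⟨_, rfl⟩
    obtain ⟨e, he⟩ : ∃ e : N → ℝ, e = fun b => ∑ c ∈ C, (1 - I (b + t c)) := ⟨_, rfl⟩
    have e0 : ∀ b, 0 ≤ e b := fun b => by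
      rw [he]; exact sum_nonneg fun c _ => by linarith [I1 (b + t c)]
    have hge : ∀ b, g b ≤ κ * #C + e b := by
      intro b
      have h2 : g b ≤ ∑ c ∈ C, (a (-θ b + τ c) - δ + (1 - I (b + t c))) := by
        rw [hg]
        refine sum_le_sum fun c _ => ?_
        have e2 : -θ (b + t c) = -θ b + τ c := by simp [t]; abel
        simp only [h, e2]
        nlinarith [a0 (-θ b + τ c), I1 (b + t c), I0 (b + t c)]
      have h3 := hU (-θ b)
      rw [sum_add_distrib, sum_sub_distrib, sum_const, nsmul_eq_mul] at h2
      simp only [he]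
      linarith
    have hesum : ∑ b ∈ D, e b ≤ κ * (#C * #D) := by
      rw [he, sum_comm]
      refine (sum_le_sum hexit).trans (le_of_eq ?_)
      rw [sum_const, nsmul_eq_mul]; ring
    have hgsum : -(η + 2 * κ) * (#C * #D) ≤ ∑ b ∈ D, g b := by
      rw [hg, sum_comm]
      calc -(η + 2 * κ) * (#C * #D) = ∑ c ∈ C, -(η + 2 * κ) * #D := by
            rw [sum_const, nsmul_eq_mul]; ring
        _ ≤ _ := by
          refine sum_le_sum fun c hc => ?_
          have hh := norm_sum_translate_sub_le h hh1 D (t c) κ (hinv c hc)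
          rw [Real.norm_eq_abs, abs_le] at hh
          linarith [hh.1]
    -- `g` is at most `κ |C| + e` pointwise and its sum is nearly nonnegative, so weights `a b ∈ [0,
    -- 1]` cannot make its weighted sum very negative.
    have hmain : -(4 * κ + η) * (#C * #D) ≤ ∑ b ∈ D, g b * a b := by
      calc -(4 * κ + η) * (#C * #D) ≤ ∑ b ∈ D, (g b - κ * #C - e b) := by
            rw [sum_sub_distrib, sum_sub_distrib, sum_const, nsmul_eq_mul]
            linarith
        _ ≤ _ := by
          refine sum_le_sum fun b _ => ?_
          have h3 : 0 ≤ κ * #C + e b := add_nonneg (by positivity) (e0 b)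
          nlinarith [hge b, a0 b, a1 b, mul_nonneg h3 (a0 b),
            mul_nonneg (sub_nonneg.2 (hge b)) (sub_nonneg.2 (a1 b))]
    have e5 : ∑ c ∈ C, ∑ b ∈ D, h (b + t c) * δ * a b = δ * ∑ b ∈ D, g b * a b := by
      rw [sum_comm, mul_sum, hg]
      refine sum_congr rfl fun b _ => ?_
      simp only [sum_mul, mul_sum]
      refine sum_congr rfl fun c _ => ?_
      ring
    rw [e5]
    have e6 := mul_le_mul_of_nonneg_left hmain h0
    have e7 : 0 ≤ (1 - δ) * ((4 * κ + η) * (#C * #D)) :=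
      mul_nonneg (by linarith) (by positivity)
    linarith
  -- the contribution of the balanced function of `A` on `C`
  have term3 : -(S * #D) ≤ ∑ c ∈ C, ∑ b ∈ D, u (τ c - θ b) * (a c - δ) * a b := by
    let v : N → ℂ := fun c => if c ∈ C then ((a c - δ : ℝ) : ℂ) else 0
    let w : N → ℂ := fun b => if b ∈ D then (a b : ℂ) else 0
    have hv : ∀ γ, ‖fourierSum v γ‖ ≤ S := by
      intro γ
      have : fourierSum v γ = ∑ c ∈ C, ((a c - δ : ℝ) : ℂ) * γ c := by
        simp only [fourierSum, v, ite_mul, zero_mul, sum_ite_mem, univ_inter]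
      rw [this]; exact hS γ
    -- Both `u` and `w` have squared `L²` norm at most `|D|`, so the bound becomes `S |D|`.
    have key := norm_trilinear_le θ τ (fun x => (u x : ℂ)) v w S hv
    have hsum : ∑ c, ∑ b, (u (τ c - θ b) : ℂ) * v c * w b =
        ((∑ c ∈ C, ∑ b ∈ D, u (τ c - θ b) * (a c - δ) * a b : ℝ) : ℂ) := by
      simp only [v, w, mul_ite, mul_zero, ite_mul, zero_mul, sum_ite_mem, univ_inter,
        sum_ite_irrel, sum_const_zero]
      push_cast
      rfl
    have hu2 : ∑ x, ‖(u x : ℂ)‖ ^ 2 ≤ #D := by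
      calc ∑ x, ‖(u x : ℂ)‖ ^ 2 ≤ ∑ x, I (-θ.symm x) := by
            refine sum_le_sum fun x _ => ?_
            rw [Complex.norm_real, Real.norm_eq_abs, sq_abs]
            simp only [u]
            rw [mul_pow, Isq]
            have := abs_realInd_sub_le A x h0 h1
            rw [← ha] at this
            have h3 : (a x - δ) ^ 2 ≤ 1 := by rw [← sq_abs]; exact pow_le_one₀ (abs_nonneg _) this
            nlinarith [I0 (-θ.symm x)]
        _ = ∑ x, I x := Equiv.sum_comp ((θ.symm.toEquiv).trans (Equiv.neg N)) I
        _ = #D := by simp [hI, realInd]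
    have hw2 : ∑ x, ‖w x‖ ^ 2 ≤ #D := by
      calc ∑ x, ‖w x‖ ^ 2 ≤ ∑ x, I x := by
            refine sum_le_sum fun x _ => ?_
            simp only [w, hI, realInd]
            split_ifs
            · rw [Complex.norm_real, Real.norm_eq_abs, sq_abs]
              exact pow_le_one₀ (a0 x) (a1 x)
            · simp
        _ = #D := by simp [hI, realInd]
    rw [hsum, Complex.norm_real, Real.norm_eq_abs] at key
    have hfin : S * √(∑ x, ‖(u x : ℂ)‖ ^ 2) * √(∑ x, ‖w x‖ ^ 2) ≤ S * √(#D) * √(#D) := by gcongr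
    rw [mul_assoc S √(#D : ℝ), Real.mul_self_sqrt (Nat.cast_nonneg _)] at hfin
    exact (abs_le.1 (key.trans hfin)).1
  -- Write `a (τ c - θ b)` times the cutoff as `δ I + u`, and split `a c = δ + (a c - δ)` in the `u`
  -- term only. Dropping the cutoff only increases the count.
  have hfinal : ∑ c ∈ C, ∑ b ∈ D, δ * I (b + t c) * a c * a b +
      ∑ c ∈ C, ∑ b ∈ D, h (b + t c) * δ * a b +
      ∑ c ∈ C, ∑ b ∈ D, u (τ c - θ b) * (a c - δ) * a b ≤
      ∑ c ∈ C, ∑ b ∈ D, a (τ c - θ b) * a c * a b := by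
    rw [← sum_add_distrib, ← sum_add_distrib]
    refine sum_le_sum fun c _ => ?_
    rw [← sum_add_distrib, ← sum_add_distrib]
    refine sum_le_sum fun b _ => ?_
    rw [hu]
    have e2 : -θ (b + t c) = τ c - θ b := by simp [t]; abel
    simp only [h, e2]
    have h3 : 0 ≤ a (τ c - θ b) * (1 - I (b + t c)) :=
      mul_nonneg (a0 _) (by linarith [I1 (b + t c)])
    have h4 := mul_nonneg h3 (mul_nonneg (a0 c) (a0 b))
    linarith
  linarith

end TwistedRoth

/-! ### The density increment for twisted progressions and its iteration. -/

section TwistedRothIteration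

open Finset

variable {N : Type*} [AddCommGroup N] [Fintype N] [DecidableEq N]

set_option maxHeartbeats 400000 in
/-- A set with few twisted progressions has increased density on a smaller Bohr set. -/
lemma exists_bohr_increment (θ : N ≃+ N) (τ : N →+ N) (hτ : ∀ c, τ c = c + θ c) (κ δ : ℝ) (x : ℕ)
    (hκ : 0 < κ) (hκx : 1 ≤ κ * x) (hκδ : 100 * κ ≤ δ ^ 3) (hδ0 : 0 < δ) (hδ1 : δ ≤ 1)
    (A K B : Finset N) (hB : IsRegularBohr κ x B) (hδ : δ * #B ≤ ∑ y ∈ B, realInd A y)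
    (hK : ∀ c d, c + θ d ∈ A → c ∈ A → c - d ∈ A → d ∈ K)
    (hN : 2 ^ ((32 * x + 6) * (16 * x)) * (2 * (#K : ℝ)) < δ ^ 3 * Fintype.card N) :
    ∃ (B' : Finset N) (s : N), IsRegularBohr κ (4096 * x) B' ∧
      ((δ + κ) * #B' < ∑ y ∈ B', realInd A (s + y) ∨
        (δ + κ) * #B' < ∑ y ∈ B', realInd A (s + τ y)) := by
  classical
  by_contra! hcon
  have hx1 : 1 ≤ x := by
    rcases Nat.eq_zero_or_pos x with rfl | h
    · norm_num at hκx
    · exact h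
  have hscale : ∀ k : ℕ, 1 ≤ k → 1 ≤ κ * ((k * x : ℕ) : ℝ) := by
    intro k hk
    have hk' : (1 : ℝ) ≤ k := by exact_mod_cast hk
    push_cast
    nlinarith
  have hpow : ∀ {a b : ℕ}, a ≤ b → ((1 : ℝ) / 2) ^ b ≤ (1 / 2) ^ a := fun h =>
    pow_le_pow_of_le_one (by norm_num) (by norm_num) h
  have hU1 : ∀ B' s, IsRegularBohr κ (4096 * x) B' →
      ∑ y ∈ B', realInd A (s + y) ≤ (δ + κ) * #B' := fun B' s h => (hcon B' s h).1
  have hU2 : ∀ B' s, IsRegularBohr κ (4096 * x) B' →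
      ∑ y ∈ B', realInd A (s + τ y) ≤ (δ + κ) * #B' := fun B' s h => (hcon B' s h).2
  obtain ⟨Γ₀, ρ₀, hΓ₀, hρ₀, hB₀, hBreg⟩ := hB
  have hBpos : (0 : ℝ) < #B := by
    rw [hB₀]
    exact_mod_cast card_pos.2 ⟨0, zero_mem_bohr (le_trans (by positivity) hρ₀)⟩
  -- the Bohr set `D`
  obtain ⟨Γ₁, hΓ₁⟩ : ∃ Γ, Γ = Γ₀ ∪ pullFreq Γ₀ (θ : N →+ N) := ⟨_, rfl⟩
  have hΓ₁c : #Γ₁ ≤ 2 * x := by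
    rw [hΓ₁]
    refine (card_union_le _ _).trans ?_
    have := card_pullFreq_le Γ₀ (θ : N →+ N)
    omega
  obtain ⟨ρ₁, hρ₁l, hρ₁u, hDreg⟩ := exists_regular_radius hκ (hscale 2 (by norm_num)) Γ₁ hΓ₁c
  obtain ⟨D, hD⟩ : ∃ D, D = bohr Γ₁ ρ₁ := ⟨_, rfl⟩
  rw [show 8 * (2 * x) = 16 * x by ring] at hDreg
  have hDR : IsRegularBohr κ (16 * x) D :=
    ⟨Γ₁, ρ₁, by omega, (hpow (by omega)).trans hρ₁l, hD, by rw [hD]; exact hDreg⟩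
  have hρ₁σ : ρ₁ ≤ (1 / 2) ^ x := hρ₁u.trans (hpow (by omega))
  -- the Bohr set `C`
  obtain ⟨Γ₂, hΓ₂⟩ : ∃ Γ, Γ = Γ₁ ∪ pullFreq Γ₁ (θ.symm : N →+ N) := ⟨_, rfl⟩
  have hΓ₂c : #Γ₂ ≤ 4 * x := by
    rw [hΓ₂]
    refine (card_union_le _ _).trans ?_
    have := card_pullFreq_le Γ₁ (θ.symm : N →+ N)
    omega
  obtain ⟨ρ₂, hρ₂l, hρ₂u, hCreg⟩ := exists_regular_radius hκ (hscale 17 (by norm_num)) Γ₂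
    (by omega)
  obtain ⟨C, hC⟩ : ∃ C, C = bohr Γ₂ ρ₂ := ⟨_, rfl⟩
  rw [show 8 * (17 * x) = 136 * x by ring] at hCreg
  have hCR : IsRegularBohr κ (136 * x) C :=
    ⟨Γ₂, ρ₂, by omega, (hpow (by omega)).trans hρ₂l, hC, by rw [hC]; exact hCreg⟩
  have hρ₂pos : 0 < ρ₂ := lt_of_lt_of_le (by positivity) hρ₂l
  have hρ₁pos : 0 < ρ₁ := lt_of_lt_of_le (by positivity) hρ₁l
  have hCpos : (0 : ℝ) < #C := by
    rw [hC]; exact_mod_cast card_pos.2 ⟨0, zero_mem_bohr hρ₂pos.le⟩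
  have hDpos : (0 : ℝ) < #D := by
    rw [hD]; exact_mod_cast card_pos.2 ⟨0, zero_mem_bohr hρ₁pos.le⟩
  -- a good centre
  have hBinv : ∀ t ∈ bohr Γ₀ ((1 / 2) ^ x), (#{y ∈ B | y + t ∉ B} : ℝ) ≤ κ * #B := by
    intro t ht
    rw [hB₀] at hBreg ⊢
    exact card_translate_not_mem_le hBreg (by positivity) ht
  -- `D` uses the frequencies of `B` and their pullbacks along `θ`, so both `D` and `-θ D` consist
  -- of almost-periods of `B`.
  have hDsub : ∀ b ∈ D, b ∈ bohr Γ₀ ((1 / 2) ^ x) := fun b hb =>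
    bohr_mono (hΓ₁ ▸ subset_union_left) hρ₁σ (hD ▸ hb)
  have hθDsub : ∀ b ∈ D, -θ b ∈ bohr Γ₀ ((1 / 2) ^ x) := fun b hb => by
    refine neg_mem_bohr ?_
    have : b ∈ bohr (pullFreq Γ₀ (θ : N →+ N)) ((1 / 2) ^ x) :=
      bohr_mono (hΓ₁ ▸ subset_union_right) hρ₁σ (hD ▸ hb)
    exact mem_bohr_pullFreq.1 this
  have hCsub : ∀ c ∈ C, c ∈ bohr Γ₀ ((1 / 2) ^ x) := fun c hc =>
    bohr_mono ((hΓ₁ ▸ subset_union_left : Γ₀ ⊆ Γ₁).trans (hΓ₂ ▸ subset_union_left))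
      (hρ₂u.trans (hpow (by omega))) (hC ▸ hc)
  -- On average over `z ∈ B` the three densities sum to at least `3 (δ - 2 κ)`, and none exceeds `δ
  -- + κ`; hence at a suitable `z` each is at least `δ - 8 κ`.
  have hcentre : ∃ z : N, (δ - 8 * κ) * #D ≤ ∑ b ∈ D, realInd A (z + b) ∧
      (δ - 8 * κ) * #D ≤ ∑ b ∈ D, realInd A (z + -θ b) ∧
      (δ - 8 * κ) * #C ≤ ∑ c ∈ C, realInd A (z + c) := by
    have l1 := le_sum_translates A B D id κ δ (fun t ht => hBinv t (hDsub t ht)) hδ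
    have l2 := le_sum_translates A B D (fun b => -θ b) κ δ (fun t ht => hBinv _ (hθDsub t ht)) hδ
    have l3 := le_sum_translates A B C id κ δ (fun t ht => hBinv t (hCsub t ht)) hδ
    simp only [id] at l1 l3
    have u1 : ∀ z, ∑ b ∈ D, realInd A (z + b) ≤ (δ + κ) * #D := fun z =>
      hU1 D z (hDR.mono (by omega))
    have u2 : ∀ z, ∑ b ∈ D, realInd A (z + -θ b) ≤ (δ + κ) * #D := fun z => by
      have hmap := hDR.map (θ.trans (AddEquiv.neg N))
      have := hU1 _ z (hmap.mono (by omega))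
      rw [sum_image ((θ.trans (AddEquiv.neg N)).injective.injOn),
        card_image_of_injective _ (θ.trans (AddEquiv.neg N)).injective] at this
      exact this
    have u3 : ∀ z, ∑ c ∈ C, realInd A (z + c) ≤ (δ + κ) * #C := fun z =>
      hU1 C z (hCR.mono (by omega))
    have hsum : ∑ z ∈ B, 3 * (δ - 2 * κ) ≤ ∑ z ∈ B, ((∑ b ∈ D, realInd A (z + b)) / #D +
        (∑ b ∈ D, realInd A (z + -θ b)) / #D + (∑ c ∈ C, realInd A (z + c)) / #C) := by
      rw [sum_add_distrib, sum_add_distrib, ← sum_div, ← sum_div, ← sum_div, sum_const,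
        nsmul_eq_mul]
      rw [← le_div_iff₀ hDpos] at l1 l2
      rw [← le_div_iff₀ hCpos] at l3
      linarith
    obtain ⟨z, -, hz⟩ := exists_le_of_sum_le (card_pos.1 (by exact_mod_cast hBpos)) hsum
    have v1 := (div_le_iff₀ hDpos).2 (u1 z)
    have v2 := (div_le_iff₀ hDpos).2 (u2 z)
    have v3 := (div_le_iff₀ hCpos).2 (u3 z)
    refine ⟨z, (le_div_iff₀ hDpos).1 ?_, (le_div_iff₀ hDpos).1 ?_, (le_div_iff₀ hCpos).1 ?_⟩ <;>
    linarith
  obtain ⟨z, hzD, hzθ, hzC⟩ := hcentre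
  obtain ⟨A', hA'⟩ : ∃ A' : Finset N, A' = univ.filter fun y => z + y ∈ A := ⟨_, rfl⟩
  have hind : ∀ y, realInd A (z + y) = realInd A' y := fun y => by simp [realInd, hA']
  simp only [hind] at hzD hzθ hzC
  -- Fourier coefficients on `C`
  have hFourier : ∀ χ : AddChar N ℂ,
      ‖∑ c ∈ C, ((realInd A' c - δ : ℝ) : ℂ) * χ c‖ ≤ 15 * κ * #C := by
    intro χ
    -- Adding `χ` to the frequencies gives a Bohr set on which `χ` is within `κ` of `1`. The
    -- constant `15` is `7` plus the `8` lost in choosing the centre.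
    obtain ⟨ρ₃, hρ₃l, hρ₃u, hBreg'⟩ := exists_regular_radius hκ (hscale 137 (by norm_num))
      (insert χ Γ₂) ((card_insert_le _ _).trans (by omega))
    rw [show 8 * (137 * x) = 1096 * x by ring] at hBreg'
    have hB'R : IsRegularBohr κ (1096 * x) (bohr (insert χ Γ₂) ρ₃) :=
      ⟨_, ρ₃, (card_insert_le _ _).trans (by omega), (hpow (by omega)).trans hρ₃l, rfl, hBreg'⟩
    have hρ₃κ : ρ₃ ≤ κ := by
      have hx2 : (x : ℝ) ≤ 2 ^ x := by exact_mod_cast Nat.lt_two_pow_self.le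
      have h1 : ((1 : ℝ) / 2) ^ x ≤ κ := by
        rw [one_div, inv_pow, ← one_div, div_le_iff₀ (by positivity)]
        nlinarith
      exact hρ₃u.trans ((hpow (by omega)).trans h1)
    have := norm_fourier_le_of_no_increment A' C (bohr (insert χ Γ₂) ρ₃) χ κ δ (8 * κ) hκ.le hδ0.le
      hδ1 (by
        intro t ht
        rw [hC]
        exact card_translate_not_mem_le hCreg (by positivity)
          (bohr_mono (subset_insert _ _) (hρ₃u.trans (hpow (by omega))) ht))
      (fun t ht => (mem_bohr.1 ht χ (mem_insert_self _ _)).trans hρ₃κ)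
      ⟨0, zero_mem_bohr (le_trans (by positivity) hρ₃l)⟩
      (fun s => by
        simp only [← hind, ← add_assoc]
        exact hU1 _ (z + s) (hB'R.mono (by omega))) hzC
    linarith
  have hκδ' : 8 * κ ≤ δ := by
    have : δ ^ 3 ≤ δ := pow_le_of_le_one hδ0.le hδ1 (by norm_num)
    linarith
  have hcount := twisted_count_lower_bound θ τ A' C D κ δ (8 * κ) (15 * κ * #C) hκ.le hδ1
    (by linarith) hκδ' (by positivity) (by
      intro c hc
      rw [hD]
      -- The frequencies of `C` include pullbacks along `θ⁻¹` so that `θ⁻¹ τ c = θ⁻¹ c + c` lies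
      -- within the regularity width of `D`.
      refine card_translate_not_mem_le hDreg (by positivity) (neg_mem_bohr ?_)
      rw [hτ, map_add, θ.symm_apply_apply]
      have h1 : c ∈ bohr Γ₁ ρ₂ := bohr_mono (hΓ₂ ▸ subset_union_left) le_rfl (hC ▸ hc)
      have h2 : θ.symm c ∈ bohr Γ₁ ρ₂ := by
        have : c ∈ bohr (pullFreq Γ₁ (θ.symm : N →+ N)) ρ₂ :=
          bohr_mono (hΓ₂ ▸ subset_union_right) le_rfl (hC ▸ hc)
        exact mem_bohr_pullFreq.1 this
      refine bohr_mono subset_rfl ?_ (add_mem_bohr h2 h1)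
      have h3 : ((1 : ℝ) / 2) ^ (17 * x) ≤ (1 / 2) ^ (16 * x + 1) := hpow (by omega)
      rw [pow_succ] at h3
      linarith) hzD hzθ hzC (fun s => by
        simp only [← hind, ← add_assoc]
        exact hU2 C (z + s) (hCR.mono (by omega))) hFourier
  -- The progression attached to `(c, b)` has difference `c - b`, which must lie in the exceptional
  -- set `K`.
  have hcountU : ∑ c ∈ C, ∑ b ∈ D, realInd A' (τ c - θ b) * realInd A' c * realInd A' b ≤
      #C * #K := by
    have h1 : ∀ c ∈ C, ∑ b ∈ D, realInd A' (τ c - θ b) * realInd A' c * realInd A' b ≤ #K := by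
      intro c _
      calc ∑ b ∈ D, realInd A' (τ c - θ b) * realInd A' c * realInd A' b
          ≤ ∑ b ∈ D, realInd K (c - b) := by
            refine sum_le_sum fun b _ => ?_
            have := realInd_nonneg K (c - b)
            by_cases h1 : τ c - θ b ∈ A'
            · by_cases h2 : c ∈ A'
              · by_cases h3 : b ∈ A'
                · have hk : c - b ∈ K := by
                    simp only [hA', mem_filter, mem_univ, true_and] at h1 h2 h3
                    refine hK (z + c) (c - b) ?_ h2 ?_
                    · convert h1 using 1; rw [hτ, map_sub]; abel
                    · convert h3 using 1; abel
                  simp [realInd, h1, h2, h3, hk]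
                · simpa [realInd, h3] using this
              · simpa [realInd, h2] using this
            · simpa [realInd, h1] using this
        _ ≤ #K := by
          rw [sum_realInd]
          refine Nat.cast_le.2 (card_le_card_of_injOn (fun b => c - b) ?_ sub_right_injective.injOn)
          intro b hb
          exact (mem_filter.1 hb).2
    refine (sum_le_sum h1).trans (le_of_eq ?_)
    rw [sum_const, nsmul_eq_mul]
  have hmain : δ ^ 3 / 2 * #D ≤ #K := by
    refine le_of_mul_le_mul_left ?_ hCpos
    refine le_trans ?_ hcountU
    refine le_trans ?_ hcount
    -- The losses are at most `16 κ` from the cube and `5 κ + 8 κ + 15 κ` from the errors, `44 κ` in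
    -- all, below `δ³ / 2` since `100 κ ≤ δ³`.
    have h1 : δ ^ 3 / 2 ≤ δ * (δ - 8 * κ) ^ 2 - 5 * κ - 8 * κ - 15 * κ := by
      have h2 : δ ^ 2 * κ ≤ 1 * κ := by gcongr; exact pow_le_one₀ hδ0.le hδ1
      have h3 : 0 ≤ δ * κ ^ 2 := by positivity
      nlinarith
    have h4 := mul_le_mul_of_nonneg_right h1 (mul_pos hCpos hDpos).le
    refine le_trans (le_of_eq ?_) (h4.trans (le_of_eq ?_)) <;> ring
  have hcard : (Fintype.card N : ℝ) ≤ 2 ^ ((32 * x + 6) * (16 * x)) * #D := by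
    have := hDR.card_le
    rw [show 2 * (16 * x) + 6 = 32 * x + 6 by ring] at this
    exact_mod_cast this
  have hδ3 : 0 < δ ^ 3 := by positivity
  have h2p : (0 : ℝ) < 2 ^ ((32 * x + 6) * (16 * x)) := by positivity
  have h5 : δ ^ 3 * (Fintype.card N : ℝ) ≤ 2 ^ ((32 * x + 6) * (16 * x)) * (2 * (#K : ℝ)) := by
    calc δ ^ 3 * (Fintype.card N : ℝ) ≤ δ ^ 3 * (2 ^ ((32 * x + 6) * (16 * x)) * #D) := by gcongr
      _ = 2 ^ ((32 * x + 6) * (16 * x)) * (2 * (δ ^ 3 / 2 * #D)) := by ring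
      _ ≤ _ := by gcongr
  linarith

/-- Controls the growth of the exceptional set when the problem is pulled back along the possibly
non-injective `τ`. -/
lemma card_preimage_le_mul_card_ker (τ : N →+ N) (K : Finset N) :
    #{d | τ d ∈ K} ≤ #{d | τ d = 0} * #K := by
  have h := card_le_mul_card_image (s := {d | τ d ∈ K}) (f := τ) #{d | τ d = 0} (by
    intro g hg
    obtain ⟨y, hy, rfl⟩ := mem_image.1 hg
    refine card_le_card_of_injOn (fun d => d - y) ?_ (sub_left_injective.injOn)
    intro d hd
    have := (mem_filter.1 hd).2
    simp [this])
  refine h.trans (Nat.mul_le_mul_left _ (card_le_card ?_))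
  intro g hg
  obtain ⟨y, hy, rfl⟩ := mem_image.1 hg
  exact (mem_filter.1 hy).2

/-- **Roth's theorem for twisted progressions** in finite abelian groups. -/
theorem card_le_of_twisted_roth (θ : N ≃+ N) (A : Finset N) (α : ℝ) (hα : 0 < α)
    (hA : α * Fintype.card N ≤ #A)
    (htriv : ∀ c d, c + θ d ∈ A → c ∈ A → c - d ∈ A → d = 0) :
    (Fintype.card N : ℝ) ≤ 2 ^ (2 ^ (36 * ⌈100 / α ^ 3⌉₊)) := by
  have hn0 : (0 : ℝ) < Fintype.card N := by
    exact_mod_cast Fintype.card_pos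
  have hα1 : α ≤ 1 := by
    have h1 : (#A : ℝ) ≤ Fintype.card N := by exact_mod_cast card_le_univ A
    nlinarith
  obtain ⟨τ, hτ⟩ : ∃ τ : N →+ N, τ = AddMonoidHom.id N + (θ : N →+ N) := ⟨_, rfl⟩
  have hτ' : ∀ c, τ c = c + θ c := fun c => by rw [hτ]; simp
  -- The kernel of `τ = 1 + θ` has at most `1 / α` elements: two points of `A` differing by `d` in
  -- it would form a progression, since `a + θ d = a - d`. So `(a, k) ↦ a + k` is injective on `A ×
  -- ker τ`.
  have hker : (#{d | τ d = 0} : ℝ) * α ≤ 1 := by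
    have h1 : #A * #{d | τ d = 0} ≤ Fintype.card N := by
      rw [← card_product, ← card_univ]
      refine card_le_card_of_injOn (fun p => p.1 + p.2) (fun _ _ => mem_coe.2 (mem_univ _)) ?_
      rintro ⟨a, k⟩ h ⟨a', k'⟩ h' heq
      simp only [coe_product, Set.mem_prod, mem_coe, mem_filter, mem_univ, true_and] at h h' heq
      have e1 : a - a' = k' - k := by
        rw [sub_eq_sub_iff_add_eq_add, heq]; abel
      have e2 : θ (a - a') = -(a - a') := by
        have : τ (a - a') = 0 := by rw [e1, map_sub, h.2, h'.2, sub_zero]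
        rw [hτ'] at this
        exact (neg_eq_of_add_eq_zero_right this).symm
      have e3 : a - a' = 0 := by
        refine htriv a (a - a') ?_ h.1 ?_
        · rw [e2]; simpa using h'.1
        · simpa using h'.1
      rw [e3] at e1
      exact Prod.ext (sub_eq_zero.1 e3) (sub_eq_zero.1 e1.symm).symm
    have h2 : (#A : ℝ) * #{d | τ d = 0} ≤ Fintype.card N := by exact_mod_cast h1
    have h3 : α * Fintype.card N * #{d | τ d = 0} ≤ #A * #{d | τ d = 0} := by gcongr
    refine le_of_mul_le_mul_right ?_ hn0
    linarith
  obtain ⟨κ, hκ⟩ : ∃ κ, κ = α ^ 3 / 100 := ⟨_, rfl⟩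
  have hκ0 : 0 < κ := by rw [hκ]; positivity
  obtain ⟨y, hy⟩ : ∃ y : ℕ, y = ⌈100 / α ^ 3⌉₊ := ⟨_, rfl⟩
  have hy1 : 100 / α ^ 3 ≤ y := hy ▸ Nat.le_ceil _
  have hκy : 1 ≤ κ * y := by
    rw [div_le_iff₀ (by positivity)] at hy1
    rw [hκ]; linarith
  have hα3 : α ^ 3 ≤ α := pow_le_of_le_one hα.le hα1 (by norm_num)
  have hαy : 1 ≤ α * y := by
    have : κ * y ≤ α * y := by
      refine mul_le_mul_of_nonneg_right ?_ (Nat.cast_nonneg _)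
      rw [hκ]; linarith
    linarith
  have hα3y : 2 ≤ α ^ 3 * y := by rw [hκ] at hκy; linarith
  have hy0 : 1 ≤ y := by
    rcases Nat.eq_zero_or_pos y with h | h
    · rw [h] at hκy; norm_num at hκy
    · exact h
  rw [← hy]
  by_contra! hbig
  have hkery : #{d | τ d = 0} ≤ y := by
    have : (#{d | τ d = 0} : ℝ) ≤ y := by
      refine le_of_mul_le_mul_right (hker.trans ?_) hα
      linarith
    exact_mod_cast this
  have hsize : ∀ j < y, ∀ K : Finset N, #K ≤ y ^ j → ∀ δ : ℝ, α ≤ δ →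
      2 ^ ((32 * (4096 ^ j * y) + 6) * (16 * (4096 ^ j * y))) * (2 * (#K : ℝ)) <
        δ ^ 3 * Fintype.card N := by
    intro j hj K hK δ hδ
    obtain ⟨X, hX⟩ : ∃ X, X = 4096 ^ j * y := ⟨_, rfl⟩
    rw [← hX]
    have hy2 : y ≤ 2 ^ y := Nat.lt_two_pow_self.le
    have hX1 : 1 ≤ X := by rw [hX]; exact Nat.one_le_iff_ne_zero.2 (by positivity)
    have hXle : X ≤ 2 ^ (13 * y) := by
      rw [hX]
      calc 4096 ^ j * y ≤ 4096 ^ y * 2 ^ y := by gcongr; norm_num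
        _ = 2 ^ (13 * y) := by
          rw [show (4096 : ℕ) = 2 ^ 12 by norm_num, ← pow_mul, ← pow_add]; congr 1; ring
    have hyX : y ≤ X := by rw [hX]; exact Nat.le_mul_of_pos_left _ (by positivity)
    have hKy : #K * y ≤ 2 ^ (X * X) := by
      calc #K * y ≤ y ^ j * y := by gcongr
        _ = y ^ (j + 1) := (pow_succ _ _).symm
        _ ≤ y ^ y := Nat.pow_le_pow_right hy0 hj
        _ ≤ (2 ^ y) ^ y := Nat.pow_le_pow_left hy2 _
        _ = 2 ^ (y * y) := (pow_mul _ _ _).symm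
        _ ≤ _ := Nat.pow_le_pow_right (by norm_num) (Nat.mul_le_mul hyX hyX)
    have hexp : (32 * X + 6) * (16 * X) + X * X ≤ 2 ^ (36 * y) := by
      calc (32 * X + 6) * (16 * X) + X * X ≤ 2 ^ 10 * (X * X) := by nlinarith
        _ ≤ 2 ^ (10 * y) * (2 ^ (13 * y) * 2 ^ (13 * y)) := by
          gcongr <;> omega
        _ = _ := by rw [← pow_add, ← pow_add]; congr 1; ring
    have hδy : 2 ≤ δ ^ 3 * y := hα3y.trans (by gcongr)
    have hfin : (2 : ℝ) ^ ((32 * X + 6) * (16 * X)) * (#K * y) ≤ 2 ^ (2 ^ (36 * y)) := by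
      calc (2 : ℝ) ^ ((32 * X + 6) * (16 * X)) * (#K * y)
          ≤ 2 ^ ((32 * X + 6) * (16 * X)) * 2 ^ (X * X) := by gcongr; exact_mod_cast hKy
        _ = 2 ^ ((32 * X + 6) * (16 * X) + X * X) := (pow_add _ _ _).symm
        _ ≤ _ := pow_le_pow_right₀ (by norm_num) hexp
    have hδ3 : 0 < δ ^ 3 := pow_pos (hα.trans_le hδ) 3
    calc (2 : ℝ) ^ ((32 * X + 6) * (16 * X)) * (2 * (#K : ℝ))
        ≤ 2 ^ ((32 * X + 6) * (16 * X)) * (δ ^ 3 * y * #K) := by gcongr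
      _ = δ ^ 3 * (2 ^ ((32 * X + 6) * (16 * X)) * (#K * y)) := by ring
      _ ≤ δ ^ 3 * 2 ^ (2 ^ (36 * y)) := by gcongr
      _ < _ := by gcongr
  -- The iteration carries a set `K` of admissible differences, initially `{0}`: an increment along
  -- `τ` enlarges it by at most the factor `|ker τ| ≤ y`. After `y` steps of gain `κ` the density
  -- would exceed `1`.
  have key : ∀ j ≤ y, ∃ A' K B : Finset N, IsRegularBohr κ (4096 ^ j * y) B ∧ B.Nonempty ∧
      (α + j * κ) * #B ≤ ∑ x ∈ B, realInd A' x ∧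
      (∀ c d, c + θ d ∈ A' → c ∈ A' → c - d ∈ A' → d ∈ K) ∧ #K ≤ y ^ j := by
    intro j
    induction j with
    | zero =>
      intro _
      refine ⟨A, {0}, univ, isRegularBohr_univ hκ0.le _, univ_nonempty, ?_, ?_, by simp⟩
      · rw [sum_realInd A univ (fun x => x)]
        simpa using hA
      · intro c d h1 h2 h3
        exact mem_singleton.2 (htriv c d h1 h2 h3)
    | succ j ih =>
      intro hj
      obtain ⟨A', K, B, hB, hB0, hδ, hpat, hK⟩ := ih (by omega)
      have hBpos : (0 : ℝ) < #B := by exact_mod_cast hB0.card_pos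
      have hjκ : 0 ≤ j * κ := by positivity
      have hδ1 : α + j * κ ≤ 1 := by
        refine le_of_mul_le_mul_right (hδ.trans ?_) hBpos
        rw [sum_realInd A' B (fun x => x), one_mul]
        exact_mod_cast card_filter_le _ _
      have hαδ : α ≤ α + j * κ := by linarith
      obtain ⟨B', s, hB', h | h⟩ := exists_bohr_increment θ τ hτ' κ (α + j * κ) (4096 ^ j * y) hκ0
        (hκy.trans (by
          refine mul_le_mul_of_nonneg_left ?_ hκ0.le
          exact_mod_cast Nat.le_mul_of_pos_left _ (by positivity)))
        (by
          have : α ^ 3 ≤ (α + j * κ) ^ 3 := by gcongr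
          rw [hκ] at this ⊢; linarith) (by linarith) hδ1 A' K B hB hδ hpat
          (hsize j (by omega) K hK _ hαδ)
      all_goals
        have hB'0 : B'.Nonempty := by
          rcases B'.eq_empty_or_nonempty with rfl | h'
          · simp at h
          · exact h'
        rw [← mul_assoc, ← pow_succ'] at hB'
      · refine ⟨univ.filter fun y => s + y ∈ A', K, B', hB', hB'0, ?_, ?_, hK.trans ?_⟩
        · simp only [realInd, mem_filter, mem_univ, true_and]
          simp only [realInd] at h
          push_cast; linarith
        · intro c d h1 h2 h3
          simp only [mem_filter, mem_univ, true_and] at h1 h2 h3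
          exact hpat (s + c) d (by rwa [add_assoc]) h2 (by rwa [add_sub_assoc])
        · exact Nat.pow_le_pow_right hy0 (by omega)
      · refine ⟨univ.filter fun y => s + τ y ∈ A', univ.filter fun d => τ d ∈ K, B', hB', hB'0, ?_, ?_, ?_⟩
        · simp only [realInd, mem_filter, mem_univ, true_and]
          simp only [realInd] at h
          push_cast; linarith
        · intro c d h1 h2 h3
          simp only [mem_filter, mem_univ, true_and] at h1 h2 h3 ⊢
          -- Because `τ` commutes with `θ`, the map `y ↦ s + τ y` carries progressions of difference
          -- `d` to progressions of difference `τ d`.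
          have hcomm : τ (θ d) = θ (τ d) := by rw [hτ', hτ', map_add]
          refine hpat (s + τ c) (τ d) ?_ h2 ?_
          · rwa [add_assoc, ← hcomm, ← map_add]
          · rwa [add_sub_assoc, ← map_sub]
        · refine (card_preimage_le_mul_card_ker τ K).trans ?_
          rw [pow_succ']
          exact Nat.mul_le_mul hkery hK
  obtain ⟨A', K, B, hB, hB0, hδ, -, -⟩ := key y le_rfl
  have hBpos : (0 : ℝ) < #B := by exact_mod_cast hB0.card_pos
  have hδ1 : α + y * κ ≤ 1 := by
    refine le_of_mul_le_mul_right (hδ.trans ?_) hBpos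
    rw [sum_realInd A' B (fun x => x), one_mul]
    exact_mod_cast card_filter_le _ _
  linarith

end TwistedRothIteration

/-! ### Mixing in groups without small nontrivial representations. -/

section Quasirandom

open Finset Module

/-- All isometric real representations of dimension at most `D` are trivial. -/
def OnlyTrivialReps (D : ℕ) (K : Type*) [Group K] : Prop :=
  ∀ d ≤ D, ∀ ρ : K →* (EuclideanSpace ℝ (Fin d) →L[ℝ] EuclideanSpace ℝ (Fin d)),
    (∀ g x, ‖ρ g x‖ = ‖x‖) → ∀ g, ρ g = 1

/-- Right translation of functions on a group. -/
def rightTranslate {K : Type*} [Group K] (g : K) : EuclideanSpace ℝ K →ₗ[ℝ] EuclideanSpace ℝ K where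
  toFun F := WithLp.toLp 2 fun x => F (x * g)
  map_add' _ _ := rfl
  map_smul' _ _ := rfl

lemma rightTranslate_apply {K : Type*} [Group K] (g : K) (F : EuclideanSpace ℝ K) (x : K) :
    rightTranslate g F x = F (x * g) := rfl

variable {K : Type*} [Group K] [Fintype K]

lemma norm_rightTranslate (g : K) (F : EuclideanSpace ℝ K) : ‖rightTranslate g F‖ = ‖F‖ := by
  rw [EuclideanSpace.norm_eq, EuclideanSpace.norm_eq]
  congr 1
  exact Equiv.sum_comp (Equiv.mulRight g) fun x => ‖F x‖ ^ 2

/-- Orthonormal coordinates on `W` turn right translation into an isometric representation of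
dimension at most `D`. -/
lemma OnlyTrivialReps.rightTranslate_eq {D : ℕ} (hK : OnlyTrivialReps D K)
    (W : Submodule ℝ (EuclideanSpace ℝ K)) (hW : finrank ℝ W ≤ D)
    (hinv : ∀ g, ∀ F ∈ W, rightTranslate g F ∈ W) (F : EuclideanSpace ℝ K) (hF : F ∈ W) (g : K) :
    rightTranslate g F = F := by
  let b := stdOrthonormalBasis ℝ W
  let R : K → W →ₗ[ℝ] W := fun g => (rightTranslate g).restrict (hinv g)
  have R1 : ∀ x, R 1 x = x := fun x => by
    ext y; simp [R, LinearMap.restrict_apply, rightTranslate_apply]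
  have Rmul : ∀ g h x, R (g * h) x = R g (R h x) := fun g h x => by
    ext y; simp [R, LinearMap.restrict_apply, rightTranslate_apply, mul_assoc]
  let ρ : K →* (EuclideanSpace ℝ (Fin (finrank ℝ W)) →L[ℝ] EuclideanSpace ℝ (Fin (finrank ℝ W))) :=
    { toFun := fun g => LinearMap.toContinuousLinearMap
        (b.repr.toLinearEquiv.toLinearMap ∘ₗ R g ∘ₗ b.repr.symm.toLinearEquiv.toLinearMap)
      map_one' := by
        refine ContinuousLinearMap.ext fun x => ?_
        simp [R1]
      map_mul' := fun g h => by
        refine ContinuousLinearMap.ext fun x => ?_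
        simp [Rmul] }
  have hρ : ∀ g x, ρ g x = b.repr (R g (b.repr.symm x)) := fun g x => rfl
  have h := hK _ hW ρ (fun g x => by
    rw [hρ, LinearIsometryEquiv.norm_map]
    change ‖rightTranslate g (b.repr.symm x : EuclideanSpace ℝ K)‖ = _
    rw [norm_rightTranslate, ← Submodule.coe_norm, LinearIsometryEquiv.norm_map]) g
  have h2 := hρ g (b.repr ⟨F, hF⟩)
  rw [h, LinearIsometryEquiv.symm_apply_apply] at h2
  have h3 : (⟨F, hF⟩ : W) = R g ⟨F, hF⟩ := b.repr.injective h2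
  exact (congrArg Subtype.val h3).symm

/-- Otherwise right translation on all functions would be trivial, yet it moves the point mass at
`1`. -/
lemma OnlyTrivialReps.lt_card {D : ℕ} (hK : OnlyTrivialReps D K) [Nontrivial K] :
    D < Fintype.card K := by
  classical
  by_contra! h
  obtain ⟨g, hg⟩ := exists_ne (1 : K)
  have h1 := hK.rightTranslate_eq ⊤ (by simpa using h) (fun _ _ _ => Submodule.mem_top)
    (EuclideanSpace.single 1 (1 : ℝ)) Submodule.mem_top g
  have h2 := congrArg (fun F : EuclideanSpace ℝ K => F 1) h1
  simp [rightTranslate_apply, hg] at h2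

/-- Left convolution with `f`. -/
def convLeft (f : K → ℝ) : EuclideanSpace ℝ K →ₗ[ℝ] EuclideanSpace ℝ K where
  toFun F := WithLp.toLp 2 fun x => ∑ y, f (x * y⁻¹) * F y
  map_add' F H := by ext x; simp [mul_add, sum_add_distrib]
  map_smul' c F := by
    ext x
    simp only [PiLp.smul_apply, smul_eq_mul, RingHom.id_apply, mul_sum]
    exact sum_congr rfl fun y _ => by ring

lemma convLeft_apply (f : K → ℝ) (F : EuclideanSpace ℝ K) (x : K) :
    convLeft f F x = ∑ y, f (x * y⁻¹) * F y := rfl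

/-- Makes the eigenspaces of operators built from left convolutions invariant under right
translation, hence subrepresentations. -/
lemma convLeft_rightTranslate (f : K → ℝ) (F : EuclideanSpace ℝ K) (g : K) :
    convLeft f (rightTranslate g F) = rightTranslate g (convLeft f F) := by
  ext x
  rw [convLeft_apply, rightTranslate_apply, convLeft_apply]
  refine Fintype.sum_equiv (Equiv.mulRight g) _ _ fun y => ?_
  simp [rightTranslate_apply, mul_assoc]

lemma inner_convLeft (f : K → ℝ) (F H : EuclideanSpace ℝ K) :
    inner ℝ (convLeft f F) H = inner ℝ F (convLeft (fun x => f x⁻¹) H) := by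
  simp only [PiLp.inner_apply, convLeft_apply, RCLike.inner_apply, conj_trivial, mul_sum, sum_mul]
  rw [sum_comm]
  refine sum_congr rfl fun y _ => sum_congr rfl fun x _ => ?_
  rw [mul_inv_rev, inv_inv]
  ring

/-- Convolution with a balanced function is a contraction on a quasirandom group. -/
lemma OnlyTrivialReps.norm_convLeft_sq_le {D : ℕ} (hK : OnlyTrivialReps D K) (f : K → ℝ)
    (hf : ∑ x, f x = 0) (F : EuclideanSpace ℝ K) :
    D * ‖convLeft f F‖ ^ 2 ≤ Fintype.card K * (∑ x, f x ^ 2) * ‖F‖ ^ 2 := by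
  classical
  obtain ⟨M, hM⟩ : ∃ M, M = (Fintype.card K : ℝ) * ∑ x, f x ^ 2 := ⟨_, rfl⟩
  have hM0 : 0 ≤ M := by rw [hM]; positivity
  rw [← hM]
  -- `S = T* T` for `T` the convolution by `f`; its largest eigenvalue is the squared operator norm
  -- of `T`.
  let S : EuclideanSpace ℝ K →ₗ[ℝ] EuclideanSpace ℝ K :=
    convLeft (fun x => f x⁻¹) ∘ₗ convLeft f
  have hSinner : ∀ F H, inner ℝ (S F) H = inner ℝ (convLeft f F) (convLeft f H) := by
    intro F H
    have := inner_convLeft f H (convLeft f F)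
    rw [real_inner_comm, real_inner_comm _ H] at this
    exact this.symm
  have hSsymm : S.IsSymmetric := by
    intro F H
    rw [hSinner, real_inner_comm, ← hSinner, real_inner_comm]
  have hSnorm : ∀ F, inner ℝ (S F) F = ‖convLeft f F‖ ^ 2 := fun F => by
    rw [hSinner, real_inner_self_eq_norm_sq]
  have heig : ∀ c : ℝ, End.HasEigenvalue S c → D * c ≤ M := by
    intro c hc
    rcases le_or_gt c 0 with hc0 | hc0
    · exact (mul_nonpos_of_nonneg_of_nonpos (Nat.cast_nonneg _) hc0).trans hM0
    -- An eigenspace of dimension at most `D` would consist of constants, which `T` kills because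
    -- `f` has mean zero.
    have hdim : D < finrank ℝ (End.eigenspace S c) := by
      by_contra! hle
      obtain ⟨v, hv⟩ := hc.exists_hasEigenvector
      have hfix := hK.rightTranslate_eq (End.eigenspace S c) hle (by
        intro g F hF
        rw [End.mem_eigenspace_iff] at hF ⊢
        simp only [S, LinearMap.comp_apply] at hF ⊢
        rw [convLeft_rightTranslate, convLeft_rightTranslate, hF, map_smul]) v hv.1
      have hconst : ∀ x, v x = v 1 := fun x => by
        have := congrArg (fun F : EuclideanSpace ℝ K => F 1) (hfix x)
        simpa [rightTranslate_apply] using this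
      have hT : convLeft f v = 0 := by
        ext x
        rw [convLeft_apply]
        simp only [hconst, ← sum_mul]
        have : ∑ y, f (x * y⁻¹) = ∑ y, f y :=
          Equiv.sum_comp ((Equiv.inv K).trans (Equiv.mulLeft x)) f
        rw [this, hf]; simp
      have hS : S v = 0 := by simp only [S, LinearMap.comp_apply, hT, map_zero]
      have := End.mem_eigenspace_iff.1 hv.1
      rw [hS] at this
      rcases smul_eq_zero.1 this.symm with h | h
      · exact hc0.ne' h
      · exact hv.2 h
    let b := stdOrthonormalBasis ℝ (End.eigenspace S c)
    have horth : Orthonormal ℝ fun i => (b i : EuclideanSpace ℝ K) :=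
      b.orthonormal.comp_linearIsometry (End.eigenspace S c).subtypeₗᵢ
    let r : K → EuclideanSpace ℝ K := fun x => WithLp.toLp 2 fun y => f (x * y⁻¹)
    have hr : ∀ x F, convLeft f F x = inner ℝ F (r x) := by
      intro x F
      rw [convLeft_apply, PiLp.inner_apply]
      refine sum_congr rfl fun y _ => ?_
      simp [r]
    have h1 : ∀ i, c = ∑ x, ‖inner ℝ (b i : EuclideanSpace ℝ K) (r x)‖ ^ 2 := by
      intro i
      have h2 := hSnorm (b i)
      rw [End.mem_eigenspace_iff.1 (b i).2, inner_smul_left, real_inner_self_eq_norm_sq,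
        horth.1 i, EuclideanSpace.norm_sq_eq] at h2
      simp only [hr] at h2
      simpa using h2
    -- The multiplicity times the eigenvalue is at most the squared Hilbert-Schmidt norm of `T`, by
    -- Bessel's inequality applied to each row.
    have h2 : (finrank ℝ (End.eigenspace S c) : ℝ) * c ≤ M := by
      calc (finrank ℝ (End.eigenspace S c) : ℝ) * c
          = ∑ i : Fin (finrank ℝ (End.eigenspace S c)), c := by simp
        _ = ∑ i, ∑ x, ‖inner ℝ (b i : EuclideanSpace ℝ K) (r x)‖ ^ 2 :=
          sum_congr rfl fun i _ => h1 i
        _ = ∑ x, ∑ i, ‖inner ℝ (b i : EuclideanSpace ℝ K) (r x)‖ ^ 2 := sum_comm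
        _ ≤ ∑ x, ‖r x‖ ^ 2 := sum_le_sum fun x _ => horth.sum_inner_products_le (r x)
        _ = ∑ x : K, ∑ y, f y ^ 2 := by
          refine sum_congr rfl fun x _ => ?_
          rw [EuclideanSpace.real_norm_sq_eq]
          exact Equiv.sum_comp ((Equiv.inv K).trans (Equiv.mulLeft x)) fun y => f y ^ 2
        _ = M := by rw [sum_const, nsmul_eq_mul, hM, card_univ]
    refine le_trans ?_ h2
    gcongr
  let e := hSsymm.eigenvectorBasis rfl
  have hexp : ‖convLeft f F‖ ^ 2 =
      ∑ i, hSsymm.eigenvalues rfl i * inner ℝ (e i) F ^ 2 := by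
    rw [← hSnorm, ← e.sum_inner_mul_inner]
    refine sum_congr rfl fun i _ => ?_
    rw [hSsymm F (e i), hSsymm.apply_eigenvectorBasis, inner_smul_right]
    simp only [e, RCLike.ofReal_real_eq_id, id]
    rw [real_inner_comm F]
    ring
  rw [hexp, mul_sum]
  have hpars : ‖F‖ ^ 2 = ∑ i, inner ℝ (e i) F ^ 2 := by
    rw [← real_inner_self_eq_norm_sq, ← e.sum_inner_mul_inner]
    refine sum_congr rfl fun i _ => ?_
    rw [real_inner_comm F]; ring
  rw [hpars, mul_sum]
  refine sum_le_sum fun i _ => ?_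
  rw [← mul_assoc]
  exact mul_le_mul_of_nonneg_right (heig _ (hSsymm.hasEigenvalue_eigenvalues rfl i)) (sq_nonneg _)

/-- Mixing: products of dense sets in a quasirandom group are equidistributed. -/
lemma OnlyTrivialReps.card_mul_le [DecidableEq K] {D : ℕ} (hK : OnlyTrivialReps D K) (hD : 0 < D)
    (X Y W : Finset K) :
    (#X * #Y * #W : ℝ) / Fintype.card K - Real.sqrt (Fintype.card K * #X * #Y * #W / D) ≤
      #{p ∈ X ×ˢ Y | p.1 * p.2 ∈ W} := by
  have hn : (0 : ℝ) < Fintype.card K := by exact_mod_cast Fintype.card_pos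
  have hD' : (0 : ℝ) < D := by exact_mod_cast hD
  obtain ⟨ξ, hξ⟩ : ∃ ξ, ξ = (#X : ℝ) / Fintype.card K := ⟨_, rfl⟩
  obtain ⟨f, hf⟩ : ∃ f : K → ℝ, f = fun x => realInd X x - ξ := ⟨_, rfl⟩
  have hXsum : ∑ x, realInd X x = #X := by simp [realInd]
  have hf0 : ∑ x, f x = 0 := by
    rw [hf, sum_sub_distrib, hXsum, sum_const, nsmul_eq_mul, card_univ, hξ]
    field_simp
    ring
  have hf2 : ∑ x, f x ^ 2 ≤ #X := by
    have : ∀ x, f x ^ 2 = realInd X x - 2 * ξ * realInd X x + ξ ^ 2 := by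
      intro x; rw [hf]; simp only [realInd]; split_ifs <;> ring
    simp only [this]
    rw [sum_add_distrib, sum_sub_distrib, ← mul_sum, hXsum, sum_const, nsmul_eq_mul, card_univ]
    have h1 : (Fintype.card K : ℝ) * ξ ^ 2 = ξ * #X := by rw [hξ]; field_simp
    have h2 : 0 ≤ ξ * #X := by rw [hξ]; positivity
    linarith
  let F : EuclideanSpace ℝ K := WithLp.toLp 2 (realInd Y)
  have hF : ‖F‖ ^ 2 = #Y := by
    rw [EuclideanSpace.real_norm_sq_eq]
    simp [F, realInd]
  have hconv := hK.norm_convLeft_sq_le f hf0 F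
  rw [hF] at hconv
  have hcount : (#{p ∈ X ×ˢ Y | p.1 * p.2 ∈ W} : ℝ) =
      ∑ w ∈ W, ∑ y, realInd X (w * y⁻¹) * realInd Y y := by
    rw [sum_comm]
    have h1 : #{p ∈ X ×ˢ Y | p.1 * p.2 ∈ W} = ∑ y ∈ Y, #{w ∈ W | w * y⁻¹ ∈ X} := by
      rw [card_eq_sum_card_fiberwise (f := Prod.snd) (t := Y)
        (fun p hp => (mem_product.1 (mem_filter.1 hp).1).2)]
      refine sum_congr rfl fun y hy => ?_
      refine card_bij' (fun p _ => p.1 * p.2) (fun w _ => (w * y⁻¹, y)) ?_ ?_ ?_ ?_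
      · rintro ⟨a, b⟩ h
        simp only [mem_filter, mem_product] at h ⊢
        obtain ⟨⟨⟨h1, h2⟩, h3⟩, rfl⟩ := h
        simpa using ⟨h3, h1⟩
      · intro w h
        simp only [mem_filter, mem_product] at h ⊢
        simpa using ⟨⟨h.2, hy⟩, h.1⟩
      · rintro ⟨a, b⟩ h
        simp only [mem_filter, mem_product] at h ⊢
        obtain ⟨-, rfl⟩ := h
        simp
      · intro w h; simp
    rw [h1]
    push_cast
    have h2 : ∀ y, ∑ w ∈ W, realInd X (w * y⁻¹) * realInd Y y =
        if y ∈ Y then (#{w ∈ W | w * y⁻¹ ∈ X} : ℝ) else 0 := by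
      intro y
      rw [← sum_mul, sum_realInd X W]
      simp [realInd]
    simp only [h2, sum_ite_mem, univ_inter]
  have hsplit : ∑ w ∈ W, ∑ y, realInd X (w * y⁻¹) * realInd Y y =
      ∑ w ∈ W, convLeft f F w + ξ * #Y * #W := by
    have h1 : ∀ w, ∑ y, realInd X (w * y⁻¹) * realInd Y y = convLeft f F w + ξ * #Y := by
      intro w
      have : (#Y : ℝ) = ∑ y, realInd Y y := by simp [realInd]
      rw [convLeft_apply, this, mul_sum, ← sum_add_distrib]
      refine sum_congr rfl fun y _ => ?_
      simp only [hf, F]; ring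
    simp only [h1]
    rw [sum_add_distrib, sum_const, nsmul_eq_mul]; ring
  have hcs : |∑ w ∈ W, convLeft f F w| ≤ Real.sqrt (Fintype.card K * #X * #Y * #W / D) := by
    refine Real.abs_le_sqrt ?_
    have h1 : (∑ w ∈ W, convLeft f F w) ^ 2 ≤ #W * ∑ w ∈ W, convLeft f F w ^ 2 :=
      sq_sum_le_card_mul_sum_sq
    have h2 : ∑ w ∈ W, convLeft f F w ^ 2 ≤ ‖convLeft f F‖ ^ 2 := by
      rw [EuclideanSpace.real_norm_sq_eq]
      exact sum_le_sum_of_subset_of_nonneg (subset_univ _) fun _ _ _ => sq_nonneg _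
    rw [le_div_iff₀ hD']
    calc (∑ w ∈ W, convLeft f F w) ^ 2 * D ≤ #W * ‖convLeft f F‖ ^ 2 * D := by
          gcongr; exact h1.trans (by gcongr)
      _ = #W * (D * ‖convLeft f F‖ ^ 2) := by ring
      _ ≤ #W * (Fintype.card K * #X * #Y) := by
          exact mul_le_mul_of_nonneg_left (hconv.trans (by gcongr)) (Nat.cast_nonneg _)
      _ = _ := by ring
  rw [hcount, hsplit]
  have h1 : (#X * #Y * #W : ℝ) / Fintype.card K = ξ * #Y * #W := by rw [hξ]; ring
  rw [h1]
  linarith [(abs_le.1 hcs).1]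

end Quasirandom

/-! ### Solutions of `xz = y²` inside the three kinds of subgroup. -/

section Reductions

open Finset

variable {G : Type*} [Group G]

/-- For each `i`, as `g` ranges over `G` the element `u i * g * v i` is uniformly distributed;
average over `g`. Two-sided translates are needed for corners. -/
lemma exists_dense_translate [Fintype G] [DecidableEq G] {ι : Type*} [Fintype ι] (u v : ι → G)
    (A : Finset G) {α : ℝ} (hA : α * Fintype.card G ≤ #A) :
    ∃ g : G, α * Fintype.card ι ≤ #{i | u i * g * v i ∈ A} := by
  have hsum : ∑ g : G, (#{i | u i * g * v i ∈ A} : ℝ) = Fintype.card ι * #A := by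
    simp only [← sum_realInd A univ (fun i => u i * _ * v i)]
    rw [sum_comm]
    have : ∀ i, ∑ g, realInd A (u i * g * v i) = #A := by
      intro i
      exact (Equiv.sum_comp ((Equiv.mulLeft (u i)).trans (Equiv.mulRight (v i))) (realInd A)).trans
        (by simp [realInd])
    simp [this]
  have hle : ∑ _g : G, α * (Fintype.card ι : ℝ) ≤ ∑ g : G, (#{i | u i * g * v i ∈ A} : ℝ) := by
    rw [hsum, sum_const, nsmul_eq_mul, card_univ]
    calc _ = (Fintype.card ι : ℝ) * (α * Fintype.card G) := by ring
      _ ≤ _ := by gcongr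
  obtain ⟨g, -, hg⟩ := exists_le_of_sum_le ⟨1, mem_univ _⟩ hle
  exact ⟨g, hg⟩

/-- A set without nontrivial solutions to `xz = y²`. -/
def SquareFree (A : Finset G) : Prop :=
  ∀ x ∈ A, ∀ y ∈ A, ∀ z ∈ A, x * z = y ^ 2 → x = y

/-- The map `w c = φ c * c` is injective on `S`, so `φ(S)`, `S` and `w(S)` all have size `|S|`.
Absence of solutions leaves at most `|S|` products of the first two in the third, whereas mixing
predicts about `|S|³ / |K|`. -/
lemma density_le_of_quasirandom [Fintype G] (A : Finset G) (hA : SquareFree A) {α : ℝ} (hα : 0 < α)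
    (hα' : α * Fintype.card G ≤ #A) (K : Subgroup G) [K.Normal] (hK1 : K ≠ ⊥) {D : ℕ} (hD : 0 < D)
    (hK : OnlyTrivialReps D K) : α ^ 3 * D ≤ 4 := by
  classical
  have : Nontrivial K := (Subgroup.nontrivial_iff_ne_bot K).2 hK1
  have hDK := hK.lt_card
  obtain ⟨g, hg⟩ := exists_dense_translate (fun _ : K => 1) (fun k : K => (k : G)) A hα'
  simp only [one_mul] at hg
  obtain ⟨S, hS⟩ : ∃ S : Finset K, S = univ.filter fun k : K => g * (k : G) ∈ A := ⟨_, rfl⟩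
  rw [← hS] at hg
  have hSmem : ∀ k : K, k ∈ S ↔ g * (k : G) ∈ A := fun k => by simp [hS]
  let φ : K ≃* K := MulAut.conjNormal g⁻¹
  have hφ : ∀ k : K, (φ k : G) = g⁻¹ * k * g := fun k => by
    simp [φ]
  have hsq : ∀ a b c : K, φ a * b = φ c * c → (g * (a : G)) * (g * b) = (g * (c : G)) ^ 2 := by
    intro a b c h
    have h' := congrArg (Subtype.val) h
    simp only [Subgroup.coe_mul, hφ] at h'
    calc g * (a : G) * (g * b) = g * g * (g⁻¹ * a * g * b) := by group
      _ = g * g * (g⁻¹ * c * g * c) := by rw [h']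
      _ = _ := by rw [sq]; group
  have heq : ∀ a ∈ S, ∀ b ∈ S, ∀ c ∈ S, φ a * b = φ c * c → a = c := by
    intro a ha b hb c hc h
    have := hA _ ((hSmem a).1 ha) _ ((hSmem c).1 hc) _ ((hSmem b).1 hb) (hsq a b c h)
    exact Subtype.ext (mul_left_cancel this)
  let w : K → K := fun c => φ c * c
  have hw : Set.InjOn w S := fun a ha c hc h => heq a ha a ha c hc h
  -- A product `φ a * b = φ c * c` forces `a = c`, and then `b = a`; each `b` thus occurs at most
  -- once.
  have hcount : #{p ∈ S.image φ ×ˢ S | p.1 * p.2 ∈ S.image w} ≤ #S := by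
    refine card_le_card_of_injOn Prod.snd (fun p hp => (mem_product.1 (mem_filter.1 hp).1).2) ?_
    have key : ∀ p : K × K, p ∈ {p ∈ S.image φ ×ˢ S | p.1 * p.2 ∈ S.image w} → p.1 = φ p.2 := by
      rintro ⟨x, b⟩ hp
      simp only [mem_filter, mem_product, mem_image] at hp
      obtain ⟨⟨⟨a, ha, rfl⟩, hb⟩, c, hc, hcw⟩ := hp
      obtain rfl := heq a ha b hb c hc hcw.symm
      have : a = b := mul_left_cancel hcw
      simp [this]
    intro p hp q hq h
    exact Prod.ext (by rw [key p hp, key q hq]; exact congrArg φ h) h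
  have hmix := hK.card_mul_le hD (S.image φ) S (S.image w)
  rw [card_image_of_injective _ φ.injective, card_image_of_injOn hw] at hmix
  have hmix' : (#S * #S * #S : ℝ) / Fintype.card K - √(Fintype.card K * #S * #S * #S / D) ≤ #S :=
    hmix.trans (by exact_mod_cast hcount)
  obtain ⟨k, hk⟩ : ∃ k : ℝ, k = Fintype.card K := ⟨_, rfl⟩
  rw [← hk] at hmix' hg
  have hDk : (D : ℝ) ≤ k := by rw [hk]; exact_mod_cast hDK.le
  have hD0 : (0 : ℝ) < D := by exact_mod_cast hD
  have hk0 : 0 < k := hD0.trans_le hDk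
  obtain ⟨a, ha⟩ : ∃ a : ℝ, a = #S / k := ⟨_, rfl⟩
  have hSa : (#S : ℝ) = a * k := by rw [ha]; field_simp
  have hαa : α ≤ a := by rw [ha, le_div_iff₀ hk0]; exact hg
  have ha0 : 0 < a := hα.trans_le hαa
  have ha1 : a ≤ 1 := by
    rw [ha, div_le_one hk0, hk]; exact_mod_cast card_le_univ S
  by_contra! hcon
  have ha3 : 4 < a ^ 3 * D := hcon.trans_le (by gcongr)
  rw [hSa] at hmix'
  have e1 : a * k * (a * k) * (a * k) / k = a ^ 3 * k ^ 2 := by field_simp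
  have e2 : √(k * (a * k) * (a * k) * (a * k) / D) ≤ a ^ 3 * k ^ 2 / 2 := by
    refine Real.sqrt_le_iff.2 ⟨by positivity, ?_⟩
    rw [div_le_iff₀ hD0]
    have : 0 < a ^ 3 * k ^ 4 := by positivity
    calc k * (a * k) * (a * k) * (a * k) = a ^ 3 * k ^ 4 * 1 := by ring
      _ ≤ a ^ 3 * k ^ 4 * (a ^ 3 * D / 4) := by gcongr; linarith
      _ = _ := by ring
  rw [e1] at hmix'
  have e3 : a * k ≤ a ^ 3 * k ^ 2 / 4 := by
    have h1 : 4 ≤ a ^ 2 * k := by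
      calc 4 ≤ a ^ 3 * D := ha3.le
        _ ≤ a ^ 2 * k := by
          have : a ^ 3 ≤ a ^ 2 := pow_le_pow_of_le_one ha0.le ha1 (by norm_num)
          gcongr
    have : 0 < a * k := by positivity
    nlinarith
  have : 0 < a ^ 3 * k ^ 2 := by positivity
  linarith

/-- The source of the twisted progressions: with `θ` conjugation by `g`, the factors are `c + θ d`
and `c - d` around `c`. -/
lemma mul_conj_mul_eq_sq (g : G) {c d : G} (h : d * c = c * d) :
    g * (c * (g * d * g⁻¹)) * (g * (c * d⁻¹)) = (g * c) ^ 2 := by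
  calc g * (c * (g * d * g⁻¹)) * (g * (c * d⁻¹)) = g * c * g * (d * c) * d⁻¹ := by group
    _ = g * c * g * c := by rw [h]; group
    _ = (g * c) ^ 2 := by rw [sq]; group

lemma card_abelian_normal_le [Fintype G] (A : Finset G) (hA : SquareFree A) {α : ℝ} (hα : 0 < α)
    (hα' : α * Fintype.card G ≤ #A) (N : Subgroup G) [N.Normal]
    (hN : ∀ a ∈ N, ∀ b ∈ N, a * b = b * a) :
    (Nat.card N : ℝ) ≤ 2 ^ (2 ^ (36 * ⌈100 / α ^ 3⌉₊)) := by
  classical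
  obtain ⟨g, hg⟩ := exists_dense_translate (fun _ : N => 1) (fun k : N => (k : G)) A hα'
  simp only [one_mul] at hg
  let _ : CommGroup N :=
    { (inferInstance : Group N) with
      mul_comm := fun a b => Subtype.ext (hN a a.2 b b.2) }
  let θ : Additive N ≃+ Additive N := MulEquiv.toAdditive (MulAut.conjNormal g : N ≃* N)
  have hθ : ∀ d : Additive N, ((θ d).toMul : G) = g * (d.toMul : G) * g⁻¹ := fun d => by
    simp [θ]
  let S : Finset (Additive N) := univ.filter fun k => g * (k.toMul : G) ∈ A
  have hcard : Fintype.card (Additive N) = Nat.card N := by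
    rw [Nat.card_eq_fintype_card]; exact Fintype.card_congr Additive.toMul
  rw [← hcard]
  refine card_le_of_twisted_roth θ S α hα ?_ ?_
  · refine le_trans (le_of_eq ?_) (hg.trans (le_of_eq ?_))
    · rw [hcard, Nat.card_eq_fintype_card]
    · norm_cast
      exact card_equiv Additive.ofMul (by simp [S])
  · intro c d h1 h2 h3
    simp only [S, mem_filter, mem_univ, true_and] at h1 h2 h3
    have hc1 : ((c + θ d).toMul : G) = c.toMul * (g * (d.toMul : G) * g⁻¹) := by
      rw [← hθ]; rfl
    have hc2 : ((c - d).toMul : G) = c.toMul * (d.toMul : G)⁻¹ := by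
      rw [sub_eq_add_neg]; rfl
    rw [hc1] at h1
    rw [hc2] at h3
    have hcomm : (d.toMul : G) * c.toMul = c.toMul * d.toMul := hN _ d.toMul.2 _ c.toMul.2
    have hxy := hA _ h1 _ h2 _ h3 (mul_conj_mul_eq_sq g hcomm)
    have h5 : g * (d.toMul : G) * g⁻¹ = 1 := by
      have := mul_left_cancel hxy
      exact mul_eq_left.1 this
    have h6 : (d.toMul : G) = 1 := by simpa using h5
    exact Additive.toMul.injective (Subtype.ext h6)

universe u in
-- Put `f(x, y) = x⁻¹ g y`. Then `f(x, y d) f(x d, y) = x⁻¹ g y d d⁻¹ x⁻¹ g y = f(x, y)²`, so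
-- corners give solutions; the subgroup need not be normal.
lemma exists_card_elementary_le : ∃ c : ℝ, 0 < c ∧ ∀ (G : Type u) [Group G] [Fintype G]
    (A : Finset G) (_ : SquareFree A) (α : ℝ) (_ : 0 < α) (_ : α * Fintype.card G ≤ #A) (p : ℕ)
    (_ : p.Prime) (H : Subgroup G) (_ : ∀ a ∈ H, ∀ b ∈ H, a * b = b * a) (_ : ∀ a ∈ H, a ^ p = 1),
    (Nat.card H : ℝ) ≤ (p : ℝ) ^ Real.exp (c / α ^ 48) := by
  classical
  obtain ⟨c, hc, hmain⟩ := card_le_of_corner_free.{u}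
  refine ⟨c, hc, ?_⟩
  intro G _ _ A hA α hα hα' p hp H hH hHp
  obtain ⟨g, hg⟩ := exists_dense_translate (fun i : H × H => (i.1 : G)⁻¹) (fun i => (i.2 : G)) A hα'
  let _ : CommGroup H :=
    { (inferInstance : Group H) with
      mul_comm := fun a b => Subtype.ext (hH a a.2 b b.2) }
  let S : Finset (Additive H × Additive H) :=
    univ.filter fun i => (i.1.toMul : G)⁻¹ * g * (i.2.toMul : G) ∈ A
  have hcard : Fintype.card (Additive H) = Nat.card H := by
    rw [Nat.card_eq_fintype_card]; exact Fintype.card_congr Additive.toMul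
  rw [← hcard]
  refine hmain p hp (Additive H) ?_ S α hα ?_ ?_
  · intro x
    exact Additive.toMul.injective (Subtype.ext (hHp _ x.toMul.2))
  · refine le_trans (le_of_eq ?_) (hg.trans (le_of_eq ?_))
    · rw [hcard, Nat.card_eq_fintype_card, Fintype.card_prod]; push_cast; ring
    · norm_cast
      exact card_equiv (Additive.ofMul.prodCongr Additive.ofMul) (by simp [S])
  · intro x y d h1 h2 h3
    simp only [S, mem_filter, mem_univ, true_and] at h1 h2 h3
    have e1 : ((x + d).toMul : G) = x.toMul * d.toMul := rfl
    have e2 : ((y + d).toMul : G) = y.toMul * d.toMul := rfl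
    rw [e1] at h2
    rw [e2] at h3
    have hxy := hA _ h3 _ h1 _ h2 (by
      rw [sq]; group)
    have h5 : (x.toMul : G)⁻¹ * g * y.toMul * d.toMul = (x.toMul : G)⁻¹ * g * y.toMul := by
      rw [mul_assoc, hxy]
    exact Additive.toMul.injective (Subtype.ext (mul_eq_left.1 h5))

/-- Either there is a quasirandom normal subgroup, or every nontrivial subgroup has a nontrivial
representation of small dimension. -/
lemma exists_quasirandom_or (D : ℕ) :
    (∃ K : Subgroup G, K.Normal ∧ K ≠ ⊥ ∧ OnlyTrivialReps D K) ∨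
      ∀ L : Subgroup G, L ≠ ⊥ → ¬ OnlyTrivialReps D L := by
  let F : Set (Subgroup G) := {L | OnlyTrivialReps D L}
  by_cases h : ∀ L : Subgroup G, L ≠ ⊥ → ¬ OnlyTrivialReps D L
  · exact Or.inr h
  push Not at h
  obtain ⟨L, hL1, hL⟩ := h
  -- The join of all such subgroups works: the family is stable under conjugation, and a
  -- representation of the join is trivial on every member, hence on the join.
  refine Or.inl ⟨sSup F, ?_, ?_, ?_⟩
  · refine ⟨fun n hn g => ?_⟩
    have hconj : ∀ M ∈ F, M.map (MulAut.conj g).toMonoidHom ∈ F := by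
      intro M hM d hd ρ hρ
      let e : M ≃* M.map (MulAut.conj g).toMonoidHom :=
        M.equivMapOfInjective _ (MulAut.conj g).injective
      intro x
      have := hM d hd (ρ.comp e.toMonoidHom) (fun y z => hρ _ _) (e.symm x)
      simpa only [MonoidHom.comp_apply, MulEquiv.coe_toMonoidHom, MulEquiv.apply_symm_apply] using this
    have : sSup F ≤ (sSup F).comap (MulAut.conj g).toMonoidHom := by
      refine sSup_le fun M hM => ?_
      rw [← Subgroup.map_le_iff_le_comap]
      exact le_sSup (hconj M hM)
    exact this hn
  · intro h
    exact hL1 (le_bot_iff.1 (h ▸ le_sSup (show L ∈ F from hL)))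
  · intro d hd ρ hρ
    have : sSup F ≤ (ρ.ker).map (sSup F).subtype := by
      refine sSup_le fun M hM => ?_
      have hMF : M ≤ sSup F := le_sSup hM
      intro x hx
      have := hM d hd (ρ.comp (Subgroup.inclusion hMF)) (fun y z => hρ _ _) ⟨x, hx⟩
      exact ⟨⟨x, hMF hx⟩, this, rfl⟩
    intro g
    obtain ⟨y, hy, hyg⟩ := this g.2
    have : y = g := Subtype.ext hyg
    exact this ▸ hy

end Reductions

/-! ### Order bounds from generators, conjugation actions and exponents. -/

section GroupBounds

open Finset

/-- Each new generator enlarges the subgroup by an index of at least two. -/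
lemma exists_generating_finset {P : Type*} [Group P] [Finite P] (H : Subgroup P) :
    ∃ T : Finset P, H ⊔ Subgroup.closure T = ⊤ ∧ Nat.card H * 2 ^ #T ≤ Nat.card P := by
  classical
  induction h : Nat.card P - Nat.card H using Nat.strong_induction_on generalizing H with
  | _ n ih =>
    by_cases hH : H = ⊤
    · exact ⟨∅, by simp [hH], by simp [hH]⟩
    obtain ⟨x, -, hx⟩ := SetLike.exists_of_lt (lt_top_iff_ne_top.2 hH)
    obtain ⟨H', hH'⟩ : ∃ H', H' = H ⊔ Subgroup.zpowers x := ⟨_, rfl⟩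
    have hle : H ≤ H' := hH' ▸ le_sup_left
    have hxH' : x ∈ H' := hH' ▸ (le_sup_right : Subgroup.zpowers x ≤ _) (Subgroup.mem_zpowers x)
    have hdvd : Nat.card H ∣ Nat.card H' := Subgroup.card_dvd_of_le hle
    have hne : Nat.card H ≠ Nat.card H' := fun heq => by
      have := Subgroup.eq_of_le_of_card_ge hle heq.ge
      exact hx (this ▸ hxH')
    have hpos : 0 < Nat.card H := Nat.card_pos
    have hpos' : 0 < Nat.card H' := Nat.card_pos
    have h2 : Nat.card H * 2 ≤ Nat.card H' := by
      obtain ⟨k, hk⟩ := hdvd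
      have : 2 ≤ k := by
        rcases k with _ | _ | k
        · omega
        · omega
        · omega
      rw [hk]; gcongr
    have hcard : Nat.card H' ≤ Nat.card P := Subgroup.card_le_card_group H'
    obtain ⟨T, hT, hTc⟩ := ih (Nat.card P - Nat.card H') (by omega) H' rfl
    refine ⟨insert x T, ?_, ?_⟩
    · rw [coe_insert, Set.insert_eq, Subgroup.closure_union, ← Subgroup.zpowers_eq_closure,
        ← sup_assoc, ← hH', hT]
    · calc Nat.card H * 2 ^ #(insert x T) ≤ Nat.card H * 2 ^ (#T + 1) := by
            gcongr
            · norm_num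
            · exact card_insert_le _ _
        _ = Nat.card H * 2 * 2 ^ #T := by ring
        _ ≤ _ := (Nat.mul_le_mul_right _ h2).trans hTc

variable {G : Type*} [Group G] [Finite G]

/-- Conjugation on `P` is determined by the images of at most `a` generators, so there are at most
`(2 ^ a) ^ a` such actions; elements acting equally differ by the centralizer. -/
lemma card_le_mul_card_centralizer (H P : Subgroup G) (hHP : ∀ h ∈ H, ∀ x ∈ P, h * x * h⁻¹ ∈ P)
    {a : ℕ} (hP : Nat.card P ≤ 2 ^ a) :
    Nat.card H ≤ 2 ^ (a * a) * Nat.card (H ⊓ Subgroup.centralizer (P : Set G) : Subgroup G) := by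
  classical
  have := Fintype.ofFinite G
  obtain ⟨T, hT, hTc⟩ := exists_generating_finset (⊥ : Subgroup P)
  rw [bot_sup_eq] at hT
  have hTa : #T ≤ a := by
    rw [Subgroup.card_bot, one_mul] at hTc
    exact (Nat.pow_le_pow_iff_right (by norm_num)).1 (hTc.trans hP)
  have hfin : ∀ K : Subgroup G, Nat.card K = #(univ.filter fun x => x ∈ K) := by
    intro K
    rw [Nat.card_eq_fintype_card, Fintype.card_subtype]
  rw [hfin, hfin]
  let f : G → T → G := fun h t => h * (t.1 : G) * h⁻¹
  have himg : (univ.filter fun x => x ∈ H).image f ⊆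
      Fintype.piFinset fun _ => univ.filter fun x => x ∈ P := by
    intro g hg
    obtain ⟨h, hh, rfl⟩ := mem_image.1 hg
    refine Fintype.mem_piFinset.2 fun t => ?_
    simpa [f] using hHP h (mem_filter.1 hh).2 _ t.1.2
  have himgc : #((univ.filter fun x => x ∈ H).image f) ≤ 2 ^ (a * a) := by
    refine (card_le_card himg).trans ?_
    rw [Fintype.card_piFinset, prod_const, card_univ, Fintype.card_coe, ← hfin, pow_mul]
    calc Nat.card P ^ #T ≤ (2 ^ a) ^ #T := Nat.pow_le_pow_left hP _
      _ ≤ (2 ^ a) ^ a := Nat.pow_le_pow_right (by positivity) hTa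
  have := card_le_mul_card_image (s := univ.filter fun x => x ∈ H) (f := f)
    #(univ.filter fun x => x ∈ H ⊓ Subgroup.centralizer (P : Set G)) (by
      intro g hg
      obtain ⟨k, hk, rfl⟩ := mem_image.1 hg
      have hkH := (mem_filter.1 hk).2
      refine card_le_card_of_injOn (fun h => k⁻¹ * h) ?_ ((mul_right_injective _).injOn)
      intro h hh
      obtain ⟨hh1, hh2⟩ := mem_filter.1 hh
      have hhH := (mem_filter.1 hh1).2
      simp only [mem_coe, mem_filter, mem_univ, true_and]
      refine ⟨H.mul_mem (H.inv_mem hkH) hhH, ?_⟩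
      have hle : (⊤ : Subgroup P) ≤
          (Subgroup.centralizer {k⁻¹ * h}).comap P.subtype := by
        rw [← hT, Subgroup.closure_le]
        intro t ht
        have h1 : h * (t : G) * h⁻¹ = k * t * k⁻¹ := congrFun hh2 ⟨t, ht⟩
        rw [SetLike.mem_coe, Subgroup.mem_comap, Subgroup.mem_centralizer_singleton_iff]
        have h2 : h * (t : G) = k * t * k⁻¹ * h := by rw [← h1]; group
        calc P.subtype t * (k⁻¹ * h) = k⁻¹ * (k * t * k⁻¹ * h) := by
              rw [Subgroup.coe_subtype]; group
          _ = k⁻¹ * h * P.subtype t := by rw [← h2, Subgroup.coe_subtype, mul_assoc]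
      refine Subgroup.mem_centralizer_iff.2 fun x hx => ?_
      exact Subgroup.mem_centralizer_singleton_iff.1 (hle (Subgroup.mem_top (⟨x, hx⟩ : P))))
  calc _ ≤ _ := this
    _ ≤ _ := by rw [mul_comm]; gcongr

universe u in
/-- An abelian group of exponent `E` whose `p`-torsion has order at most `p ^ R` has order at most
`E ^ R`. -/
lemma card_le_exponent_pow (R E : ℕ) (hE : 0 < E) (Y : Type u) [CommGroup Y] [Finite Y]
    (hY : ∀ y : Y, y ^ E = 1)
    (hR : ∀ p : ℕ, p.Prime → Nat.card (powMonoidHom p : Y →* Y).ker ≤ p ^ R) :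
    Nat.card Y ≤ E ^ R := by
  induction E using Nat.strong_induction_on generalizing Y with
  | _ E ih =>
    by_cases hE1 : E = 1
    · subst hE1
      have : Subsingleton Y := ⟨fun a b => by
        rw [← pow_one a, ← pow_one b, hY, hY]⟩
      rw [one_pow]
      exact Finite.card_le_one_iff_subsingleton.2 this
    obtain ⟨p, hp, E', rfl⟩ := Nat.exists_prime_and_dvd hE1
    have hE' : 0 < E' := Nat.pos_of_mul_pos_left hE
    have hlt : E' < p * E' := by
      have := hp.two_le
      nlinarith
    -- The image of the `p`-th power map satisfies the hypotheses with `E'` in place of `p * E'`,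
    -- and its kernel has order at most `p ^ R`.
    let f : Y →* Y := powMonoidHom p
    have h1 := ih E' hlt hE' f.range (by
      rintro ⟨-, y, rfl⟩
      refine Subtype.ext ?_
      change (y ^ p) ^ E' = 1
      rw [← pow_mul]; exact hY y) (by
      intro q hq
      refine le_trans ?_ (hR q hq)
      refine Nat.card_le_card_of_injective
        (fun y : (powMonoidHom q : f.range →* f.range).ker =>
          (⟨y.1.1, congrArg Subtype.val y.2⟩ : (powMonoidHom q : Y →* Y).ker)) ?_
      intro a b hab
      have hab' : (a.1.1 : Y) = b.1.1 := Subtype.mk.inj hab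
      exact Subtype.ext (Subtype.ext hab'))
    have h2 := Subgroup.card_mul_index f.ker
    rw [Subgroup.index_ker] at h2
    rw [← h2, mul_pow]
    exact Nat.mul_le_mul (hR p hp) h1

end GroupBounds

/-! ### Commuting families of nonabelian simple subgroups. -/

section SimpleFactors

variable {Γ : Type*} [Group Γ]

/-- A subgroup which is a nonabelian simple group. -/
def IsNonabelianSimple (S : Subgroup Γ) : Prop :=
  IsSimpleGroup S ∧ ∃ a ∈ S, ∃ b ∈ S, a * b ≠ b * a

/-- The conjugate of a subgroup. -/
def conjSubgroup (g : Γ) (S : Subgroup Γ) : Subgroup Γ := S.map (MulAut.conj g).toMonoidHom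

lemma mem_conjSubgroup {g x : Γ} {S : Subgroup Γ} : x ∈ conjSubgroup g S ↔ g⁻¹ * x * g ∈ S := by
  constructor
  · rintro ⟨y, hy, rfl⟩
    simpa [mul_assoc] using hy
  · intro h
    exact ⟨g⁻¹ * x * g, h, by simp [mul_assoc]⟩

lemma conjSubgroup_mul (g h : Γ) (S : Subgroup Γ) :
    conjSubgroup (g * h) S = conjSubgroup g (conjSubgroup h S) := by
  ext x; simp [mem_conjSubgroup, mul_assoc]

lemma conjSubgroup_one (S : Subgroup Γ) : conjSubgroup 1 S = S := by
  ext x; simp [mem_conjSubgroup]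

lemma IsNonabelianSimple.conj {S : Subgroup Γ} (hS : IsNonabelianSimple S) (g : Γ) :
    IsNonabelianSimple (conjSubgroup g S) := by
  obtain ⟨h1, a, ha, b, hb, hab⟩ := hS
  let e : S ≃* conjSubgroup g S := S.equivMapOfInjective _ (MulAut.conj g).injective
  refine ⟨?_, g * a * g⁻¹, mem_conjSubgroup.2 (by simpa [mul_assoc] using ha), g * b * g⁻¹,
    mem_conjSubgroup.2 (by simpa [mul_assoc] using hb), fun h => hab ?_⟩
  · have : Nontrivial (conjSubgroup g S) := e.symm.toEquiv.nontrivial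
    exact IsSimpleGroup.isSimpleGroup_of_surjective e.toMonoidHom e.surjective
  · have : g * (a * b) * g⁻¹ = g * (b * a) * g⁻¹ := by
      calc g * (a * b) * g⁻¹ = g * a * g⁻¹ * (g * b * g⁻¹) := by group
        _ = g * b * g⁻¹ * (g * a * g⁻¹) := h
        _ = _ := by group
    exact mul_left_cancel (mul_right_cancel this)

/-- Two subgroups which commute elementwise. -/
def ElementsCommute (S T : Subgroup Γ) : Prop := ∀ s ∈ S, ∀ t ∈ T, s * t = t * s

lemma ElementsCommute.symm {S T : Subgroup Γ} (h : ElementsCommute S T) : ElementsCommute T S :=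
  fun t ht s hs => (h s hs t ht).symm

lemma ElementsCommute.conj {S T : Subgroup Γ} (h : ElementsCommute S T) (g : Γ) :
    ElementsCommute (conjSubgroup g S) (conjSubgroup g T) := by
  intro s hs t ht
  have := h _ (mem_conjSubgroup.1 hs) _ (mem_conjSubgroup.1 ht)
  calc s * t = g * (g⁻¹ * s * g * (g⁻¹ * t * g)) * g⁻¹ := by group
    _ = _ := by rw [this]; group

lemma elementsCommute_iff_le {S T : Subgroup Γ} :
    ElementsCommute S T ↔ S ≤ Subgroup.centralizer (T : Set Γ) := by
  refine ⟨fun h s hs => Subgroup.mem_centralizer_iff.2 fun t ht => (h s hs t ht).symm, ?_⟩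
  intro h s hs t ht
  exact (Subgroup.mem_centralizer_iff.1 (h hs) t ht).symm

/-- Every commutator of an element of `S` with one of `T` lies in both subgroups. -/
lemma elementsCommute_of_inf_eq_bot {S T U : Subgroup Γ} (hST : S ⊓ T = ⊥) (hSU : S ≤ U)
    (hTU : T ≤ U) (hS : ∀ u ∈ U, ∀ s ∈ S, u * s * u⁻¹ ∈ S) (hT : ∀ u ∈ U, ∀ t ∈ T, u * t * u⁻¹ ∈ T) :
    ElementsCommute S T := by
  intro s hs t ht
  have h1 : s * t * s⁻¹ * t⁻¹ ∈ S ⊓ T := by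
    refine ⟨?_, T.mul_mem (hT s (hSU hs) t ht) (T.inv_mem ht)⟩
    have := S.mul_mem hs (hS t (hTU ht) s⁻¹ (S.inv_mem hs))
    simpa [mul_assoc] using this
  rw [hST, Subgroup.mem_bot] at h1
  calc s * t = s * t * s⁻¹ * t⁻¹ * (t * s) := by group
    _ = t * s := by rw [h1, one_mul]

/-- Take `T` minimal normal in `Γ` below `V`, and `S` minimal normal in `T`. Distinct conjugates of
`S` commute and together generate `T`; if `S` were abelian, so would be `T`. A normal subgroup of
`S` is normalized by all conjugates, hence by `T`, so minimality makes `S` simple. -/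
lemma exists_simple_in_normal [Finite Γ] (V : Subgroup Γ) [V.Normal] (hV : V ≠ ⊥)
    (hab : ∀ U : Subgroup Γ, U.Normal → U ≤ V → ElementsCommute U U → U = ⊥) :
    ∃ S ≤ V, IsNonabelianSimple S ∧
      ∀ g, conjSubgroup g S = S ∨ ElementsCommute S (conjSubgroup g S) := by
  obtain ⟨T, hT⟩ := (Set.toFinite {T : Subgroup Γ | T.Normal ∧ T ≤ V ∧ T ≠ ⊥}).exists_minimal
    ⟨V, inferInstance, le_rfl, hV⟩
  obtain ⟨⟨hTn, hTV, hT1⟩, hTmin⟩ := hT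
  obtain ⟨S, hS⟩ := (Set.toFinite {S : Subgroup Γ | S ≤ T ∧ S ≠ ⊥ ∧
    ∀ t ∈ T, ∀ s ∈ S, t * s * t⁻¹ ∈ S}).exists_minimal
    ⟨T, le_rfl, hT1, fun t ht s hs => T.mul_mem (T.mul_mem ht hs) (T.inv_mem ht)⟩
  obtain ⟨⟨hST, hS1, hSn⟩, hSmin⟩ := hS
  have hSsub : ∀ M ≤ S, (∀ t ∈ T, ∀ s ∈ M, t * s * t⁻¹ ∈ M) → M = ⊥ ∨ M = S := by
    intro M hM hMn
    by_cases h : M = ⊥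
    · exact Or.inl h
    · exact Or.inr (le_antisymm hM (hSmin ⟨hM.trans hST, h, hMn⟩ hM))
  have hconjT : ∀ g, conjSubgroup g S ≤ T := by
    intro g x hx
    have := hTn.conj_mem _ (hST (mem_conjSubgroup.1 hx)) g
    simpa [mul_assoc] using this
  have hconjn : ∀ g, ∀ t ∈ T, ∀ s ∈ conjSubgroup g S, t * s * t⁻¹ ∈ conjSubgroup g S := by
    intro g t ht s hs
    rw [mem_conjSubgroup] at hs ⊢
    have h1 : g⁻¹ * t * g ∈ T := by simpa using hTn.conj_mem t ht g⁻¹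
    have := hSn _ h1 _ hs
    simpa [mul_assoc] using this
  have hdich : ∀ g, conjSubgroup g S = S ∨ ElementsCommute S (conjSubgroup g S) := by
    intro g
    rcases hSsub (S ⊓ conjSubgroup g S) inf_le_left
      (fun t ht s hs => ⟨hSn t ht s hs.1, hconjn g t ht s hs.2⟩) with h | h
    · exact Or.inr (elementsCommute_of_inf_eq_bot h hST (hconjT g) hSn (hconjn g))
    · refine Or.inl ?_
      have h1 : S ≤ conjSubgroup g S := inf_eq_left.1 h
      refine (Subgroup.eq_of_le_of_card_ge h1 (le_of_eq ?_)).symm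
      exact Nat.card_congr (S.equivMapOfInjective _ (MulAut.conj g).injective).symm.toEquiv
  have hsup : T ≤ ⨆ g, conjSubgroup g S := by
    refine hTmin ⟨⟨?_⟩, (iSup_le hconjT).trans hTV, ?_⟩ (iSup_le hconjT)
    · intro x hx g
      have : ⨆ h, conjSubgroup h S ≤ (⨆ h, conjSubgroup h S).comap (MulAut.conj g).toMonoidHom := by
        refine iSup_le fun h => ?_
        rw [← Subgroup.map_le_iff_le_comap]
        change conjSubgroup g (conjSubgroup h S) ≤ _
        rw [← conjSubgroup_mul]
        exact le_iSup (fun h => conjSubgroup h S) (g * h)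
      exact this hx
    · intro h
      refine hS1 (le_bot_iff.1 (h ▸ ?_))
      have := le_iSup (fun h => conjSubgroup h S) 1
      rwa [conjSubgroup_one] at this
  have hnonab : ¬ ElementsCommute S S := by
    intro hSS
    have h1 : ∀ g, ElementsCommute S (conjSubgroup g S) := by
      intro g
      rcases hdich g with h | h
      · rw [h]; exact hSS
      · exact h
    have h2 : ElementsCommute T S := elementsCommute_iff_le.2
      (hsup.trans (iSup_le fun g => elementsCommute_iff_le.1 (h1 g).symm))
    have h3 : ElementsCommute T T := by
      refine ElementsCommute.symm (elementsCommute_iff_le.2 (hsup.trans (iSup_le fun g => ?_)))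
      refine elementsCommute_iff_le.1 ?_
      intro s hs t ht
      have h4 := h2 (g⁻¹ * t * g) (by simpa using hTn.conj_mem t ht g⁻¹) _ (mem_conjSubgroup.1 hs)
      calc s * t = g * (g⁻¹ * s * g * (g⁻¹ * t * g)) * g⁻¹ := by group
        _ = _ := by rw [← h4]; group
    exact hT1 (hab T hTn hTV h3)
  refine ⟨S, hST.trans hTV, ⟨?_, ?_⟩, hdich⟩
  · have : Nontrivial S := (Subgroup.nontrivial_iff_ne_bot S).2 hS1
    refine ⟨fun M hM => ?_⟩
    have hle : M.map S.subtype ≤ S := by rintro _ ⟨y, -, rfl⟩; exact y.2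
    have hnorm : T ≤ Subgroup.normalizer (M.map S.subtype : Subgroup Γ) := by
      refine hsup.trans (iSup_le fun g => ?_)
      rcases hdich g with h | h
      · rw [h]
        intro s hs
        refine Subgroup.mem_normalizer_iff.2 fun x => ⟨?_, ?_⟩
        · rintro ⟨y, hy, rfl⟩
          exact ⟨_, hM.conj_mem y hy ⟨s, hs⟩, rfl⟩
        · rintro ⟨y, hy, hyx⟩
          refine ⟨_, hM.conj_mem y hy ⟨s, hs⟩⁻¹, ?_⟩
          simp only [Subgroup.coe_subtype] at hyx
          simp [hyx, mul_assoc]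
      · intro c hc
        refine Subgroup.mem_normalizer_iff.2 fun x => ⟨fun hx => ?_, fun hx => ?_⟩
        · rw [← h x (hle hx) c hc, mul_inv_cancel_right]; exact hx
        · have := h _ (hle hx) c hc
          have h5 : c * x * c⁻¹ = x := by
            have h6 : c * x = c * (c * x * c⁻¹) := by rw [← this]; group
            exact (mul_left_cancel h6).symm
          rwa [h5] at hx
    rcases hSsub _ hle (fun t ht s hs =>
      (Subgroup.mem_normalizer_iff.1 (hnorm ht) s).1 hs) with h | h
    · exact Or.inl ((Subgroup.map_eq_bot_iff_of_injective _ S.subtype_injective).1 h)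
    · refine Or.inr (top_le_iff.1 fun x _ => ?_)
      have : (x : Γ) ∈ M.map S.subtype := h.ge x.2
      obtain ⟨y, hy, hyx⟩ := this
      exact (Subtype.ext hyx : y = x) ▸ hy
  · unfold ElementsCommute at hnonab
    push Not at hnonab
    exact hnonab

/-- A finite group `Q` normal in `Γ` without abelian `Γ`-normal subgroups has a family of commuting
nonabelian simple subgroups, invariant under `Γ`, with trivial centralizer. -/
lemma exists_simple_family [Finite Γ] (Q : Subgroup Γ) [Q.Normal]
    (hQ : ∀ U : Subgroup Γ, U.Normal → U ≤ Q → ElementsCommute U U → U = ⊥) :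
    ∃ F : Set (Subgroup Γ), (∀ S ∈ F, S ≤ Q ∧ IsNonabelianSimple S) ∧
      F.Pairwise ElementsCommute ∧ (∀ S ∈ F, ∀ g, conjSubgroup g S ∈ F) ∧
      ∀ g ∈ Q, (∀ S ∈ F, ∀ s ∈ S, g * s = s * g) → g = 1 := by
  obtain ⟨F, hF⟩ := (Set.toFinite {F : Set (Subgroup Γ) |
    (∀ S ∈ F, S ≤ Q ∧ IsNonabelianSimple S) ∧ F.Pairwise ElementsCommute ∧
      ∀ S ∈ F, ∀ g, conjSubgroup g S ∈ F}).exists_maximal ⟨∅, by simp⟩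
  obtain ⟨⟨h1, h2, h3⟩, hmax⟩ := hF
  refine ⟨F, h1, h2, h3, ?_⟩
  -- `V` is the common centralizer in `Q` of a maximal invariant family. If it were nontrivial it
  -- would contain a simple subgroup, whose conjugates could be added to the family; by maximality
  -- that subgroup is already a member, so it commutes with itself.
  let V : Subgroup Γ := Q ⊓ ⨅ S ∈ F, Subgroup.centralizer (S : Set Γ)
  have hVmem : ∀ g, g ∈ V ↔ g ∈ Q ∧ ∀ S ∈ F, ∀ s ∈ S, g * s = s * g := by
    intro g
    simp only [V, Subgroup.mem_inf, Subgroup.mem_iInf, Subgroup.mem_centralizer_iff, SetLike.mem_coe]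
    exact and_congr_right fun _ => forall₂_congr fun S _ => forall₂_congr fun s _ => eq_comm
  have hVn : V.Normal := by
    refine ⟨fun n hn g => ?_⟩
    rw [hVmem] at hn ⊢
    refine ⟨Subgroup.Normal.conj_mem inferInstance n hn.1 g, fun S hS s hs => ?_⟩
    have h4 : g⁻¹ * s * g ∈ conjSubgroup g⁻¹ S := by
      rw [mem_conjSubgroup]; simpa [mul_assoc] using hs
    have h5 := hn.2 _ (h3 S hS g⁻¹) _ h4
    calc g * n * g⁻¹ * s = g * (n * (g⁻¹ * s * g)) * g⁻¹ := by group
      _ = _ := by rw [h5]; group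
  by_cases hV : V = ⊥
  · intro g hg hgF
    exact Subgroup.mem_bot.1 (hV ▸ (hVmem g).2 ⟨hg, hgF⟩)
  exfalso
  have hVQ : V ≤ Q := inf_le_left
  obtain ⟨S, hSV, hS, hSc⟩ := exists_simple_in_normal V hV fun U hU hUV => hQ U hU (hUV.trans hVQ)
  have hconjV : ∀ g, conjSubgroup g S ≤ V := by
    intro g x hx
    have := hVn.conj_mem _ (hSV (mem_conjSubgroup.1 hx)) g
    simpa [mul_assoc] using this
  have hFS : ∀ T ∈ F, ∀ g, ElementsCommute (conjSubgroup g S) T := fun T hT g x hx t ht =>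
    ((hVmem x).1 (hconjV g hx)).2 T hT t ht
  have hmem : S ∈ F := by
    have hF' : F ∪ Set.range (fun g => conjSubgroup g S) ≤ F := by
      refine hmax ⟨?_, ?_, ?_⟩ Set.subset_union_left
      · rintro T (hT | ⟨g, rfl⟩)
        · exact h1 T hT
        · exact ⟨(hconjV g).trans hVQ, hS.conj g⟩
      · rintro T (hT | ⟨g, rfl⟩) T' (hT' | ⟨g', rfl⟩) hne
        · exact h2 hT hT' hne
        · exact (hFS T hT g').symm
        · exact hFS T' hT' g
        · have key : conjSubgroup g' S = conjSubgroup g (conjSubgroup (g⁻¹ * g') S) := by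
            rw [← conjSubgroup_mul, mul_inv_cancel_left]
          simp only at hne ⊢
          rw [key] at hne ⊢
          rcases hSc (g⁻¹ * g') with h | h
          · exact absurd (by rw [h]) hne
          · exact h.conj g
      · rintro T (hT | ⟨g, rfl⟩) h
        · exact Or.inl (h3 T hT h)
        · exact Or.inr ⟨h * g, conjSubgroup_mul h g S⟩
    exact hF' (Or.inr ⟨1, conjSubgroup_one S⟩)
  obtain ⟨-, a, ha, b, hb, hab⟩ := hS
  have := hFS S hmem 1
  rw [conjSubgroup_one] at this
  exact hab (this a ha b hb)

end SimpleFactors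

/-! ### Simple sections with small representations are small. -/

section SimpleBound

open Finset

lemma EuclideanSpace.norm_le_sum_abs {d : ℕ} (y : EuclideanSpace ℝ (Fin d)) :
    ‖y‖ ≤ ∑ i, |y i| := by
  have h := (EuclideanSpace.basisFun (Fin d) ℝ).sum_repr y
  calc ‖y‖ = ‖∑ i, y i • EuclideanSpace.basisFun (Fin d) ℝ i‖ := congrArg norm h.symm
    _ ≤ ∑ i, ‖y i • EuclideanSpace.basisFun (Fin d) ℝ i‖ := norm_sum_le _ _
    _ = _ := by simp [norm_smul]

lemma norm_le_of_entries_le {d : ℕ}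
    (M : EuclideanSpace ℝ (Fin d) →L[ℝ] EuclideanSpace ℝ (Fin d)) {ε : ℝ} (hε : 0 ≤ ε)
    (hM : ∀ i j, |M (EuclideanSpace.basisFun (Fin d) ℝ j) i| ≤ ε) : ‖M‖ ≤ d * d * ε := by
  refine M.opNorm_le_bound (by positivity) fun x => ?_
  have h := (EuclideanSpace.basisFun (Fin d) ℝ).sum_repr x
  calc ‖M x‖ = ‖∑ j, x j • M (EuclideanSpace.basisFun (Fin d) ℝ j)‖ := by
        conv_lhs => rw [← h]
        simp
    _ ≤ ∑ j, ‖x j • M (EuclideanSpace.basisFun (Fin d) ℝ j)‖ := norm_sum_le _ _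
    _ ≤ ∑ _j : Fin d, ‖x‖ * (d * ε) := by
        refine sum_le_sum fun j _ => ?_
        rw [norm_smul]
        refine mul_le_mul (PiLp.norm_apply_le x j) ?_ (norm_nonneg _) (norm_nonneg _)
        refine (EuclideanSpace.norm_le_sum_abs _).trans ((sum_le_sum fun i _ => hM i j).trans ?_)
        simp
    _ = d * d * ε * ‖x‖ := by simp; ring

section Rep

variable {L : Type*} [Group L] {d : ℕ}
  (ρ : L →* (EuclideanSpace ℝ (Fin d) →L[ℝ] EuclideanSpace ℝ (Fin d)))

lemma rep_norm_mul_le (hρ : ∀ g x, ‖ρ g x‖ = ‖x‖) (g : L)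
    (M : EuclideanSpace ℝ (Fin d) →L[ℝ] EuclideanSpace ℝ (Fin d)) : ‖ρ g * M‖ ≤ ‖M‖ :=
  ContinuousLinearMap.opNorm_le_bound _ (norm_nonneg _) fun x => by
    rw [mul_apply_eq_comp, hρ]; exact M.le_opNorm x

lemma rep_norm_mul_le' (hρ : ∀ g x, ‖ρ g x‖ = ‖x‖) (g : L)
    (M : EuclideanSpace ℝ (Fin d) →L[ℝ] EuclideanSpace ℝ (Fin d)) : ‖M * ρ g‖ ≤ ‖M‖ :=
  ContinuousLinearMap.opNorm_le_bound _ (norm_nonneg _) fun x => by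
    rw [mul_apply_eq_comp]
    refine (M.le_opNorm _).trans ?_
    rw [hρ]

/-- Up to right multiplication by an isometry, `ρ [g, h] - 1` is the ring commutator of `ρ g - 1`
and `ρ h - 1`. Near the identity, commutators are therefore much nearer. -/
lemma rep_norm_commutator_sub_one_le (hρ : ∀ g x, ‖ρ g x‖ = ‖x‖) (g h : L) :
    ‖ρ (g * h * g⁻¹ * h⁻¹) - 1‖ ≤ 2 * ‖ρ g - 1‖ * ‖ρ h - 1‖ := by
  have e : ρ (g * h * g⁻¹ * h⁻¹) - 1 =
      ((ρ g - 1) * (ρ h - 1) - (ρ h - 1) * (ρ g - 1)) * ρ (g⁻¹ * h⁻¹) := by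
    have h1 : (ρ g - 1) * (ρ h - 1) - (ρ h - 1) * (ρ g - 1) = ρ (g * h) - ρ (h * g) := by
      rw [map_mul, map_mul, sub_mul, mul_sub, mul_sub, sub_mul, mul_sub, mul_sub]
      simp only [one_mul, mul_one]
      abel
    rw [h1, sub_mul, ← map_mul, ← map_mul, show h * g * (g⁻¹ * h⁻¹) = 1 by group, map_one,
      show g * h * (g⁻¹ * h⁻¹) = g * h * g⁻¹ * h⁻¹ by group]
  rw [e]
  refine (rep_norm_mul_le' ρ hρ _ _).trans ((norm_sub_le _ _).trans ?_)
  have h1 := norm_mul_le (ρ g - 1) (ρ h - 1)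
  have h2 := norm_mul_le (ρ h - 1) (ρ g - 1)
  linarith

lemma rep_norm_conj_sub_one_le (hρ : ∀ g x, ‖ρ g x‖ = ‖x‖) (k h : L) :
    ‖ρ (k * h * k⁻¹) - 1‖ ≤ ‖ρ h - 1‖ := by
  have e : ρ (k * h * k⁻¹) - 1 = ρ k * ((ρ h - 1) * ρ k⁻¹) := by
    rw [sub_mul, mul_sub, one_mul, ← map_mul, ← map_mul, ← map_mul, mul_inv_cancel, map_one,
      mul_assoc]
  rw [e]
  exact (rep_norm_mul_le ρ hρ _ _).trans (rep_norm_mul_le' ρ hρ _ _)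

/-- Elements close to the identity in a representation of a central extension of a simple group
are central. -/
lemma eq_one_of_rep_norm_lt [Finite L] {S : Type*} [Group S] [IsSimpleGroup S]
    (hS : ∃ a b : S, a * b ≠ b * a) (π : L →* S) (hπ : Function.Surjective π)
    (hρ : ∀ g x, ‖ρ g x‖ = ‖x‖) (hker : ∀ g, ρ g = 1 → π g = 1) (g : L)
    (hg : ‖ρ g - 1‖ < 1 / 2) : π g = 1 := by
  obtain ⟨s, hs⟩ := exists_ne (1 : S)
  obtain ⟨l, rfl⟩ := hπ s
  -- Take `h` nearest to the identity among elements with nontrivial image. Commutators of `g` with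
  -- conjugates of `h` are nearer still, so they die under `π`; thus `π g` centralizes the normal
  -- closure of `π h`, which is all of `S`.
  obtain ⟨h, hh1, hmin⟩ := Set.exists_min_image {h : L | π h ≠ 1} (fun h => ‖ρ h - 1‖)
    (Set.toFinite _) ⟨l, hs⟩
  have hpos : 0 < ‖ρ h - 1‖ := norm_pos_iff.2 fun h0 => hh1 (hker h (sub_eq_zero.1 h0))
  have hcomm : ∀ k : L, π k * π h * (π k)⁻¹ ∈ Subgroup.centralizer {π g} := by
    intro k
    have h1 : ‖ρ (g * (k * h * k⁻¹) * g⁻¹ * (k * h * k⁻¹)⁻¹) - 1‖ < ‖ρ h - 1‖ := by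
      calc _ ≤ 2 * ‖ρ g - 1‖ * ‖ρ (k * h * k⁻¹) - 1‖ := rep_norm_commutator_sub_one_le ρ hρ _ _
        _ ≤ 2 * ‖ρ g - 1‖ * ‖ρ h - 1‖ := by gcongr; exact rep_norm_conj_sub_one_le ρ hρ k h
        _ < 2 * (1 / 2) * ‖ρ h - 1‖ := by gcongr
        _ = _ := by ring
    have h2 : π (g * (k * h * k⁻¹) * g⁻¹ * (k * h * k⁻¹)⁻¹) = 1 := by
      by_contra hne
      exact absurd (hmin _ hne) (not_le.2 h1)
    rw [Subgroup.mem_centralizer_singleton_iff, ← map_inv, ← map_mul, ← map_mul, ← map_mul,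
      ← map_mul]
    rw [← one_mul (π (k * h * k⁻¹ * g)), ← h2, ← map_mul]
    congr 1
    group
  have htop : Subgroup.normalClosure {π h} = ⊤ := by
    refine (IsSimpleGroup.eq_bot_or_eq_top_of_normal _ Subgroup.normalClosure_normal).resolve_left ?_
    intro hbot
    have := Subgroup.subset_normalClosure (Set.mem_singleton (π h))
    rw [hbot] at this
    exact hh1 (Subgroup.mem_bot.1 this)
  have hle : Subgroup.normalClosure {π h} ≤ Subgroup.centralizer {π g} := by
    rw [Subgroup.normalClosure, Subgroup.closure_le]
    intro x hx
    obtain ⟨a, ha, hax⟩ := Group.mem_conjugatesOfSet_iff.1 hx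
    obtain rfl := Set.mem_singleton_iff.1 ha
    obtain ⟨c, rfl⟩ := isConj_iff.1 hax
    obtain ⟨k, rfl⟩ := hπ c
    exact hcomm k
  have hcen : π g ∈ Subgroup.center S := by
    refine Subgroup.mem_center_iff.2 fun x => ?_
    exact Subgroup.mem_centralizer_singleton_iff.1 (hle (htop ▸ Subgroup.mem_top x))
  rcases IsSimpleGroup.eq_bot_or_eq_top_of_normal (Subgroup.center S) inferInstance with h0 | h0
  · exact Subgroup.mem_bot.1 (h0 ▸ hcen)
  · obtain ⟨a, b, hab⟩ := hS
    have : b ∈ Subgroup.center S := h0 ▸ Subgroup.mem_top b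
    exact absurd (Subgroup.mem_center_iff.1 this a) hab

/-- A simple group is small if a central extension has a faithful enough representation. -/
lemma card_simple_le_of_rep [Finite L] {S : Type*} [Group S] [IsSimpleGroup S]
    (hS : ∃ a b : S, a * b ≠ b * a) (π : L →* S) (hπ : Function.Surjective π)
    (hρ : ∀ g x, ‖ρ g x‖ = ‖x‖) (hker : ∀ g, ρ g = 1 → π g = 1) :
    Nat.card S ≤ (8 * d ^ 2 + 9) ^ d ^ 2 := by
  -- Rounding entries to multiples of `1 / k` moves operators by at most `d² / k < 1 / 2`, and each
  -- entry takes `2 k + 1 = 8 d² + 9` rounded values.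
  obtain ⟨k, hk⟩ : ∃ k : ℕ, k = 4 * (d ^ 2 + 1) := ⟨_, rfl⟩
  have hk0 : (0 : ℝ) < k := by rw [hk]; positivity
  let ent : L → Fin d → Fin d → ℝ := fun g i j => ρ g (EuclideanSpace.basisFun (Fin d) ℝ j) i
  have hent : ∀ g i j, |ent g i j| ≤ 1 := by
    intro g i j
    refine (PiLp.norm_apply_le (ρ g (EuclideanSpace.basisFun (Fin d) ℝ j)) i).trans ?_
    rw [hρ]; simp
  have hfl : ∀ t : ℝ, |t| ≤ 1 → ⌊(k : ℝ) * t⌋ ∈ Icc (-(k : ℤ)) k := by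
    intro t ht
    rw [abs_le] at ht
    rw [mem_Icc]
    constructor
    · rw [Int.le_floor]; push_cast; nlinarith
    · rw [← Int.cast_le (R := ℝ)]
      refine (Int.floor_le _).trans ?_
      push_cast; nlinarith
  let q : S → Fin d → Fin d → Icc (-(k : ℤ)) k := fun s i j =>
    ⟨⌊(k : ℝ) * ent (Function.surjInv hπ s) i j⌋, hfl _ (hent _ i j)⟩
  have hq : Function.Injective q := by
    intro a b hab
    obtain ⟨x, hx⟩ : ∃ x, x = Function.surjInv hπ a := ⟨_, rfl⟩
    obtain ⟨y, hy⟩ : ∃ y, y = Function.surjInv hπ b := ⟨_, rfl⟩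
    have hclose : ‖ρ x - ρ y‖ ≤ d * d * (1 / k) := by
      refine norm_le_of_entries_le _ (by positivity) fun i j => ?_
      have h1 : ⌊(k : ℝ) * ent x i j⌋ = ⌊(k : ℝ) * ent y i j⌋ := by
        rw [hx, hy]
        exact congrArg Subtype.val (congrFun (congrFun hab i) j)
      have h2 := Int.abs_sub_lt_one_of_floor_eq_floor h1
      rw [← mul_sub, abs_mul, abs_of_pos hk0] at h2
      rw [le_div_iff₀ hk0]
      have h3 : (ρ x - ρ y) (EuclideanSpace.basisFun (Fin d) ℝ j) i = ent x i j - ent y i j := rfl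
      rw [h3]; linarith
    have hlt : (d : ℝ) * d * (1 / k) < 1 / 2 := by
      rw [mul_one_div, div_lt_iff₀ hk0, hk]
      push_cast; nlinarith
    have h1 : ‖ρ (y⁻¹ * x) - 1‖ < 1 / 2 := by
      have e : ρ (y⁻¹ * x) - 1 = ρ y⁻¹ * (ρ x - ρ y) := by
        rw [mul_sub, ← map_mul, ← map_mul, inv_mul_cancel, map_one]
      rw [e]
      exact (rep_norm_mul_le ρ hρ _ _).trans_lt (hclose.trans_lt hlt)
    have h2 := eq_one_of_rep_norm_lt ρ hS π hπ hρ hker _ h1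
    rw [map_mul, map_inv, inv_mul_eq_one, hx, hy, Function.surjInv_eq hπ,
      Function.surjInv_eq hπ] at h2
    exact h2.symm
  refine (Nat.card_le_card_of_injective q hq).trans (le_of_eq ?_)
  rw [Nat.card_eq_fintype_card, Fintype.card_fun, Fintype.card_fun, Fintype.card_fin,
    Fintype.card_coe, Int.card_Icc, ← pow_mul, ← sq, hk]
  congr 1
  generalize d ^ 2 = e
  omega

end Rep

/-- A nonabelian simple group is perfect, so the commutator subgroup of its preimage still covers
it. Commutators are preferred as lifts because central factors do not affect them. -/
lemma IsNonabelianSimple.map_commutator_comap {G : Type*} [Group G] {Z : Subgroup G} [Z.Normal]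
    {S : Subgroup (G ⧸ Z)} (hS : IsNonabelianSimple S) :
    (⁅S.comap (QuotientGroup.mk' Z), S.comap (QuotientGroup.mk' Z)⁆).map (QuotientGroup.mk' Z)
      = S := by
  obtain ⟨hSs, a, ha, b, hb, hab⟩ := hS
  rw [Subgroup.map_commutator,
    Subgroup.map_comap_eq_self_of_surjective (QuotientGroup.mk'_surjective Z) S,
    ← Subgroup.map_subtype_commutator]
  have htop : commutator S = ⊤ := by
    refine (IsSimpleGroup.eq_bot_or_eq_top_of_normal _ inferInstance).resolve_left fun h => hab ?_
    have h1 := Subgroup.commutator_mem_commutator (Subgroup.mem_top (⟨a, ha⟩ : S))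
      (Subgroup.mem_top (⟨b, hb⟩ : S))
    rw [← commutator_def, h, Subgroup.mem_bot, commutatorElement_eq_one_iff_mul_comm] at h1
    exact congrArg Subtype.val h1
  rw [htop, ← MonoidHom.range_eq_map, Subgroup.range_subtype]

/-- If all nontrivial subgroups of `G` have nontrivial representations of dimension at most `D`,
then simple subgroups of central quotients are small. -/
lemma card_simple_section_le {G : Type*} [Group G] [Finite G] {D : ℕ}
    (hD : ∀ L : Subgroup G, L ≠ ⊥ → ¬ OnlyTrivialReps D L) (Z : Subgroup G) [Z.Normal]
    (S : Subgroup (G ⧸ Z)) (hS : IsNonabelianSimple S)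
    (hZ : ElementsCommute Z (S.comap (QuotientGroup.mk' Z))) :
    Nat.card S ≤ (8 * D ^ 2 + 9) ^ D ^ 2 := by
  obtain ⟨hSs, a, ha, b, hb, hab⟩ := id hS
  obtain ⟨T, hT⟩ : ∃ T, T = S.comap (QuotientGroup.mk' Z) := ⟨_, rfl⟩
  rw [← hT] at hZ
  obtain ⟨L, hL⟩ : ∃ L, L = ⁅T, T⁆ := ⟨_, rfl⟩
  have hLmap : L.map (QuotientGroup.mk' Z) = S := by
    rw [hL, hT]; exact hS.map_commutator_comap
  have hLne : L ≠ ⊥ := by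
    intro h
    rw [h, Subgroup.map_bot] at hLmap
    rw [← hLmap, Subgroup.mem_bot] at ha hb
    exact hab (by rw [ha, hb])
  have hLnot := hD L hLne
  unfold OnlyTrivialReps at hLnot
  push Not at hLnot
  obtain ⟨d, hdD, ρ, hρ, g₀, hg₀⟩ := hLnot
  have hLS : ∀ x ∈ L, QuotientGroup.mk' Z x ∈ S := fun x hx => hLmap ▸ ⟨x, hx, rfl⟩
  let π : L →* S := ((QuotientGroup.mk' Z).comp L.subtype).codRestrict S fun x => hLS x x.2
  have hπ : Function.Surjective π := by
    rintro ⟨s, hs⟩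
    rw [← hLmap] at hs
    obtain ⟨x, hx, rfl⟩ := hs
    exact ⟨⟨x, hx⟩, rfl⟩
  -- Otherwise `ker ρ` maps onto the simple group `S`, so `T = ker ρ · Z` with `Z` commuting with
  -- `T`; then `L = [T, T]` lies in `ker ρ`, contradicting the nontriviality of `ρ`.
  have hker : ∀ g, ρ g = 1 → π g = 1 := by
    intro g hg
    by_contra hne
    have hN : (ρ.ker.map π) = ⊤ := by
      have hn : (ρ.ker.map π).Normal := Subgroup.Normal.map inferInstance π hπ
      refine (IsSimpleGroup.eq_bot_or_eq_top_of_normal _ hn).resolve_left fun h => hne ?_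
      have : π g ∈ ρ.ker.map π := ⟨g, hg, rfl⟩
      rwa [h, Subgroup.mem_bot] at this
    have hfac : ∀ x ∈ T, ∃ k : L, ρ k = 1 ∧ ∃ z ∈ Z, x = k * z := by
      intro x hx
      have hxS : QuotientGroup.mk' Z x ∈ S := by rw [hT] at hx; exact hx
      have : (⟨_, hxS⟩ : S) ∈ ρ.ker.map π := hN ▸ Subgroup.mem_top _
      obtain ⟨k, hk, hkx⟩ := this
      refine ⟨k, hk, (k : G)⁻¹ * x, ?_, by group⟩
      exact QuotientGroup.eq.1 (congrArg Subtype.val hkx)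
    have hLT : L ≤ T := hL ▸ Subgroup.commutator_le_self T
    have hLker : L ≤ ρ.ker.map L.subtype := by
      conv_lhs => rw [hL]
      rw [Subgroup.commutator_le]
      intro x hx y hy
      obtain ⟨k, hk, z, hz, rfl⟩ := hfac x hx
      obtain ⟨k', hk', z', hz', rfl⟩ := hfac y hy
      have c1 : z * (k' * z') = k' * z' * z := hZ z hz _ hy
      have c2 : z' * (k : G) = k * z' := hZ z' hz' _ (hLT k.2)
      rw [commutatorElement_def]
      refine ⟨k * k' * k⁻¹ * k'⁻¹, ?_, ?_⟩
      · rw [SetLike.mem_coe, MonoidHom.mem_ker]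
        have hk1 : ρ k⁻¹ = 1 := MonoidHom.mem_ker.1 (ρ.ker.inv_mem hk)
        have hk2 : ρ k'⁻¹ = 1 := MonoidHom.mem_ker.1 (ρ.ker.inv_mem hk')
        rw [map_mul, map_mul, map_mul, hk, hk', hk1, hk2]; simp
      · change (k : G) * k' * (k : G)⁻¹ * (k' : G)⁻¹ = _
        have e1 : (k : G) * z * (k' * z') = k * k' * (z' * z) := by
          rw [mul_assoc, c1]; group
        have e2 : ((k : G) * z)⁻¹ = z⁻¹ * (k : G)⁻¹ := mul_inv_rev _ _
        have e3 : ((k' : G) * z')⁻¹ = z'⁻¹ * (k' : G)⁻¹ := mul_inv_rev _ _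
        have e4 : z' * (k : G)⁻¹ * z'⁻¹ = (k : G)⁻¹ := by
          calc z' * (k : G)⁻¹ * z'⁻¹ = (z' * k * z'⁻¹)⁻¹ := by group
            _ = (k : G)⁻¹ := by rw [c2, mul_inv_cancel_right]
        rw [e1, e2, e3]
        calc (k : G) * k' * (k : G)⁻¹ * (k' : G)⁻¹
            = k * k' * (z' * (k : G)⁻¹ * z'⁻¹) * (k' : G)⁻¹ := by rw [e4]
          _ = _ := by group
    obtain ⟨y, hy, hyg⟩ := hLker g₀.2
    have : y = g₀ := Subtype.ext hyg
    exact hg₀ (this ▸ hy)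
  have hnc : ∃ a b : S, a * b ≠ b * a :=
    ⟨⟨a, ha⟩, ⟨b, hb⟩, fun h => hab (congrArg Subtype.val h)⟩
  refine (card_simple_le_of_rep ρ hnc π hπ hρ hker).trans ?_
  calc (8 * d ^ 2 + 9) ^ d ^ 2 ≤ (8 * D ^ 2 + 9) ^ d ^ 2 := by gcongr
    _ ≤ _ := Nat.pow_le_pow_right (by positivity) (by gcongr)

end SimpleBound

/-! ### Bounding the number of simple factors. -/

section FactorCount

open Finset

lemma card_eq_card_mul_card_map {G H : Type*} [Group G] [Group H] (f : G →* H) (K : Subgroup G) :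
    Nat.card K = Nat.card (f.comp K.subtype).ker * Nat.card (K.map f) := by
  have h := Subgroup.card_mul_index (f.comp K.subtype).ker
  rw [Subgroup.index_ker, MonoidHom.range_comp, Subgroup.range_subtype] at h
  exact h.symm

lemma card_le_card_ker_mul_card_map {G H : Type*} [Group G] [Finite G] [Group H] (f : G →* H)
    (K : Subgroup G) : Nat.card K ≤ Nat.card f.ker * Nat.card (K.map f) := by
  rw [card_eq_card_mul_card_map f K]
  refine Nat.mul_le_mul_right _ ?_
  exact Nat.card_le_card_of_injective
    (fun x : (f.comp K.subtype).ker => (⟨x.1.1, x.2⟩ : f.ker))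
    fun a b hab => Subtype.ext (Subtype.ext (Subtype.mk.inj hab))

lemma ElementsCommute.sup_left {Γ : Type*} [Group Γ] {S T U : Subgroup Γ}
    (h1 : ElementsCommute S U) (h2 : ElementsCommute T U) : ElementsCommute (S ⊔ T) U :=
  elementsCommute_iff_le.2 (sup_le (elementsCommute_iff_le.1 h1) (elementsCommute_iff_le.1 h2))

lemma ElementsCommute.sup_self {Γ : Type*} [Group Γ] {S T : Subgroup Γ}
    (h1 : ElementsCommute S S) (h2 : ElementsCommute T T) (h : ElementsCommute S T) :
    ElementsCommute (S ⊔ T) (S ⊔ T) :=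
  ElementsCommute.sup_left (h1.sup_left h.symm).symm (h.sup_left h2).symm

lemma elementsCommute_closure {Γ : Type*} [Group Γ] {Y : Set Γ}
    (hY : ∀ a ∈ Y, ∀ b ∈ Y, a * b = b * a) :
    ElementsCommute (Subgroup.closure Y) (Subgroup.closure Y) := by
  have h1 : ∀ a ∈ Y, Subgroup.closure Y ≤ Subgroup.centralizer {a} := fun a ha =>
    (Subgroup.closure_le _).2 fun b hb => Subgroup.mem_centralizer_singleton_iff.2 (hY b hb a ha)
  refine elementsCommute_iff_le.2 ((Subgroup.closure_le _).2 fun a ha => ?_)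
  exact Subgroup.mem_centralizer_iff.2 fun b hb =>
    Subgroup.mem_centralizer_singleton_iff.1 (h1 a ha hb)

lemma IsNonabelianSimple.eq_one_of_commute {Γ : Type*} [Group Γ] {S : Subgroup Γ}
    (hS : IsNonabelianSimple S) {x : Γ} (hx : x ∈ S) (hc : ∀ s ∈ S, s * x = x * s) : x = 1 := by
  obtain ⟨hSs, a, ha, b, hb, hab⟩ := hS
  have hcen : (⟨x, hx⟩ : S) ∈ Subgroup.center S :=
    Subgroup.mem_center_iff.2 fun s => Subtype.ext (hc s s.2)
  rcases IsSimpleGroup.eq_bot_or_eq_top_of_normal (Subgroup.center S) inferInstance with h0 | h0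
  · rw [h0, Subgroup.mem_bot] at hcen
    exact congrArg Subtype.val hcen
  · have : (⟨b, hb⟩ : S) ∈ Subgroup.center S := h0 ▸ Subgroup.mem_top _
    exact absurd (congrArg Subtype.val (Subgroup.mem_center_iff.1 this ⟨a, ha⟩)) hab

/-- Elements of order `p` in commuting simple groups generate a large group. -/
lemma pow_card_le_card_closure {Γ : Type*} [Group Γ] [Finite Γ] {p : ℕ}
    (F : Finset (Subgroup Γ)) (hF : ∀ S ∈ F, IsNonabelianSimple S)
    (hFc : (F : Set (Subgroup Γ)).Pairwise ElementsCommute) (y : Subgroup Γ → Γ)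
    (hy : ∀ S ∈ F, y S ∈ S ∧ orderOf (y S) = p) :
    p ^ #F ≤ Nat.card (Subgroup.closure (y '' F)) := by
  classical
  induction F using Finset.induction_on with
  | empty => simp
  | insert S F hSF ih =>
    have ih' := ih (fun T hT => hF T (mem_insert_of_mem hT))
      (hFc.mono (coe_subset.2 (subset_insert S F))) fun T hT => hy T (mem_insert_of_mem hT)
    obtain ⟨hyS, hyo⟩ := hy S (mem_insert_self S F)
    have hS := hF S (mem_insert_self S F)
    obtain ⟨K, hK⟩ : ∃ K, K = Subgroup.closure (y '' F) := ⟨_, rfl⟩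
    have hKS : ElementsCommute K S := by
      rw [elementsCommute_iff_le, hK, Subgroup.closure_le]
      rintro _ ⟨T, hT, rfl⟩
      have hne : T ≠ S := fun h => hSF (h ▸ hT)
      have := hFc (mem_insert_of_mem hT) (mem_insert_self S F) hne
      exact elementsCommute_iff_le.1 this (hy T (mem_insert_of_mem hT)).1
    have hzS : Subgroup.zpowers (y S) ≤ S := Subgroup.zpowers_le.2 hyS
    -- An element of `K` commutes with all of `S`; if it also lies in `S`, it is central there,
    -- hence trivial.
    have hdisj : Disjoint K (Subgroup.zpowers (y S)) := by
      rw [Subgroup.disjoint_def]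
      intro x hxK hxz
      exact hS.eq_one_of_commute (hzS hxz) fun s hs => (hKS x hxK s hs).symm
    have hle : ∀ q : K × Subgroup.zpowers (y S), (q.1 : Γ) * q.2 ∈
        Subgroup.closure (y '' (↑(insert S F) : Set (Subgroup Γ))) := by
      intro q
      refine Subgroup.mul_mem _ ?_ ?_
      · exact Subgroup.closure_mono (Set.image_mono (coe_subset.2 (subset_insert S F)))
          (hK ▸ q.1.2)
      · exact Subgroup.zpowers_le.2
          (Subgroup.subset_closure (Set.mem_image_of_mem y (mem_coe.2 (mem_insert_self S F)))) q.2.2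
    have hinj := Nat.card_le_card_of_injective
      (fun q : K × Subgroup.zpowers (y S) =>
        (⟨(q.1 : Γ) * q.2, hle q⟩ :
          Subgroup.closure (y '' (↑(insert S F) : Set (Subgroup Γ)))))
      fun a b hab => Subgroup.mul_injective_of_disjoint hdisj (congrArg Subtype.val hab :)
    rw [Nat.card_prod, Nat.card_zpowers, hyo] at hinj
    rw [card_insert_of_notMem hSF, pow_succ]
    exact (Nat.mul_le_mul_right _ (hK ▸ ih')).trans hinj

/-- Commuting lifts of elements of order `p` generate a group of bounded rank. -/
lemma card_map_le_of_pow_eq_one {G H : Type*} [Group G] [Finite G] [Group H] (f : G →* H) {p R : ℕ}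
    (hR : ∀ E : Subgroup G, ElementsCommute E E → (∀ x ∈ E, x ^ p = 1) →
      Nat.card E ≤ p ^ R)
    (B : Subgroup G) (hB : ElementsCommute B B) (hf : ∀ b ∈ B, f b ^ p = 1) :
    Nat.card (B.map f) ≤ p ^ R := by
  let _ : CommGroup B :=
    { (inferInstance : Group B) with
      mul_comm := fun a b => Subtype.ext (hB a a.2 b b.2) }
  let g : B →* B := powMonoidHom p
  have h1 : Nat.card (g.ker.map B.subtype) ≤ p ^ R := by
    refine hR _ ?_ ?_
    · rintro _ ⟨a, -, rfl⟩ _ ⟨b, -, rfl⟩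
      exact hB a a.2 b b.2
    · rintro _ ⟨a, ha, rfl⟩
      exact congrArg Subtype.val (MonoidHom.mem_ker.1 ha)
  have h2 : Nat.card g.ker ≤ p ^ R := by
    refine le_trans (le_of_eq ?_) h1
    exact Nat.card_congr (g.ker.equivMapOfInjective B.subtype B.subtype_injective).toEquiv
  have h3 := Subgroup.card_mul_index g.ker
  rw [Subgroup.index_ker] at h3
  -- The `p`-th powers of `B` lie in the kernel of `f`, so `f(B)` is no larger than `B / Bᵖ`, which
  -- has the order of the `p`-torsion of `B`.
  have h4 : Nat.card g.range ≤ Nat.card (f.comp B.subtype).ker := by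
    refine Nat.card_le_card_of_injective (Subgroup.inclusion ?_) (Subgroup.inclusion_injective _)
    rintro _ ⟨b, rfl⟩
    rw [MonoidHom.mem_ker]
    change f ((b : G) ^ p) = 1
    rw [map_pow]; exact hf b b.2
  have h5 := card_eq_card_mul_card_map f B
  have hpos : 0 < Nat.card (f.comp B.subtype).ker := Nat.card_pos
  refine Nat.le_of_mul_le_mul_left ?_ hpos
  rw [← h5, ← h3, mul_comm]
  exact Nat.mul_le_mul h4 h2

/-- For each prime `p` at most `R` members have order divisible by `p`: lift elements of order `p`
to commuting elements of `G` and compare the rank of what they generate with `R`. Every member has a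
prime divisor at most `J`. -/
lemma card_simple_family_le {G : Type*} [Group G] [Finite G] {J R : ℕ} (Z C : Subgroup G)
    [Z.Normal] (hZC : Z ≤ C) (hcomm : ElementsCommute Z C)
    (hR : ∀ p : ℕ, p.Prime → ∀ E : Subgroup G, ElementsCommute E E → (∀ x ∈ E, x ^ p = 1) →
      Nat.card E ≤ p ^ R)
    (F : Finset (Subgroup (G ⧸ Z))) (hFC : ∀ S ∈ F, S ≤ C.map (QuotientGroup.mk' Z))
    (hF : ∀ S ∈ F, IsNonabelianSimple S) (hJ : ∀ S ∈ F, Nat.card S ≤ J)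
    (hFc : (F : Set (Subgroup (G ⧸ Z))).Pairwise ElementsCommute) : #F ≤ J * R := by
  classical
  let π := QuotientGroup.mk' Z
  have hTC : ∀ S ∈ F, S.comap π ≤ C := by
    intro S hS x hx
    obtain ⟨c, hc, hcx⟩ := hFC S hS hx
    have : c⁻¹ * x ∈ Z := QuotientGroup.eq.1 hcx
    have := C.mul_mem hc (hZC this)
    rwa [mul_inv_cancel_left] at this
  have hprime : ∀ p : ℕ, p.Prime → (F.filter fun S : Subgroup (G ⧸ Z) => p ∣ Nat.card S).card ≤ R := by
    intro p hp
    have := Fact.mk hp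
    have hexists : ∀ S : Subgroup (G ⧸ Z), ∃ y : G, S ∈ F → p ∣ Nat.card S →
        y ∈ ⁅S.comap π, S.comap π⁆ ∧ π y ∈ S ∧ orderOf (π y) = p := by
      intro S
      by_cases hS : S ∈ F ∧ p ∣ Nat.card S
      · obtain ⟨s, hs⟩ := exists_prime_orderOf_dvd_card' p hS.2
        have hsS : (s : G ⧸ Z) ∈ (⁅S.comap π, S.comap π⁆).map π :=
          (hF S hS.1).map_commutator_comap.ge s.2
        obtain ⟨y, hy, hys⟩ := hsS
        refine ⟨y, fun _ _ => ⟨hy, hys ▸ s.2, ?_⟩⟩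
        rw [hys, Subgroup.orderOf_coe, hs]
      · exact ⟨1, fun h1 h2 => absurd ⟨h1, h2⟩ hS⟩
    choose y hy using hexists
    obtain ⟨F', hF'⟩ : ∃ F' : Finset (Subgroup (G ⧸ Z)), F' = (F.filter fun S : Subgroup (G ⧸ Z) => p ∣ Nat.card S) := ⟨_, rfl⟩
    rw [← hF']
    have hmem : ∀ S ∈ F', S ∈ F ∧ p ∣ Nat.card S := fun S hS => by
      rw [hF'] at hS; exact mem_filter.1 hS
    -- Conjugation by `t` multiplies each element of the preimage of `S` by an element of `Z`. As
    -- `Z` commutes with `C`, this leaves commutators unchanged, so lifts chosen in the commutator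
    -- subgroups commute exactly and not just modulo `Z`.
    have hcent : ∀ S ∈ F', ∀ T ∈ F', S ≠ T → ElementsCommute ⁅S.comap π, S.comap π⁆ (T.comap π) := by
      intro S hS T hT hne
      have hSF := (hmem S hS).1
      have hTF := (hmem T hT).1
      rw [elementsCommute_iff_le, Subgroup.commutator_le]
      intro a ha b hb
      refine Subgroup.mem_centralizer_iff.2 fun t ht => ?_
      have hz : ∀ x ∈ S.comap π, ∃ z ∈ Z, t * x * t⁻¹ = z * x := by
        intro x hx
        refine ⟨t * x * t⁻¹ * x⁻¹, ?_, by group⟩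
        have h1 : π x * π t = π t * π x := hFc hSF hTF hne (π x) hx (π t) ht
        have h2 : π (t * x * t⁻¹ * x⁻¹) = 1 := by
          rw [map_mul, map_mul, map_mul, map_inv, map_inv, ← h1]; group
        exact (QuotientGroup.eq_one_iff _).1 h2
      obtain ⟨z, hzZ, hz1⟩ := hz a ha
      obtain ⟨w, hwZ, hw1⟩ := hz b hb
      have haC := hTC S hSF ha
      have hbC := hTC S hSF hb
      rw [commutatorElement_def]
      have e1 : t * (a * b * a⁻¹ * b⁻¹) * t⁻¹ =
          (t * a * t⁻¹) * (t * b * t⁻¹) * (t * a * t⁻¹)⁻¹ * (t * b * t⁻¹)⁻¹ := by group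
      have za : z * a = a * z := hcomm z hzZ a haC
      have zb : z * b = b * z := hcomm z hzZ b hbC
      have wb : w * b = b * w := hcomm w hwZ b hbC
      have wa : w * a = a * w := hcomm w hwZ a haC
      have zw : z * w = w * z := hcomm z hzZ w (hZC hwZ)
      have e2 : z * a * (w * b) * (z * a)⁻¹ * (w * b)⁻¹ = a * b * a⁻¹ * b⁻¹ := by
        have e3 : z * a * (w * b) = (a * b) * (w * z) := by
          calc z * a * (w * b) = a * (z * w) * b := by rw [za]; group
            _ = a * w * (z * b) := by rw [zw]; group
            _ = a * (w * b) * z := by rw [zb]; group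
            _ = _ := by rw [wb]; group
        have e4 : (w * b) * (z * a) = b * a * (w * z) := by
          calc (w * b) * (z * a) = b * (w * z) * a := by rw [wb]; group
            _ = b * (w * (z * a)) := by group
            _ = b * ((w * a) * z) := by rw [za]; group
            _ = _ := by rw [wa]; group
        calc z * a * (w * b) * (z * a)⁻¹ * (w * b)⁻¹
            = z * a * (w * b) * ((w * b) * (z * a))⁻¹ := by group
          _ = a * b * (w * z) * (b * a * (w * z))⁻¹ := by rw [e3, e4]
          _ = _ := by group
      rw [hz1, hw1, e2] at e1
      calc t * (a * b * a⁻¹ * b⁻¹) = t * (a * b * a⁻¹ * b⁻¹) * t⁻¹ * t := by group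
        _ = _ := by rw [e1]
    have hyT : ∀ S ∈ F', y S ∈ ⁅S.comap π, S.comap π⁆ ∧ π (y S) ∈ S ∧ orderOf (π (y S)) = p :=
      fun S hS => hy S (hmem S hS).1 (hmem S hS).2
    have hBcomm : ElementsCommute (Subgroup.closure (y '' F')) (Subgroup.closure (y '' F')) := by
      refine elementsCommute_closure ?_
      rintro _ ⟨S, hS, rfl⟩ _ ⟨T, hT, rfl⟩
      by_cases hST : S = T
      · rw [hST]
      · exact hcent S hS T hT hST _ (hyT S hS).1 _ (Subgroup.commutator_le_self _ (hyT T hT).1)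
    have hle := card_map_le_of_pow_eq_one π (hR p hp) (Subgroup.closure (y '' F')) hBcomm (by
      intro b hb
      induction hb using Subgroup.closure_induction with
      | mem x hx =>
        obtain ⟨S, hS, rfl⟩ := hx
        rw [← (hyT S hS).2.2]; exact pow_orderOf_eq_one _
      | one => simp
      | mul a b ha hb iha ihb =>
        have hc : Commute (π a) (π b) := by
          rw [commute_iff_eq, ← map_mul, ← map_mul, hBcomm a ha b hb]
        rw [map_mul, hc.mul_pow, iha, ihb, one_mul]
      | inv a ha iha => rw [map_inv, inv_pow, iha, inv_one])
    rw [MonoidHom.map_closure, ← Set.image_comp] at hle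
    have hge := pow_card_le_card_closure F' (fun S hS => hF S (hmem S hS).1)
      (hFc.mono fun S hS => (hmem S hS).1) (π ∘ y) fun S hS => (hyT S hS).2
    exact (Nat.pow_le_pow_iff_right hp.one_lt).1 (hge.trans hle)
  have hcover : F ⊆ (Icc 1 J).biUnion fun p => (F.filter fun S : Subgroup (G ⧸ Z) => p.Prime ∧ p ∣ Nat.card S) := by
    intro S hS
    have hne : Nat.card S ≠ 1 := by
      intro h1
      obtain ⟨_, a, ha, b, hb, hab⟩ := hF S hS
      have := Finite.card_le_one_iff_subsingleton.1 h1.le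
      have h2 : (⟨a, ha⟩ : S) = ⟨b, hb⟩ := Subsingleton.elim _ _
      exact hab (by rw [Subtype.mk.inj h2])
    obtain ⟨p, hp, hpd⟩ := Nat.exists_prime_and_dvd hne
    refine mem_biUnion.2 ⟨p, mem_Icc.2 ⟨hp.one_lt.le, ?_⟩, mem_filter.2 ⟨hS, hp, hpd⟩⟩
    exact (Nat.le_of_dvd Nat.card_pos hpd).trans (hJ S hS)
  refine (card_le_card hcover).trans (card_biUnion_le.trans ?_)
  calc ∑ p ∈ Icc 1 J, (F.filter fun S : Subgroup (G ⧸ Z) => p.Prime ∧ p ∣ Nat.card S).card ≤ ∑ p ∈ Icc 1 J, R := by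
        refine sum_le_sum fun p _ => ?_
        by_cases hp : p.Prime
        · simpa [hp] using hprime p hp
        · simp [hp]
    _ = J * R := by simp

end FactorCount

/-! ### Assembling the bound on the order of the group. -/

section Structure

open Finset

/-- The conjugation action of `Q` on an invariant generating set with trivial centralizer. -/
lemma card_le_pow_of_trivial_centralizer {Γ : Type*} [Group Γ] [Finite Γ] (Q : Subgroup Γ)
    (U : Finset Γ) {M : ℕ} (hU : #U ≤ M) (hinv : ∀ q ∈ Q, ∀ u ∈ U, q * u * q⁻¹ ∈ U)
    (hcent : ∀ q ∈ Q, (∀ u ∈ U, q * u = u * q) → q = 1) : Nat.card Q ≤ M ^ M := by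
  classical
  rcases Nat.eq_zero_or_pos M with rfl | hM
  · have hU0 : U = ∅ := card_eq_zero.1 (Nat.le_zero.1 hU)
    rw [pow_zero, Finite.card_le_one_iff_subsingleton]
    refine ⟨fun a b => ?_⟩
    have h : ∀ q : Q, q = 1 := fun q => Subtype.ext (hcent q q.2 (by simp [hU0]))
    rw [h a, h b]
  have h1 : Nat.card Q ≤ Nat.card (U → U) := by
    refine Nat.card_le_card_of_injective
      (fun (q : Q) (u : U) => (⟨q * (u : Γ) * (q : Γ)⁻¹, hinv q q.2 u u.2⟩ : U)) ?_
    intro a b hab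
    have h2 : (b : Γ)⁻¹ * a = 1 := by
      refine hcent _ (Q.mul_mem (Q.inv_mem b.2) a.2) fun u hu => ?_
      have h3 : (a : Γ) * u * (a : Γ)⁻¹ = b * u * (b : Γ)⁻¹ :=
        Subtype.mk.inj (congrFun hab ⟨u, hu⟩)
      calc (b : Γ)⁻¹ * a * u = (b : Γ)⁻¹ * (a * u * (a : Γ)⁻¹) * a := by group
        _ = _ := by rw [h3]; group
    exact Subtype.ext (inv_mul_eq_one.1 h2).symm
  refine h1.trans ?_
  rw [Nat.card_fun, Nat.card_eq_fintype_card, Fintype.card_coe]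
  calc #U ^ #U ≤ M ^ #U := Nat.pow_le_pow_left hU _
    _ ≤ M ^ M := Nat.pow_le_pow_right hM hU

/-- A finite group all of whose nontrivial subgroups have nontrivial low-dimensional
representations, whose abelian normal subgroups are small and whose elementary abelian subgroups
have small rank, is small. -/
theorem card_le_of_structure {G : Type*} [Group G] [Finite G] {D R μ J : ℕ}
    (hJ : J = (8 * D ^ 2 + 9) ^ D ^ 2)
    (hD : ∀ L : Subgroup G, L ≠ ⊥ → ¬ OnlyTrivialReps D L)
    (hμ : ∀ N : Subgroup G, N.Normal → ElementsCommute N N → Nat.card N ≤ 2 ^ μ)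
    (hR : ∀ p : ℕ, p.Prime → ∀ E : Subgroup G, ElementsCommute E E → (∀ x ∈ E, x ^ p = 1) →
      Nat.card E ≤ p ^ R) :
    Nat.card G ≤ 2 ^ ((2 * μ * R * (2 * μ * R) + 2 * μ * R) *
      (2 * μ * R * (2 * μ * R) + 2 * μ * R)) * (2 ^ μ * (J * R * J) ^ (J * R * J)) := by
  classical
  -- a maximal abelian normal subgroup
  obtain ⟨Z, ⟨hZn, hZab⟩, hZmax⟩ := (Set.toFinite {N : Subgroup G |
    N.Normal ∧ ElementsCommute N N}).exists_maximal
    ⟨⊥, inferInstance, fun a ha b hb => by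
      rw [Subgroup.mem_bot.1 ha, Subgroup.mem_bot.1 hb]⟩
  have hZcard := hμ Z hZn hZab
  let π := QuotientGroup.mk' Z
  have hπZ : Z.map π = ⊥ := by
    rw [Subgroup.map_eq_bot_iff, QuotientGroup.ker_mk']
  -- a maximal normal subgroup of class two above it
  obtain ⟨X, ⟨hXn, hZX, hZXc, hXab⟩, hXmax⟩ := (Set.toFinite {X : Subgroup G |
    X.Normal ∧ Z ≤ X ∧ ElementsCommute Z X ∧ ElementsCommute (X.map π) (X.map π)}).exists_maximal
    ⟨Z, hZn, le_rfl, hZab, fun a ha b hb => by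
      rw [hπZ, Subgroup.mem_bot] at ha hb; rw [ha, hb]⟩
  obtain ⟨C, hC⟩ : ∃ C, C = Subgroup.centralizer (X : Set G) := ⟨_, rfl⟩
  have hCX : ElementsCommute C X := elementsCommute_iff_le.2 hC.le
  have hZC : Z ≤ C := hC ▸ elementsCommute_iff_le.1 hZXc
  have hCn : C.Normal := by rw [hC]; infer_instance
  -- `X ⊓ C` is an abelian normal subgroup containing `Z`, so it equals `Z` by maximality.
  have hcentre : X ⊓ C ≤ Z := by
    refine hZmax ⟨inferInstance, ?_⟩ (le_inf hZX hZC)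
    intro a ha b hb
    exact (hCX b hb.2 a ha.1).symm
  have hXcomm : ∀ a ∈ X, ∀ b ∈ X, a * b * a⁻¹ * b⁻¹ ∈ Z := by
    intro a ha b hb
    have h1 : π a * π b = π b * π a := hXab _ ⟨a, ha, rfl⟩ _ ⟨b, hb, rfl⟩
    have h2 : π (a * b * a⁻¹ * b⁻¹) = 1 := by
      rw [map_mul, map_mul, map_mul, map_inv, map_inv, h1]; group
    exact (QuotientGroup.eq_one_iff _).1 h2
  -- a maximal abelian subgroup of `X`
  obtain ⟨Y, ⟨hZY, hYX, hYab⟩, hYmax⟩ := (Set.toFinite {Y : Subgroup G |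
    Z ≤ Y ∧ Y ≤ X ∧ ElementsCommute Y Y}).exists_maximal ⟨Z, le_rfl, hZX, hZab⟩
  -- Commutators in `X` are central in `X` and killed by `|Z|`, so `x ^ |Z|` is central in `X`,
  -- hence in `Z`. Every element of `X` thus satisfies `x ^ (|Z|²) = 1`.
  have hpowZ : ∀ x ∈ X, x ^ (Nat.card Z) ∈ Z := by
    intro x hx
    refine hcentre ⟨X.pow_mem hx _, ?_⟩
    rw [hC]
    refine Subgroup.mem_centralizer_iff.2 fun y hy => ?_
    have hz := hXcomm y hy x hx
    have hzc : (y * x * y⁻¹ * x⁻¹) ^ (Nat.card Z) = 1 := by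
      have := pow_card_eq_one' (x := (⟨_, hz⟩ : Z))
      exact congrArg Subtype.val this
    have h1 : y * x * y⁻¹ = (y * x * y⁻¹ * x⁻¹) * x := by group
    have hcom : Commute (y * x * y⁻¹ * x⁻¹) x := hZXc _ hz x hx
    have h2 : y * x ^ Nat.card Z * y⁻¹ = x ^ Nat.card Z := by
      rw [← conj_pow, h1, hcom.mul_pow, hzc, one_mul]
    calc y * x ^ Nat.card Z = y * x ^ Nat.card Z * y⁻¹ * y := by group
      _ = _ := by rw [h2]
  have hYcard : Nat.card Y ≤ 2 ^ (2 * μ * R) := by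
    let _ : CommGroup Y :=
      { (inferInstance : Group Y) with
        mul_comm := fun a b => Subtype.ext (hYab a a.2 b b.2) }
    have h1 := card_le_exponent_pow R (Nat.card Z * Nat.card Z)
      (Nat.mul_pos Nat.card_pos Nat.card_pos) Y (by
        intro y
        refine Subtype.ext ?_
        change (y : G) ^ (Nat.card Z * Nat.card Z) = 1
        have := pow_card_eq_one' (x := (⟨_, hpowZ y (hYX y.2)⟩ : Z))
        rw [pow_mul]
        exact congrArg Subtype.val this) (by
        intro p hp
        refine le_trans (le_of_eq ?_) (hR p hp ((powMonoidHom p : Y →* Y).ker.map Y.subtype) ?_ ?_)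
        · exact Nat.card_congr
            ((powMonoidHom p : Y →* Y).ker.equivMapOfInjective Y.subtype Y.subtype_injective).toEquiv
        · rintro _ ⟨a, -, rfl⟩ _ ⟨b, -, rfl⟩
          exact hYab a a.2 b b.2
        · rintro _ ⟨a, ha, rfl⟩
          exact congrArg Subtype.val (MonoidHom.mem_ker.1 ha))
    calc Nat.card Y ≤ (Nat.card Z * Nat.card Z) ^ R := h1
      _ ≤ (2 ^ μ * 2 ^ μ) ^ R := by gcongr
      _ = _ := by rw [← pow_add, ← pow_mul]; congr 1; ring
  have hYself : X ⊓ Subgroup.centralizer (Y : Set G) ≤ Y := by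
    intro x hx
    have hxY : ElementsCommute (Subgroup.zpowers x) Y :=
      elementsCommute_iff_le.2 (Subgroup.zpowers_le.2 hx.2)
    have hxx : ElementsCommute (Subgroup.zpowers x) (Subgroup.zpowers x) := by
      rw [Subgroup.zpowers_eq_closure]
      exact elementsCommute_closure (by rintro a rfl b rfl; rfl)
    have := hYmax ⟨hZY.trans le_sup_left, sup_le hYX (Subgroup.zpowers_le.2 hx.1),
      hYab.sup_self hxx hxY.symm⟩ le_sup_left
    exact this (le_sup_right (a := Y) (Subgroup.mem_zpowers x))
  -- `Y` is normalized by `X`, since commutators of `X` lie in `Z ≤ Y`, and is its own centralizer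
  -- in `X`; so `X` embeds modulo `Y` into the automorphisms of `Y`.
  have hXcard : Nat.card X ≤ 2 ^ (2 * μ * R * (2 * μ * R) + 2 * μ * R) := by
    refine (card_le_mul_card_centralizer X Y ?_ hYcard).trans ?_
    · intro x hx y hy
      have := Y.mul_mem (hZY (hXcomm x hx y (hYX hy))) hy
      rwa [inv_mul_cancel_right] at this
    · rw [pow_add]
      exact Nat.mul_le_mul_left _ ((Subgroup.card_le_of_le hYself).trans hYcard)
  have hGcard := card_le_mul_card_centralizer (⊤ : Subgroup G) X
    (fun g _ x hx => hXn.conj_mem x hx g) hXcard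
  rw [top_inf_eq, ← hC, Subgroup.card_top] at hGcard
  refine hGcard.trans (Nat.mul_le_mul_left _ ?_)
  -- the centralizer of `X` modulo `Z`
  have hCcard := card_le_card_ker_mul_card_map π C
  rw [QuotientGroup.ker_mk'] at hCcard
  refine hCcard.trans (Nat.mul_le_mul hZcard ?_)
  have hQn : (C.map π).Normal := hCn.map π (QuotientGroup.mk'_surjective Z)
  have hcomap : ∀ S ≤ C.map π, S.comap π ≤ C := by
    intro S hS x hx
    obtain ⟨c, hc, hcx⟩ := hS hx
    have h1 : c⁻¹ * x ∈ Z := QuotientGroup.eq.1 hcx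
    have := C.mul_mem hc (hZC h1)
    rwa [mul_inv_cancel_left] at this
  have hCZ : ElementsCommute Z C := fun z hz c hc => (hCX c hc z (hZX hz)).symm
  obtain ⟨F, hF1, hF2, hF3, hF4⟩ := exists_simple_family (C.map π) (by
    intro U hUn hUC hUab
    have hUmap : (U.comap π).map π = U :=
      Subgroup.map_comap_eq_self_of_surjective (QuotientGroup.mk'_surjective Z) U
    have hZU : Z ≤ U.comap π := by
      intro z hz
      have : π z = 1 := (QuotientGroup.eq_one_iff z).2 hz
      rw [Subgroup.mem_comap, this]; exact U.one_mem
    -- Joining the preimage of `U` to `X` keeps `Z` central and the quotient abelian, so maximality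
    -- of `X` absorbs it.
    have hUX : U.comap π ≤ X := by
      refine le_sup_right.trans (hXmax ⟨?_, hZX.trans le_sup_left, ?_, ?_⟩ le_sup_left)
      · infer_instance
      · exact (hZXc.symm.sup_left
          (ElementsCommute.symm fun z hz c hc => hCZ z hz c (hcomap U hUC hc))).symm
      · rw [Subgroup.map_sup, hUmap]
        refine hXab.sup_self hUab ?_
        rintro _ ⟨x, hx, rfl⟩ u hu
        obtain ⟨c, hc, rfl⟩ := hUC hu
        rw [← map_mul, ← map_mul, hCX c hc x hx]
    have hUZ : U.comap π ≤ Z := (le_inf hUX (hcomap U hUC)).trans hcentre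
    rw [← hUmap, Subgroup.map_eq_bot_iff, QuotientGroup.ker_mk']
    exact hUZ)
  obtain ⟨F', hF'⟩ : ∃ F' : Finset (Subgroup (G ⧸ Z)), F' = (Set.toFinite F).toFinset := ⟨_, rfl⟩
  have hmem : ∀ S, S ∈ F' ↔ S ∈ F := fun S => by rw [hF']; exact Set.Finite.mem_toFinset _
  have hSJ : ∀ S ∈ F', Nat.card S ≤ J := by
    intro S hS
    rw [hJ]
    refine card_simple_section_le hD Z S (hF1 S ((hmem S).1 hS)).2 ?_
    exact fun z hz x hx => hCZ z hz x (hcomap S (hF1 S ((hmem S).1 hS)).1 hx)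
  have hFcard : #F' ≤ J * R := card_simple_family_le Z C hZC hCZ hR F'
    (fun S hS => (hF1 S ((hmem S).1 hS)).1) (fun S hS => (hF1 S ((hmem S).1 hS)).2) hSJ
    (hF2.mono fun S hS => (hmem S).1 hS)
  have := Fintype.ofFinite (G ⧸ Z)
  obtain ⟨U, hU⟩ : ∃ U : Finset (G ⧸ Z),
    U = F'.biUnion fun S : Subgroup (G ⧸ Z) => univ.filter fun x => x ∈ S := ⟨_, rfl⟩
  have hUmem : ∀ x, x ∈ U ↔ ∃ S ∈ F, x ∈ S := fun x => by simp [hU, hmem]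
  have hUcard : #U ≤ J * R * J := by
    rw [hU]
    refine (card_biUnion_le_card_mul _ _ J fun S hS => ?_).trans (Nat.mul_le_mul_right _ hFcard)
    refine le_trans (le_of_eq ?_) (hSJ S hS)
    rw [Nat.card_eq_fintype_card, Fintype.card_subtype]
  refine card_le_pow_of_trivial_centralizer (C.map π) U hUcard ?_ ?_
  · intro q _ u hu
    obtain ⟨S, hS, huS⟩ := (hUmem u).1 hu
    refine (hUmem _).2 ⟨_, hF3 S hS q, ?_⟩
    rw [mem_conjSubgroup]
    simpa [mul_assoc] using huS
  · intro q hq h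
    exact hF4 q hq fun S hS s hs => h s ((hUmem s).2 ⟨S, hS, hs⟩)

end Structure

/-! ### Quantitative conclusion. -/

section Main

open Finset

universe u

/-- The whole group contains the nontrivial solution `x * x⁻¹ = 1 ^ 2`. -/
lemma SquareFree.card_lt {G : Type*} [Group G] [Fintype G] {A : Finset G} (hA : SquareFree A)
    (hG : 1 < Fintype.card G) : #A < Fintype.card G := by
  classical
  have : Nontrivial G := Fintype.one_lt_card_iff_nontrivial.1 hG
  obtain ⟨x, hx⟩ := exists_ne (1 : G)
  refine (card_le_univ A).lt_of_ne fun h => hx ?_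
  have hu : ∀ g, g ∈ A := fun g => (card_eq_iff_eq_univ A).1 h ▸ mem_univ g
  exact hA x (hu x) 1 (hu 1) x⁻¹ (hu _) (by simp)

/-- Combining the structural alternatives: a dense set without nontrivial solutions forces the
order of the group to be small. -/
lemma exists_log_card_le : ∃ K : ℝ, 1 ≤ K ∧ ∀ (G : Type u) [Group G] [Fintype G] (A : Finset G)
    (_ : SquareFree A) (w : ℝ) (_ : 1 ≤ w) (_ : 1 / w * Fintype.card G ≤ #A),
    Real.log (Fintype.card G) ≤ Real.exp (14 * (K * w ^ 48)) := by
  obtain ⟨c₀, hc₀, helem⟩ := exists_card_elementary_le.{u}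
  refine ⟨c₀ + 22033, by linarith, ?_⟩
  intro G _ _ A hA w hw hdens
  have hw0 : 0 < w := by linarith
  have hα : 0 < 1 / w := by positivity
  have hw3 : 1 ≤ w ^ 3 := one_le_pow₀ hw
  -- With density `1 / w`, this makes the cubed density times `D` at least `5`, excluding the
  -- quasirandom alternative.
  obtain ⟨D, hD⟩ : ∃ D : ℕ, D = ⌈5 * w ^ 3⌉₊ := ⟨_, rfl⟩
  have hDl : 5 * w ^ 3 ≤ D := hD ▸ Nat.le_ceil _
  have hDu : (D : ℝ) ≤ 6 * w ^ 3 := by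
    have := (Nat.ceil_lt_add_one (show 0 ≤ 5 * w ^ 3 by positivity)).le
    rw [← hD] at this; linarith
  have hD1 : (1 : ℝ) ≤ D := by linarith
  have hreps : ∀ L : Subgroup G, L ≠ ⊥ → ¬ OnlyTrivialReps D L := by
    rcases exists_quasirandom_or (G := G) D with ⟨K, hKn, hK1, hK⟩ | h
    · exfalso
      have h1 := density_le_of_quasirandom A hA hα hdens K hK1
        (by exact_mod_cast (zero_lt_one.trans_le hD1)) hK
      have h2 : (1 / w) ^ 3 * (5 * w ^ 3) = 5 := by field_simp
      have h3 : (1 / w) ^ 3 * (5 * w ^ 3) ≤ (1 / w) ^ 3 * D := by gcongr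
      linarith
    · exact h
  obtain ⟨μ, hμ⟩ : ∃ μ : ℕ, μ = 2 ^ (36 * ⌈100 / (1 / w) ^ 3⌉₊) := ⟨_, rfl⟩
  obtain ⟨R, hR⟩ : ∃ R : ℕ, R = ⌈Real.exp (c₀ / (1 / w) ^ 48)⌉₊ := ⟨_, rfl⟩
  obtain ⟨J, hJ⟩ : ∃ J : ℕ, J = (8 * D ^ 2 + 9) ^ D ^ 2 := ⟨_, rfl⟩
  have hstruct := card_le_of_structure hJ hreps (μ := μ) (R := R)
    (fun N hN hNab => by
      have := card_abelian_normal_le A hA hα hdens N hNab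
      rw [← hμ] at this
      exact_mod_cast this)
    (fun p hp E hE hEp => by
      have h1 := helem G A hA (1 / w) hα hdens p hp E hE hEp
      have hp1 : (1 : ℝ) ≤ p := by exact_mod_cast hp.one_lt.le
      have h2 : (p : ℝ) ^ Real.exp (c₀ / (1 / w) ^ 48) ≤ (p : ℝ) ^ (R : ℝ) :=
        Real.rpow_le_rpow_of_exponent_le hp1 (hR ▸ Nat.le_ceil _)
      rw [Real.rpow_natCast] at h2
      exact_mod_cast h1.trans h2)
  rw [Nat.card_eq_fintype_card] at hstruct
  -- All of `μ`, `R` and `J` are at most `E = exp s`. The largest numerical requirement comes from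
  -- `J ≤ exp(17 D⁴)` with `D⁴ ≤ 1296 w ^ 12`, and `17 · 1296 = 22032`.
  obtain ⟨s, hs⟩ : ∃ s, s = (c₀ + 22033) * w ^ 48 := ⟨_, rfl⟩
  obtain ⟨E, hE⟩ : ∃ E, E = Real.exp s := ⟨_, rfl⟩
  have hw48 : 1 ≤ w ^ 48 := one_le_pow₀ hw
  have hs1 : 1 ≤ s := by rw [hs]; nlinarith
  have hE2 : 2 ≤ E := by
    rw [hE]; linarith [Real.add_one_le_exp s]
  have hμE : (μ : ℝ) ≤ E := by
    have h1 : (100 : ℝ) / (1 / w) ^ 3 = 100 * w ^ 3 := by field_simp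
    have h2 : ((⌈100 / (1 / w) ^ 3⌉₊ : ℕ) : ℝ) ≤ 101 * w ^ 3 := by
      have := (Nat.ceil_lt_add_one (show 0 ≤ 100 / (1 / w) ^ 3 by positivity)).le
      rw [h1] at this ⊢
      linarith
    have h3 : w ^ 3 ≤ w ^ 48 := pow_le_pow_right₀ hw (by norm_num)
    have h4 : (2 : ℝ) ≤ Real.exp 1 := by linarith [Real.add_one_le_exp 1]
    rw [hμ, hE]
    push_cast
    calc (2 : ℝ) ^ (36 * ⌈100 / (1 / w) ^ 3⌉₊) ≤ Real.exp 1 ^ (36 * ⌈100 / (1 / w) ^ 3⌉₊) := by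
          gcongr
      _ = Real.exp ((36 * ⌈100 / (1 / w) ^ 3⌉₊ : ℕ) : ℝ) := by
          rw [← Real.exp_nat_mul, mul_one]
      _ ≤ Real.exp s := by
          refine Real.exp_le_exp.2 ?_
          push_cast
          rw [hs]
          nlinarith
  have hRE : (R : ℝ) ≤ E := by
    have h1 : c₀ / (1 / w) ^ 48 = c₀ * w ^ 48 := by field_simp
    have h2 := (Nat.ceil_lt_add_one (Real.exp_pos (c₀ / (1 / w) ^ 48)).le).le
    rw [← hR, h1] at h2
    have h3 : 1 ≤ Real.exp (c₀ * w ^ 48) := Real.one_le_exp (by positivity)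
    have h4 : (2 : ℝ) ≤ Real.exp (w ^ 48) := by linarith [Real.add_one_le_exp (w ^ 48)]
    calc (R : ℝ) ≤ Real.exp (c₀ * w ^ 48) * 2 := by linarith
      _ ≤ Real.exp (c₀ * w ^ 48) * Real.exp (w ^ 48) := by gcongr
      _ = Real.exp (c₀ * w ^ 48 + w ^ 48) := (Real.exp_add _ _).symm
      _ ≤ E := by
        rw [hE, hs]
        refine Real.exp_le_exp.2 ?_
        nlinarith
  have hJE : (J : ℝ) ≤ E := by
    have h1 : (8 * (D : ℝ) ^ 2 + 9) ≤ Real.exp (17 * D ^ 2) := by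
      have : (1 : ℝ) ≤ D ^ 2 := one_le_pow₀ hD1
      linarith [Real.add_one_le_exp (17 * (D : ℝ) ^ 2)]
    have h2 : (D : ℝ) ^ 4 ≤ 1296 * w ^ 48 := by
      calc (D : ℝ) ^ 4 ≤ (6 * w ^ 3) ^ 4 := by gcongr
        _ = 1296 * w ^ 12 := by ring
        _ ≤ 1296 * w ^ 48 := by
          gcongr
          norm_num
    rw [hJ, hE]
    push_cast
    calc (8 * (D : ℝ) ^ 2 + 9) ^ D ^ 2 ≤ Real.exp (17 * D ^ 2) ^ D ^ 2 := by gcongr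
      _ = Real.exp (17 * (D : ℝ) ^ 4) := by
        rw [← Real.exp_nat_mul]; push_cast; congr 1; ring
      _ ≤ Real.exp s := by
        refine Real.exp_le_exp.2 ?_
        rw [hs]; nlinarith
  obtain ⟨y, hy⟩ : ∃ y : ℕ, y = 2 * μ * R := ⟨_, rfl⟩
  obtain ⟨M, hM⟩ : ∃ M : ℕ, M = J * R * J := ⟨_, rfl⟩
  rw [← hy, ← hM] at hstruct
  have hE0 : 0 < E := by linarith
  have hyE : (y : ℝ) ≤ 2 * E ^ 2 := by
    rw [hy]; push_cast
    calc 2 * (μ : ℝ) * R ≤ 2 * E * E := by gcongr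
      _ = _ := by ring
  have hME : (M : ℝ) ≤ E ^ 3 := by
    rw [hM]; push_cast
    calc (J : ℝ) * R * J ≤ E * E * E := by gcongr
      _ = _ := by ring
  have hn0 : (0 : ℝ) < Fintype.card G := by exact_mod_cast Fintype.card_pos
  have hlog2 : Real.log 2 ≤ 1 := by
    linarith [Real.log_le_sub_one_of_pos (show (0 : ℝ) < 2 by norm_num)]
  have hlog : Real.log (Fintype.card G) ≤ ((y * y + y) * (y * y + y) : ℝ) + (μ + M * M) := by
    have h1 : (Fintype.card G : ℝ) ≤ 2 ^ ((y * y + y) * (y * y + y)) * (2 ^ μ * (M : ℝ) ^ M) := by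
      exact_mod_cast hstruct
    have hMM : (M : ℝ) ^ M ≤ Real.exp (M * M) := by
      rw [Real.exp_nat_mul]
      gcongr
      linarith [Real.add_one_le_exp (M : ℝ)]
    have h2e : ∀ k : ℕ, (2 : ℝ) ^ k ≤ Real.exp k := by
      intro k
      have h4 : (2 : ℝ) ≤ Real.exp 1 := by linarith [Real.add_one_le_exp 1]
      calc (2 : ℝ) ^ k ≤ Real.exp 1 ^ k := by gcongr
        _ = Real.exp k := by rw [← Real.exp_nat_mul, mul_one]
    rw [Real.log_le_iff_le_exp hn0, Real.exp_add, Real.exp_add]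
    refine h1.trans ?_
    have := h2e ((y * y + y) * (y * y + y))
    push_cast at this
    gcongr
    exact h2e μ
  refine hlog.trans ?_
  rw [← hs]
  have hexp : Real.exp (14 * s) = E ^ 14 := by
    rw [hE, ← Real.exp_nat_mul]; norm_num
  rw [hexp]
  have h1 : (y * y + y : ℝ) ≤ 6 * E ^ 4 := by
    calc (y * y + y : ℝ) ≤ 2 * E ^ 2 * (2 * E ^ 2) + 2 * E ^ 2 := by gcongr
      _ ≤ 6 * E ^ 4 := by
        have : (1 : ℝ) ≤ E ^ 2 := one_le_pow₀ (by linarith)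
        nlinarith [sq_nonneg (E ^ 2)]
  have h2 : E ≤ E ^ 8 := le_self_pow₀ (by linarith) (by norm_num)
  have h3 : E ^ 6 ≤ E ^ 8 := pow_le_pow_right₀ (by linarith) (by norm_num)
  have h4 : (64 : ℝ) ≤ E ^ 6 := by
    calc (64 : ℝ) = 2 ^ 6 := by norm_num
      _ ≤ E ^ 6 := by gcongr
  calc ((y * y + y) * (y * y + y) : ℝ) + (μ + M * M)
      ≤ 6 * E ^ 4 * (6 * E ^ 4) + (E ^ 8 + E ^ 3 * E ^ 3) := by
        gcongr
        exact hμE.trans h2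
    _ = 37 * E ^ 8 + E ^ 6 := by ring
    _ ≤ 64 * E ^ 8 := by
        have : 0 < E ^ 8 := by positivity
        linarith
    _ ≤ E ^ 6 * E ^ 8 := by gcongr
    _ = E ^ 14 := by ring

lemma exists_card_mul_loglog_le : ∃ K : ℝ, 1 ≤ K ∧ ∀ (G : Type u) [Group G] [Fintype G]
    (A : Finset G) (_ : SquareFree A) (_ : K < Real.log (Real.log (Fintype.card G))),
    (#A : ℝ) * Real.log (Real.log (Fintype.card G)) ^ (1 / 96 : ℝ) ≤ Fintype.card G := by
  obtain ⟨K, hK, hmain⟩ := exists_log_card_le.{u}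
  refine ⟨(14 * K) ^ 2, one_le_pow₀ (by linarith), ?_⟩
  intro G _ _ A hA hbig
  obtain ⟨t, ht⟩ : ∃ t, t = Real.log (Real.log (Fintype.card G)) := ⟨_, rfl⟩
  rw [← ht] at hbig ⊢
  have ht1 : 1 ≤ t := (one_le_pow₀ (by linarith : 1 ≤ 14 * K)).trans hbig.le
  -- If the density exceeded `1 / w`, then `t ≤ 14 K w ^ 48 = 14 K √t`, which bounds `t`. Halving
  -- the exponent `1 / 48` is what absorbs the constant.
  obtain ⟨w, hw⟩ : ∃ w, w = t ^ (1 / 96 : ℝ) := ⟨_, rfl⟩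
  have hw1 : 1 ≤ w := hw ▸ Real.one_le_rpow ht1 (by norm_num)
  have hw96 : w ^ 96 = t := by
    rw [hw, ← Real.rpow_natCast, ← Real.rpow_mul (by linarith)]; norm_num
  rw [← hw]
  by_contra! hcon
  have hlog := hmain G A hA w hw1 (by
    rw [one_div_mul_eq_div, div_le_iff₀ (by linarith)]; exact hcon.le)
  have hpos : 0 < Real.log (Fintype.card G) := by
    by_contra! h
    have hnn : 0 ≤ Real.log (Fintype.card G) := Real.log_natCast_nonneg _
    have h0 : Real.log (Fintype.card G) = 0 := le_antisymm h hnn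
    rw [h0, Real.log_zero] at ht
    linarith
  have h1 : t ≤ 14 * (K * w ^ 48) := by
    rw [ht]; exact (Real.log_le_iff_le_exp hpos).2 hlog
  have h2 : w ^ 48 ≤ 14 * K := by
    have h3 : 0 < w ^ 48 := by positivity
    refine le_of_mul_le_mul_right ?_ h3
    calc w ^ 48 * w ^ 48 = t := by rw [← hw96]; ring
      _ ≤ _ := by linarith
  have h3 : t ≤ (14 * K) ^ 2 := by
    calc t = (w ^ 48) ^ 2 := by rw [← hw96]; ring
      _ ≤ _ := by gcongr
  linarith

end Main

theorem theorem1p2 :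
    ∃ c : ℝ, 0 < c ∧
      ∀ (G : Type*) [Group G] [Finite G] (A : Finset G),
        3 ≤ Nat.card G →
        (∀ x ∈ A, ∀ y ∈ A, ∀ z ∈ A, x * z = y ^ 2 → x = y) →
          (A.card : ℝ) ≤ (Nat.card G : ℝ) / (Real.log (Real.log (Nat.card G : ℝ))) ^ c := by
  obtain ⟨K₁, hK₁, hmain⟩ := exists_card_mul_loglog_le
  obtain ⟨K, hK⟩ : ∃ K, K = K₁ + Real.exp 1 := ⟨_, rfl⟩
  have hKe : Real.exp 1 ≤ K := by linarith
  have hK0 : 0 < K := (Real.exp_pos 1).trans_le hKe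
  have hlogK : 1 ≤ Real.log K := (Real.le_log_iff_exp_le hK0).2 hKe
  obtain ⟨N, hN⟩ : ∃ N, N = Real.exp (Real.exp K) := ⟨_, rfl⟩
  have hN0 : 0 < N := hN ▸ Real.exp_pos _
  -- For orders up to `N` only `|A| ≤ n - 1` is available, so the exponent is chosen with `K ^ c₁ =
  -- 1 + 1 / N`; then `(n - 1)(1 + 1 / n) < n` suffices.
  obtain ⟨c₁, hc₁⟩ : ∃ c₁, c₁ = Real.log (1 + 1 / N) / Real.log K := ⟨_, rfl⟩
  have hc₁0 : 0 < c₁ := by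
    rw [hc₁]
    have : 0 < 1 / N := by positivity
    exact div_pos (Real.log_pos (by linarith)) (by linarith)
  have hKc : K ^ c₁ = 1 + 1 / N := by
    rw [Real.rpow_def_of_pos hK0, hc₁, mul_div_cancel₀ _ (by linarith), Real.exp_log (by positivity)]
  refine ⟨min (1 / 96) c₁, lt_min (by norm_num) hc₁0, ?_⟩
  intro G _ _ A hG hA
  have := Fintype.ofFinite G
  rw [Nat.card_eq_fintype_card] at hG ⊢
  obtain ⟨n, hn⟩ : ∃ n : ℝ, n = Fintype.card G := ⟨_, rfl⟩
  have hn3 : 3 ≤ n := by rw [hn]; exact_mod_cast hG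
  have hAn : (A.card : ℝ) + 1 ≤ n := by
    rw [hn]; exact_mod_cast SquareFree.card_lt hA (by omega)
  -- This is where order at least `3` matters: `e < 3` makes the iterated logarithm positive.
  have hlogn : 1 < Real.log n := by
    rw [Real.lt_log_iff_exp_lt (by linarith)]
    linarith [Real.exp_one_lt_d9]
  obtain ⟨t, ht⟩ : ∃ t, t = Real.log (Real.log n) := ⟨_, rfl⟩
  have ht0 : 0 < t := ht ▸ Real.log_pos hlogn
  have hm := hmain G A hA
  rw [← hn, ← ht] at hm
  rw [← hn, ← ht, le_div_iff₀ (Real.rpow_pos_of_pos ht0 _)]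
  have hc0 : 0 ≤ min (1 / 96) c₁ := le_min (by norm_num) hc₁0.le
  have hA0 : (0 : ℝ) ≤ A.card := Nat.cast_nonneg _
  rcases le_or_gt t 1 with h1 | h1
  · have : t ^ min (1 / 96) c₁ ≤ 1 := Real.rpow_le_one ht0.le h1 hc0
    nlinarith
  rcases lt_or_ge K₁ t with h2 | h2
  · refine le_trans ?_ (hm h2)
    gcongr
    · exact h1.le
    · exact min_le_left _ _
  · have hnN : n ≤ N := by
      have htK : t ≤ K := by linarith [Real.exp_pos 1]
      rw [hN, ← Real.log_le_iff_le_exp (by linarith), ← Real.log_le_iff_le_exp (by linarith), ← ht]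
      exact htK
    have h3 : t ^ min (1 / 96) c₁ ≤ 1 + 1 / n := by
      calc t ^ min (1 / 96) c₁ ≤ t ^ c₁ :=
            Real.rpow_le_rpow_of_exponent_le h1.le (min_le_right _ _)
        _ ≤ K ^ c₁ := Real.rpow_le_rpow ht0.le (by linarith [Real.exp_pos 1]) hc₁0.le
        _ = 1 + 1 / N := hKc
        _ ≤ 1 + 1 / n := by gcongr
    have hn0 : 0 < n := by linarith
    calc (A.card : ℝ) * t ^ min (1 / 96) c₁ ≤ (n - 1) * (1 + 1 / n) := by
          refine mul_le_mul (by linarith) h3 (Real.rpow_nonneg ht0.le _) (by linarith)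
      _ = n - 1 / n := by field_simp; ring
      _ ≤ n := by
        have : 0 < 1 / n := by positivity
        linarith
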